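/- **Lemma (Shifting).** Let $D\subset\mathbb R^3$ be a bounded domain (non-empty, open, connected) with Lipschitz boundary, surface measure $\sigma$ and outward unit normal $\nu$ on $\partial D$, and let $\lambda\in\mathbb R$, $|\lambda|>1/2$. Let $\mathcal K_D^*$ be the operator on $L^2(\partial D)$ given by the principal value $$\mathcal K_D^*[\phi](x)=\frac1{4\pi}\,\mathrm{p.v.}\!\int_{\partial D}\frac{\langle x-y,\nu(x)\rangle}{|x-y|^3}\,\phi(y)\,d\sigma(y).$$ For $y=r_y(\cos\varphi_y\sin\theta_y,\sin\varphi_y\sin\theta_y,\cos\theta_y)$, $n\ge0$ and $-n\le m\le n$, put $$Y_n^m(\theta,\varphi)=(-1)^m\Big[\tfrac{2n+1}{4\pi}\tfrac{(n-m)!}{(n+m)!}\Big]^{1/2}e^{im\varphi}P_n^m(\cos\theta),\qquad P_n^m(x)=\tfrac{(-1)^m}{2^n n!}(1-x^2)^{m/2}\tfrac{d^{n+m}}{dx^{n+m}}(x^2-1)^n .$$ For $l,n\ge1$ let $\mathbf M_{ln}(D)$ be the $(2l+1)\times(2n+1)$ matrix with entries, for $-l\le k\le l$ and $-n\le m\le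 n$, $$(\mathbf M_{ln}(D))_{km}=\int_{\partial D}r_y^l\,\overline{Y_l^k(\theta_y,\varphi_y)}\;(\lambda I-\mathcal K_D^*)^{-1}\Big[\frac{\partial}{\partial\nu}\,r^nY_n^m(\theta,\varphi)\Big|_{\partial D}\Big](y)\,d\sigma(y).$$ For $z=r_z(\cos\varphi_z\sin\theta_z,\sin\varphi_z\sin\theta_z,\cos\theta_z)\in\mathbb R^3$ let $\mathbf G_{li}(z)$ be the $(2l+1)\times(2i+1)$ matrix with entries, for $-l\le k\le l$ and $-i\le j\le i$, $$(\mathbf G_{li}(z))_{kj}=\begin{cases}C_{ijlk}\,r_z^{l-i}\,Y_{l-i}^{k-j}(\theta_z,\varphi_z)&\text{if }\max(-i,i-l+k)\le j\le\min(i,-i+l+k),\\0&\text{otherwise,}\end{cases}$$ $$C_{\nu\mu nm}=\Big[\frac{4\pi(2n+1)(n-m)!(n+m)!}{(2n-2\nu+1)(2\nu+1)(n-\nu-m+\mu)!(n-\nu+m-\mu)!(\nu-\mu)!(\nu+\mu)!}\Big]^{1/2}.$$ Then for all positive integers $l,n$ and all $z\in\mathbb R^3$, with $D_z=\{x+z: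 x\in D\}$, $$\mathbf M_{ln}(D_z)=\sum_{i=1}^{l}\sum_{\nu=1}^{n}\overline{\mathbf G_{li}(z)}\,\mathbf M_{i\nu}(D)\,\mathbf G_{n\nu}(z)^t ,$$ and $\mathbf G_{nn}(z)$ is the identity matrix of size $2n+1$ for every $n$. -/

import Mathlib

noncomputable section

namespace CGPT

open MeasureTheory Filter Topology
open scoped NNReal ENNReal

/-- Euclidean three-space. -/
abbrev E3 : Type := EuclideanSpace ℝ (Fin 3)

/-! ### Bounded Lipschitz domains, surface measure and outward normal -/

/-- `D` has Lipschitz boundary: near each boundary point, in suitable orthonormal coordinates,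
`D` is the set of points lying strictly above the graph of a Lipschitz function. -/
def HasLipschitzBoundary (D : Set E3) : Prop :=
  ∀ p ∈ frontier D, ∃ (e : E3 ≃ₗᵢ[ℝ] E3) (r : ℝ) (K : ℝ≥0) (f : EuclideanSpace ℝ (Fin 2) → ℝ),
    0 < r ∧ LipschitzWith K f ∧
      ∀ x ∈ Metric.ball p r, (x ∈ D ↔ f !₂[e x 0, e x 1] < e x 2)

/-- A bounded domain (non-empty connected open set) with Lipschitz boundary. -/
structure IsBoundedLipschitzDomain (D : Set E3) : Prop where
  isOpen : IsOpen D
  isConnected : IsConnected D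
  isBounded : Bornology.IsBounded D
  lipschitzBoundary : HasLipschitzBoundary D

/-- The surface measure `σ` on `∂D`: two-dimensional Hausdorff measure, normalized so that it is
Lebesgue measure on planes, restricted to the boundary. -/
def surfaceMeasure (D : Set E3) : Measure E3 :=
  (Measure.euclideanHausdorffMeasure 2 : Measure E3).restrict (frontier D)

/-- `v` is the unit outward normal to `D` at `x`: close to `x`, every cone around `-v` of opening
less than a half-space lies in `D`, and every such cone around `v` lies outside `D`. Where `∂D` is
the graph of a function this says that the function is differentiable and `v` is orthogonal to
the tangent plane, pointing out of `D`. -/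
def IsOutwardNormal (D : Set E3) (x v : E3) : Prop :=
  ‖v‖ = 1 ∧ ∀ δ : ℝ, 0 < δ → ∀ᶠ y in 𝓝 x,
    (inner ℝ (y - x) v < -(δ * ‖y - x‖) → y ∈ D) ∧
    (δ * ‖y - x‖ < inner ℝ (y - x) v → y ∉ D)

open Classical in
/-- The unit outward normal field (zero on the null set where there is no tangent plane). -/
def outwardNormal (D : Set E3) (x : E3) : E3 :=
  if h : ∃ v, IsOutwardNormal D x v then h.choose else 0

/-! ### The adjoint Neumann-Poincaré operator -/

/-- The space `L²(∂D)` of complex densities. -/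
abbrev L2 (D : Set E3) : Type := Lp ℂ 2 (surfaceMeasure D)

/-- The integral defining `K_D^*[φ](x)`, truncated to `|x - y| > ε`. -/
def truncatedNPAdjoint (D : Set E3) (ε : ℝ) (φ : E3 → ℂ) (x : E3) : ℂ :=
  (1 / (4 * Real.pi) : ℝ) *
    ∫ y in {y : E3 | ε < ‖x - y‖},
      ((inner ℝ (x - y) (outwardNormal D x) / ‖x - y‖ ^ 3 : ℝ) : ℂ) * φ y ∂(surfaceMeasure D)

/-- `T` is the principal value operator: `T φ` is the limit of the truncated integrals as
`ε → 0⁺`, almost everywhere on `∂D` and in `L²(∂D)`. At most one `T` has this property. -/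
def IsNPAdjoint (D : Set E3) (T : L2 D →L[ℂ] L2 D) : Prop :=
  ∀ φ : L2 D,
    (∀ᵐ x ∂(surfaceMeasure D),
      Tendsto (fun ε : ℝ => truncatedNPAdjoint D ε φ x) (𝓝[>] 0) (𝓝 (T φ x))) ∧
    Tendsto (fun ε : ℝ => eLpNorm (fun x => truncatedNPAdjoint D ε φ x - T φ x) 2
      (surfaceMeasure D)) (𝓝[>] 0) (𝓝 0)

open Classical in
/-- The operator `K_D^*` on `L²(∂D)`. -/
def npAdjoint (D : Set E3) : L2 D →L[ℂ] L2 D :=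
  if h : ∃ T, IsNPAdjoint D T then h.choose else 0

/-- `(λ I - K_D^*)⁻¹` as a bounded operator on `L²(∂D)`. -/
def npResolvent (lam : ℝ) (D : Set E3) : L2 D →L[ℂ] L2 D :=
  Ring.inverse ((lam : ℂ) • (1 : L2 D →L[ℂ] L2 D) - npAdjoint D)

/-! ### Spherical harmonics -/

/-- Associated Legendre function of order `m ≥ 0`, by Rodrigues' formula and with the
Condon-Shortley phase:
`(-1)^m (1 - x²)^{m/2} / (2^n n!) * d^{n+m}/dx^{n+m} (x² - 1)^n`. -/
def assocLegendreNat (n m : ℕ) (x : ℝ) : ℝ :=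
  (-1) ^ m * Real.sqrt (1 - x ^ 2) ^ m / (2 ^ n * (n.factorial : ℝ)) *
    (Polynomial.derivative^[n + m] ((Polynomial.X ^ 2 - 1 : Polynomial ℝ) ^ n)).eval x

/-- Associated Legendre function `P_n^m`, `-n ≤ m ≤ n`, with
`P_n^{-m} = (-1)^m (n-m)!/(n+m)! P_n^m`. -/
def assocLegendre (n : ℕ) (m : ℤ) (x : ℝ) : ℝ :=
  if 0 ≤ m then assocLegendreNat n m.toNat x
  else (-1) ^ m.natAbs * ((n - m.natAbs).factorial : ℝ) / ((n + m.natAbs).factorial : ℝ) *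
    assocLegendreNat n m.natAbs x

/-- The factorial of a non-negative integer. -/
def intFactorial (a : ℤ) : ℝ := (a.toNat.factorial : ℝ)

/-- The complex spherical harmonic `Y_n^m(θ, φ)`. -/
def sphericalHarmonic (n : ℕ) (m : ℤ) (θ φ : ℝ) : ℂ :=
  (-1) ^ m *
    (Real.sqrt ((2 * n + 1) / (4 * Real.pi) * (intFactorial (n - m) / intFactorial (n + m))) : ℝ) *
    Complex.exp (Complex.I * m * φ) * (assocLegendre n m (Real.cos θ) : ℝ)

/-- Polar angle of `x = r (cos φ sin θ, sin φ sin θ, cos θ)`. -/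
def polarAngle (x : E3) : ℝ := Real.arccos (x 2 / ‖x‖)

/-- Azimuth of `x = r (cos φ sin θ, sin φ sin θ, cos θ)`. -/
def azimuth (x : E3) : ℝ := Complex.arg (x 0 + x 1 * Complex.I)

/-- The regular solid harmonic `r^n Y_n^m(θ, φ)` as a function on `ℝ³`. -/
def solidHarmonic (n : ℕ) (m : ℤ) (x : E3) : ℂ :=
  (‖x‖ : ℂ) ^ n * sphericalHarmonic n m (polarAngle x) (azimuth x)

/-! ### Contracted generalized polarization tensors -/

/-- The normal derivative on `∂D` of a function `h` given near `∂D`. -/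
def normalDerivative (D : Set E3) (h : E3 → ℂ) (y : E3) : ℂ :=
  fderiv ℝ h y (outwardNormal D y)

open Classical in
/-- The normal derivative as an element of `L²(∂D)`. -/
def normalDerivativeL2 (D : Set E3) (h : E3 → ℂ) : L2 D :=
  if hm : MemLp (normalDerivative D h) 2 (surfaceMeasure D) then hm.toLp else 0

/-- The contracted generalized polarization tensor `M_{nmlk}(D)`. -/
def cgpt (lam : ℝ) (D : Set E3) (n : ℕ) (m : ℤ) (l : ℕ) (k : ℤ) : ℂ :=
  ∫ y, starRingEnd ℂ (solidHarmonic l k y) *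
    npResolvent lam D (normalDerivativeL2 D (solidHarmonic n m)) y ∂(surfaceMeasure D)

/-- The index set `{-l, …, l}`. -/
abbrev Ord (l : ℕ) : Type := ↥(Finset.Icc (-(l : ℤ)) (l : ℤ))

/-- The `(2l+1) × (2n+1)` matrix `M_{ln}(D)`, with `(M_{ln})_{km} = M_{nmlk}`. -/
def cgptMatrix (lam : ℝ) (D : Set E3) (l n : ℕ) : Matrix (Ord l) (Ord n) ℂ :=
  Matrix.of fun k m => cgpt lam D n m l k

/-! ### Shifts -/

/-- The shifted set `D_z = {x + z | x ∈ D}`. -/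
def shift (z : E3) (D : Set E3) : Set E3 := (fun x => x + z) '' D

/-- The coefficient `C_{νμnm}` of the translation formula for regular solid harmonics. -/
def shiftCoeff (ν μ n m : ℤ) : ℝ :=
  Real.sqrt
    (4 * Real.pi * (2 * n + 1) * intFactorial (n - m) * intFactorial (n + m) /
      ((2 * n - 2 * ν + 1) * (2 * ν + 1) *
        intFactorial (n - ν - m + μ) * intFactorial (n - ν + m - μ) *
        intFactorial (ν - μ) * intFactorial (ν + μ)))

/-- The `(2l+1) × (2i+1)` matrix `G_{li}(z)`. The index condition forces `i ≤ l`, so `l - i` is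
the true difference whenever it is used. -/
def shiftMatrix (l i : ℕ) (z : E3) : Matrix (Ord l) (Ord i) ℂ :=
  Matrix.of fun k j =>
    if max (-(i : ℤ)) (i - l + k) ≤ (j : ℤ) ∧ (j : ℤ) ≤ min (i : ℤ) (-i + l + k) then
      (shiftCoeff i j l k : ℂ) * solidHarmonic (l - i) (k - j) z
    else 0

end CGPT

end

noncomputable section

namespace CGPT

open MeasureTheory Filter Topology
open scoped NNReal ENNReal

/-! ### Solid harmonics: generating polynomial and addition theorem -/

/-! The proof combines translation invariance, an addition theorem for solid harmonics, and a
conservation law that removes the terms of degree zero.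

Pulling back along x ↦ x + z identifies ∂D_z with ∂D, together with surface measure, normal field,
K* and its resolvent. So M(D_z) is an integral over ∂D in which both solid harmonics are replaced by
their translates (`cgpt_shift`). These expand with coefficients G(z) (`solidHarmonic_add`), which is
the binomial theorem in disguise: up to a constant, r^n Y_n^m at x is coefficient n + m of the n-th
power of the quadratic polynomial `genPoly x`, and `genPoly` is additive in x. By linearity the
asserted double sum appears, except that both degrees start at 0.

The term ν = 0 vanishes because constants have zero normal derivative. The term i = 0 is a multiple
of the mean of ψ = (λ - K*)⁻¹[∂h/∂ν] with h harmonic. The mean of ∂h/∂ν is zero by the divergence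
theorem, and K* multiplies means by 1/2 (`integral_npAdjoint`), so (λ - 1/2) mean ψ = 0 and ψ has
mean zero.

The factor 1/2 is Gauss' solid angle. The kernel has size up to |x - y|⁻², too singular on a surface
for a direct use of Fubini. Instead the truncations at radius εs are averaged over s against a
probability density chosen to turn ⟨x - y, ν⟩/|x - y|³ into ⟨x - y, ν⟩(|x - y|² + ε²)^(-3/2). The
flux of this smooth field is a regularized solid angle, which tends to 2π, half of 4π, at every
boundary point with a normal.

The divergence theorem on Lipschitz domains rests on the area formula for Lipschitz graphs,
Rademacher's theorem and a partition of unity. Neither existence of K* nor invertibility of λ - K*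
has to be established: the default value 0 of either operator is compatible with translations and
with vanishing means. -/

open Polynomial in
/-- The quadratic polynomial `w X² / 2 + z X - v / 2`, whose powers generate solid harmonics. -/
def harmonicQuadratic (w v z : ℂ) : ℂ[X] := C (w / 2) * X ^ 2 + C z * X - C (v / 2)

/-- The complex number `x₀ + i x₁`. -/
def planar (x : E3) : ℂ := x 0 + x 1 * Complex.I

/-- The generating polynomial of the solid harmonics at the point `x`. -/
def genPoly (x : E3) : Polynomial ℂ :=
  harmonicQuadratic (planar x) (starRingEnd ℂ (planar x)) (x 2)

open Polynomial in
theorem natDegree_harmonicQuadratic_le (w v z : ℂ) : (harmonicQuadratic w v z).natDegree ≤ 2 := by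
  unfold harmonicQuadratic
  compute_degree

theorem natDegree_genPoly_pow_le (x : E3) (n : ℕ) : (genPoly x ^ n).natDegree ≤ 2 * n := by
  refine Polynomial.natDegree_pow_le.trans ?_
  have := natDegree_harmonicQuadratic_le (planar x) (starRingEnd ℂ (planar x)) (x 2)
  unfold genPoly
  nlinarith

open Polynomial in
/-- Rodrigues' formula in terms of Taylor coefficients: the upper coefficients of the powers of
`harmonicQuadratic` are Taylor coefficients of `(X² - 1)^n`. -/
theorem coeff_harmonicQuadratic_pow (n μ : ℕ) {w v z r c : ℂ} (hr : r ≠ 0) (hz : z = r * c)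
    (hwv : w * v = r ^ 2 - z ^ 2) :
    2 ^ n * (harmonicQuadratic w v z ^ n).coeff (n + μ) * r ^ μ =
      r ^ n * w ^ μ * ((((X + C c) ^ 2 - 1 : ℂ[X])) ^ n).coeff (n + μ) := by
  -- On the axis w = 0 the substitution used below is not available. There c = ±1, both sides vanish
  -- for μ > 0, and for μ = 0 both reduce to a power of z.
  rcases eq_or_ne w 0 with rfl | hw
  · have hc : c ^ 2 = 1 := by
      have h : r ^ 2 * (1 - c ^ 2) = 0 := by rw [hz] at hwv; linear_combination -hwv
      have := (mul_eq_zero.1 h).resolve_left (pow_ne_zero 2 hr)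
      linear_combination -this
    have h1 : ((X + C c) ^ 2 - 1 : ℂ[X]) = X * (X + C (2 * c)) := by
      have : (C c : ℂ[X]) ^ 2 = 1 := by rw [← C_pow, hc, C_1]
      rw [C_mul, C_ofNat]
      linear_combination this
    rcases Nat.eq_zero_or_pos μ with rfl | hμ
    · have h2 : harmonicQuadratic 0 v z = C z * X + C (-(v / 2)) := by
        simp [harmonicQuadratic, sub_eq_add_neg]
      have h3 : (harmonicQuadratic 0 v z ^ n).coeff n = z ^ n := by
        have hd : (harmonicQuadratic 0 v z).natDegree ≤ 1 := by
          rw [h2]; exact natDegree_linear_le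
        have := coeff_pow_of_natDegree_le (m := n) hd
        rw [mul_one] at this
        rw [this, h2]
        simp
      rw [h1, mul_pow, add_zero, h3, coeff_X_pow_mul', if_pos le_rfl, Nat.sub_self,
        coeff_zero_eq_eval_zero, hz]
      simp
      ring
    · have h2 : (harmonicQuadratic 0 v z ^ n).coeff (n + μ) = 0 := by
        apply coeff_eq_zero_of_natDegree_lt
        refine lt_of_le_of_lt natDegree_pow_le ?_
        have hd : (harmonicQuadratic 0 v z).natDegree ≤ 1 := by
          have : harmonicQuadratic 0 v z = C z * X + C (-(v / 2)) := by
            simp [harmonicQuadratic, sub_eq_add_neg]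
          rw [this]; exact natDegree_linear_le
        nlinarith
      rw [h2, zero_pow hμ.ne']
      ring
  -- Complete the square: 2w(wX²/2 + zX - v/2) = (wX + z)² - r², which is r²((Y + c)² - 1) at Y =
  -- (w/r)X.
  · have h1 : C (2 * w) * harmonicQuadratic w v z =
        C (r ^ 2) * ((X + C c) ^ 2 - 1 : ℂ[X]).comp (C (w / r) * X) := by
      have e1 : (C w * C v : ℂ[X]) = C r ^ 2 - C z ^ 2 := by
        rw [← C_mul, hwv]; simp
      have e2 : (C z : ℂ[X]) = C r * C c := by rw [hz, C_mul]
      have e3 : (C r * C (w / r) : ℂ[X]) = C w := by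
        rw [← C_mul]; congr 1; field_simp
      have e4 : (C 2 * C (w / 2) : ℂ[X]) = C w := by
        rw [← C_mul]; congr 1; field_simp
      have e5 : (C 2 * C (v / 2) : ℂ[X]) = C v := by
        rw [← C_mul]; congr 1; field_simp
      simp only [harmonicQuadratic, sub_comp, pow_comp, add_comp, X_comp, C_comp, one_comp, C_mul,
        C_pow]
      rw [show (C r : ℂ[X]) ^ 2 * ((C (w / r) * X + C c) ^ 2 - 1) =
        ((C r * C (w / r)) * X + C r * C c) ^ 2 - C r ^ 2 by ring, e3, ← e2]
      simp only [C_ofNat] at e4 e5 ⊢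
      linear_combination (C w * X ^ 2) * e4 - C w * e5 - e1
    have h2 := congrArg (fun p => (p ^ n).coeff (n + μ)) h1
    simp only [mul_pow, ← C_pow, coeff_C_mul, ← pow_comp, comp_C_mul_X_coeff] at h2
    have hw' : w ^ n ≠ 0 := pow_ne_zero _ hw
    apply mul_left_cancel₀ hw'
    rw [div_pow, ← pow_mul, pow_add, pow_add r] at h2
    calc _ = ((2 * w) ^ n * (harmonicQuadratic w v z ^ n).coeff (n + μ)) * r ^ μ := by
            rw [mul_pow]; ring
      _ = _ := by
        rw [mul_pow, h2, pow_mul' r 2 n]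
        field_simp

-- Substituting -X for X and then reversing the three coefficients exchanges w and v and changes the
-- overall sign. Since reversal is multiplicative, the same holds for powers, so negative orders
-- reduce to positive ones.
open Polynomial in
theorem coeff_harmonicQuadratic_pow_symm (n μ : ℕ) (hμ : μ ≤ n) (w v z : ℂ) :
    (harmonicQuadratic w v z ^ n).coeff (n - μ) =
      (-1) ^ μ * (harmonicQuadratic v w z ^ n).coeff (n + μ) := by
  have hdeg : ((harmonicQuadratic w v z).comp (C (-1) * X)).natDegree ≤ 2 := by
    unfold harmonicQuadratic
    simp only [sub_comp, add_comp, mul_comp, C_comp, pow_comp, X_comp]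
    compute_degree
  have hrefl : ∀ k : ℕ, reflect (2 * k) (((harmonicQuadratic w v z).comp (C (-1) * X)) ^ k) =
      (-harmonicQuadratic v w z) ^ k := by
    intro k
    induction k with
    | zero => simp
    | succ k ih =>
      rw [pow_succ, pow_succ, mul_add, mul_one, reflect_mul _ _ _ hdeg, ih]
      · congr 1
        ext i
        rw [coeff_reflect]
        by_cases hi : i ≤ 2
        · rw [revAt_le hi]
          interval_cases i <;>
            simp [harmonicQuadratic, coeff_X, coeff_C, coeff_X_pow]
        · have h2 : ¬ (i ≤ 2) := hi
          have h3 : revAt 2 i = i := by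
            change (if i ≤ 2 then 2 - i else i) = i
            rw [if_neg h2]
          rw [h3, coeff_eq_zero_of_natDegree_lt (by omega), coeff_neg,
            coeff_eq_zero_of_natDegree_lt
              (by have := natDegree_harmonicQuadratic_le v w z; omega), neg_zero]
      · refine natDegree_pow_le.trans ?_
        nlinarith
  have h := congrArg (fun p => p.coeff (n + μ)) (hrefl n)
  simp only [coeff_reflect] at h
  rw [revAt_le (by omega), show 2 * n - (n + μ) = n - μ by omega, ← pow_comp, comp_C_mul_X_coeff,
    neg_pow (harmonicQuadratic v w z), ← C_1, ← C_neg, ← C_pow, coeff_C_mul] at h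
  have h1 : ((-1 : ℂ) ^ (n - μ)) * (-1) ^ (n - μ) = 1 := by
    rw [← mul_pow]; simp
  have h2 : ((-1 : ℂ) ^ n) = (-1) ^ (n - μ) * (-1) ^ μ := by
    rw [← pow_add]; congr 1; omega
  calc _ = ((-1 : ℂ) ^ (n - μ)) * ((harmonicQuadratic w v z ^ n).coeff (n - μ) * (-1) ^ (n - μ)) := by
        linear_combination -(harmonicQuadratic w v z ^ n).coeff (n - μ) * h1
    _ = _ := by
        rw [h, h2]
        linear_combination ((-1) ^ μ * (harmonicQuadratic v w z ^ n).coeff (n + μ)) * h1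

/-- The Rodrigues derivative is a multiple of a Taylor coefficient. -/
theorem assocLegendreNat_eq_coeff (n μ : ℕ) (c : ℝ) :
    (assocLegendreNat n μ c : ℂ) =
      (-1) ^ μ * (Real.sqrt (1 - c ^ 2) : ℂ) ^ μ / (2 ^ n * (n.factorial : ℂ)) *
        ((n + μ).factorial *
          ((((Polynomial.X + Polynomial.C (c : ℂ)) ^ 2 - 1 : Polynomial ℂ)) ^ n).coeff (n + μ)) := by
  have h : (Polynomial.derivative^[n + μ] ((Polynomial.X ^ 2 - 1 : Polynomial ℝ) ^ n)).eval c =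
      (n + μ).factorial *
        ((((Polynomial.X + Polynomial.C c) ^ 2 - 1 : Polynomial ℝ)) ^ n).coeff (n + μ) := by
    rw [← Polynomial.factorial_smul_hasseDeriv, LinearMap.smul_apply, Polynomial.eval_smul,
      ← Polynomial.taylor_coeff, Polynomial.taylor_apply]
    simp
  have h2 : ((((((Polynomial.X + Polynomial.C c) ^ 2 - 1 : Polynomial ℝ)) ^ n).coeff (n + μ) : ℝ) : ℂ)
      = ((((Polynomial.X + Polynomial.C (c : ℂ)) ^ 2 - 1 : Polynomial ℂ)) ^ n).coeff (n + μ) := by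
    have := Polynomial.coeff_map (Complex.ofRealHom)
      (p := (((Polynomial.X + Polynomial.C c) ^ 2 - 1 : Polynomial ℝ)) ^ n) (n + μ)
    simp at this
    exact this.symm
  rw [assocLegendreNat, h, ← h2]
  push_cast
  ring

/-! ### Polar coordinates and the coefficient formula for solid harmonics -/

theorem norm_sq_eq_coords (x : E3) : ‖x‖ ^ 2 = x 0 ^ 2 + x 1 ^ 2 + x 2 ^ 2 := by
  rw [EuclideanSpace.norm_sq_eq, Fin.sum_univ_three]
  simp

theorem planar_mul_conj (x : E3) :
    planar x * starRingEnd ℂ (planar x) = (‖x‖ : ℂ) ^ 2 - (x 2 : ℂ) ^ 2 := by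
  have h := norm_sq_eq_coords x
  have h' : (‖x‖ : ℂ) ^ 2 = (x 0 : ℂ) ^ 2 + (x 1 : ℂ) ^ 2 + (x 2 : ℂ) ^ 2 := by exact_mod_cast h
  rw [h', planar]
  simp only [map_add, map_mul, Complex.conj_ofReal, Complex.conj_I]
  linear_combination (-(x 1 : ℂ) ^ 2) * Complex.I_sq

theorem norm_planar_sq (x : E3) : ‖planar x‖ ^ 2 = ‖x‖ ^ 2 - x 2 ^ 2 := by
  have h := planar_mul_conj x
  rw [Complex.mul_conj, Complex.normSq_eq_norm_sq] at h
  exact_mod_cast h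

theorem cos_polarAngle (x : E3) : Real.cos (polarAngle x) = x 2 / ‖x‖ := by
  have h : |x 2| ≤ ‖x‖ := by
    simpa using EuclideanSpace.norm_eq x ▸ PiLp.norm_apply_le x 2
  rw [polarAngle, Real.cos_arccos]
  · rw [← neg_le_neg_iff, neg_neg, ← neg_div]
    exact div_le_one_of_le₀ ((neg_le_abs _).trans h) (norm_nonneg _)
  · exact div_le_one_of_le₀ ((le_abs_self _).trans h) (norm_nonneg _)

theorem norm_mul_sin_polarAngle (x : E3) (hx : x ≠ 0) :
    ‖x‖ * Real.sqrt (1 - (x 2 / ‖x‖) ^ 2) = ‖planar x‖ := by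
  have hx' : 0 < ‖x‖ := norm_pos_iff.2 hx
  rw [← Real.sqrt_sq (norm_nonneg (planar x)), norm_planar_sq, ← Real.sqrt_sq hx'.le,
    ← Real.sqrt_mul (sq_nonneg _), Real.sqrt_sq hx'.le]
  congr 1
  field_simp

theorem norm_planar_mul_exp (x : E3) :
    (‖planar x‖ : ℂ) * Complex.exp (Complex.I * azimuth x) = planar x := by
  rw [mul_comm Complex.I]
  exact Complex.norm_mul_exp_arg_mul_I (planar x)

theorem norm_planar_mul_exp_neg (x : E3) :
    (‖planar x‖ : ℂ) * Complex.exp (-(Complex.I * azimuth x)) = starRingEnd ℂ (planar x) := by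
  conv_rhs => rw [← norm_planar_mul_exp x]
  rw [map_mul, Complex.conj_ofReal, ← Complex.exp_conj]
  simp

/-- A complex exponential `E` of modulus one with `E |w| = W`, times an associated Legendre
function, is an upper coefficient of `harmonicQuadratic`. -/
theorem pow_mul_assocLegendreNat (n μ : ℕ) (x : E3) (hx : x ≠ 0) {E W V : ℂ}
    (hE : (‖planar x‖ : ℂ) * E = W) (hWV : W * V = (‖x‖ : ℂ) ^ 2 - (x 2 : ℂ) ^ 2) :
    (‖x‖ : ℂ) ^ n * (E ^ μ * (assocLegendreNat n μ (x 2 / ‖x‖) : ℂ)) =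
      (-1) ^ μ * ((n + μ).factorial / n.factorial) *
        (harmonicQuadratic W V (x 2) ^ n).coeff (n + μ) := by
  have hx' : (‖x‖ : ℂ) ≠ 0 := by exact_mod_cast (norm_pos_iff.2 hx).ne'
  have hz : (x 2 : ℂ) = (‖x‖ : ℂ) * ((x 2 / ‖x‖ : ℝ) : ℂ) := by push_cast; field_simp
  have key := coeff_harmonicQuadratic_pow n μ hx' hz hWV
  have hs : (‖x‖ : ℂ) * (Real.sqrt (1 - (x 2 / ‖x‖) ^ 2) : ℂ) = ‖planar x‖ := by
    exact_mod_cast norm_mul_sin_polarAngle x hx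
  rw [assocLegendreNat_eq_coeff]
  set τ := ((((Polynomial.X + Polynomial.C ((x 2 / ‖x‖ : ℝ) : ℂ)) ^ 2 - 1 : Polynomial ℂ)) ^ n).coeff
    (n + μ)
  set q := (harmonicQuadratic W V (x 2) ^ n).coeff (n + μ)
  set s := (Real.sqrt (1 - (x 2 / ‖x‖) ^ 2) : ℂ)
  have hf : (n.factorial : ℂ) ≠ 0 := by exact_mod_cast n.factorial_ne_zero
  apply mul_left_cancel₀ (pow_ne_zero μ hx')
  have e1 : (‖x‖ : ℂ) ^ μ * s ^ μ * E ^ μ = W ^ μ := by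
    rw [← mul_pow, ← mul_pow, hs, hE]
  calc _ = (-1) ^ μ * ((n + μ).factorial / n.factorial) / 2 ^ n *
        ((‖x‖ : ℂ) ^ n * ((‖x‖ : ℂ) ^ μ * s ^ μ * E ^ μ) * τ) := by
        field_simp
    _ = _ := by
        rw [e1, ← key]
        field_simp

/-- Normalizing constant of the solid harmonics. -/
def harmonicNorm (n m : ℤ) : ℝ :=
  Real.sqrt ((2 * n + 1) / (4 * Real.pi) * (intFactorial (n - m) * intFactorial (n + m)))

theorem intFactorial_pos (a : ℤ) : 0 < intFactorial a := by
  unfold intFactorial; positivity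

theorem sqrt_div_mul_self {A p q : ℝ} (hq : 0 < q) :
    Real.sqrt (A * (p / q)) * q = Real.sqrt (A * (p * q)) := by
  conv_lhs => rw [← Real.sqrt_sq hq.le]
  rw [← Real.sqrt_mul' _ (sq_nonneg _), Real.sqrt_sq hq.le]
  congr 1
  field_simp

/-- The sign (-1)^m of Y cancels the Condon-Shortley phase, and the factorials from Rodrigues'
formula turn the quotient under the root into a product symmetric in ±m. One formula therefore
serves both signs of m and is free of angles. -/
theorem solidHarmonic_eq_coeff (n : ℕ) (m : ℤ) (hm : -(n : ℤ) ≤ m) (hm' : m ≤ n) (x : E3) :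
    solidHarmonic n m x =
      harmonicNorm n m / n.factorial * (genPoly x ^ n).coeff (n + m).toNat := by
  rcases eq_or_ne x 0 with rfl | hx
  -- At the origin the angles are default values; they do not matter, since degree 0 is constant and
  -- higher degrees carry a factor r^n = 0.
  · rcases Nat.eq_zero_or_pos n with rfl | hn
    · obtain rfl : m = 0 := by simp at hm hm'; omega
      simp [solidHarmonic, sphericalHarmonic, harmonicNorm, assocLegendre, assocLegendreNat,
        intFactorial]
    · have h0 : genPoly (0 : E3) = 0 := by simp [genPoly, harmonicQuadratic, planar]
      rw [solidHarmonic, h0, zero_pow hn.ne']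
      simp [hn.ne']
  have hf : ((n.factorial : ℕ) : ℂ) ≠ 0 := by exact_mod_cast n.factorial_ne_zero
  rcases le_or_gt 0 m with h | h
  · obtain ⟨μ, rfl⟩ := Int.eq_ofNat_of_zero_le h
    have hN := sqrt_div_mul_self (A := (2 * n + 1) / (4 * Real.pi))
      (p := intFactorial (n - (μ : ℤ))) (intFactorial_pos ((n : ℤ) + (μ : ℤ)))
    have key := pow_mul_assocLegendreNat n μ x hx (norm_planar_mul_exp x) (planar_mul_conj x)
    have ht : ((n : ℤ) + (μ : ℤ)).toNat = n + μ := by omega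
    have hI : intFactorial ((n : ℤ) + (μ : ℤ)) = (n + μ).factorial := by
      rw [intFactorial, ht]
    rw [ht, genPoly]
    have hN' := congrArg (fun a : ℝ => (a : ℂ)) hN
    simp only [Complex.ofReal_mul] at hN'
    have hH : harmonicNorm (n : ℤ) (μ : ℤ) = Real.sqrt ((2 * n + 1) / (4 * Real.pi) *
        (intFactorial (n - (μ : ℤ)) * intFactorial (n + (μ : ℤ)))) := by
      simp [harmonicNorm]
    rw [hH]
    rw [← hN', hI, solidHarmonic, sphericalHarmonic, cos_polarAngle, assocLegendre, if_pos h]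
    rw [← Complex.exp_nat_mul] at key
    simp only [Int.toNat_natCast, zpow_natCast, Int.cast_natCast, Complex.ofReal_natCast]
    rw [hI]
    rw [show Complex.I * (μ : ℂ) * (azimuth x : ℂ) = (μ : ℂ) * (Complex.I * azimuth x) by ring]
    have h1 : ((-1 : ℂ) ^ μ) * (-1) ^ μ = 1 := by rw [← mul_pow]; simp
    linear_combination ((-1 : ℂ) ^ μ * (Real.sqrt ((2 * n + 1) / (4 * Real.pi) *
      (intFactorial (n - (μ : ℤ)) / (n + μ).factorial)) : ℂ)) * key + (Real.sqrt ((2 * n + 1) / (4 * Real.pi) *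
      (intFactorial (n - (μ : ℤ)) / (n + μ).factorial)) : ℂ) * ((n + μ).factorial / n.factorial) *
        (harmonicQuadratic (planar x) (starRingEnd ℂ (planar x)) (x 2) ^ n).coeff (n + μ) * h1
  · obtain ⟨μ, rfl⟩ : ∃ μ : ℕ, m = -(μ : ℤ) := ⟨m.natAbs, by omega⟩
    have hμn : μ ≤ n := by omega
    have hN := sqrt_div_mul_self (A := (2 * n + 1) / (4 * Real.pi))
      (p := intFactorial (n - -(μ : ℤ))) (intFactorial_pos ((n : ℤ) + -(μ : ℤ)))
    have hWV : starRingEnd ℂ (planar x) * planar x = (‖x‖ : ℂ) ^ 2 - (x 2 : ℂ) ^ 2 := by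
      rw [mul_comm]; exact planar_mul_conj x
    have key := pow_mul_assocLegendreNat n μ x hx (norm_planar_mul_exp_neg x) hWV
    have ht : ((n : ℤ) + -(μ : ℤ)).toNat = n - μ := by omega
    have hI : intFactorial ((n : ℤ) + -(μ : ℤ)) = (n - μ).factorial := by
      rw [intFactorial, ht]
    have hI' : intFactorial ((n : ℤ) - -(μ : ℤ)) = (n + μ).factorial := by
      rw [intFactorial, show ((n : ℤ) - -(μ : ℤ)).toNat = n + μ by omega]
    rw [ht, genPoly, coeff_harmonicQuadratic_pow_symm n μ hμn]
    have hN' := congrArg (fun a : ℝ => (a : ℂ)) hN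
    simp only [Complex.ofReal_mul] at hN'
    have hH : harmonicNorm (n : ℤ) (-(μ : ℤ)) = Real.sqrt ((2 * n + 1) / (4 * Real.pi) *
        (intFactorial (n - (-(μ : ℤ))) * intFactorial (n + (-(μ : ℤ))))) := by
      simp [harmonicNorm]
    rw [hH]
    rw [← hN', hI, solidHarmonic, sphericalHarmonic, cos_polarAngle, assocLegendre,
      if_neg (not_le.2 h)]
    rw [← Complex.exp_nat_mul] at key
    simp only [Int.natAbs_neg, Int.natAbs_natCast, zpow_neg, zpow_natCast, Int.cast_neg,
      Int.cast_natCast, Complex.ofReal_natCast]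
    rw [hI, hI']
    rw [show Complex.I * (-(μ : ℂ)) * (azimuth x : ℂ) = (μ : ℂ) * (-(Complex.I * azimuth x)) by ring]
    have h1 : ((-1 : ℂ) ^ μ)⁻¹ * (-1) ^ μ = 1 := inv_mul_cancel₀ (by simp)
    have hf2 : (((n + μ).factorial : ℕ) : ℂ) ≠ 0 := by exact_mod_cast (n + μ).factorial_ne_zero
    set S : ℂ := (Real.sqrt ((2 * n + 1) / (4 * Real.pi) *
      ((n + μ).factorial / (n - μ).factorial)) : ℂ)
    push_cast
    set Q := (harmonicQuadratic (starRingEnd ℂ (planar x)) (planar x) (x 2) ^ n).coeff (n + μ)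
    calc _ = (((-1 : ℂ) ^ μ)⁻¹ * (-1) ^ μ) * S * ((n - μ).factorial / (n + μ).factorial) *
          ((‖x‖ : ℂ) ^ n * (Complex.exp ((μ : ℂ) * (-(Complex.I * azimuth x))) *
            (assocLegendreNat n μ (x 2 / ‖x‖) : ℂ))) := by ring
      _ = _ := by
        rw [key, h1]
        field_simp

/-! ### The addition theorem -/

theorem genPoly_add (x z : E3) : genPoly (x + z) = genPoly x + genPoly z := by
  simp only [genPoly, harmonicQuadratic, planar, PiLp.add_apply, Complex.ofReal_add, map_add,
    map_mul, Complex.conj_ofReal, Complex.conj_I, add_div, neg_div, mul_neg, map_neg,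
    add_mul]
  ring

/-- This is where the constants C come from: they are the ratios of normalizing constants left over
when coefficients in the binomial expansion are rewritten as solid harmonics. -/
theorem harmonicNorm_eq_shiftCoeff (n ν : ℕ) (hν : ν ≤ n) (m μ : ℤ) :
    shiftCoeff ν μ n m * harmonicNorm ν μ * harmonicNorm (n - ν : ℕ) (m - μ) =
      harmonicNorm n m := by
  have h1 := intFactorial_pos (n - m)
  have h2 := intFactorial_pos (n + m)
  have h3 := intFactorial_pos (ν - μ)
  have h4 := intFactorial_pos (ν + μ)
  have h5 := intFactorial_pos (n - ν - m + μ)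
  have h6 := intFactorial_pos (n - ν + m - μ)
  have h7 := Real.pi_pos
  have hc : ((n - ν : ℕ) : ℤ) = (n : ℤ) - ν := by push_cast [hν]; ring
  have hc' : (0 : ℝ) < 2 * (n : ℝ) - 2 * (ν : ℝ) + 1 := by
    have : (ν : ℝ) ≤ n := by exact_mod_cast hν
    linarith
  rw [hc]
  unfold shiftCoeff harmonicNorm
  rw [show (n : ℤ) - ν - (m - μ) = n - ν - m + μ by ring,
    show (n : ℤ) - ν + (m - μ) = n - ν + m - μ by ring]
  push_cast
  rw [show 2 * ((n : ℝ) - ν) + 1 = 2 * (n : ℝ) - 2 * (ν : ℝ) + 1 by ring]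
  generalize 2 * (n : ℝ) - 2 * (ν : ℝ) + 1 = d at hc' ⊢
  rw [← Real.sqrt_mul (by positivity), ← Real.sqrt_mul (by positivity)]
  congr 1
  field_simp

theorem sum_ord_eq_sum_range (ν : ℕ) (g : ℤ → ℂ) :
    ∑ μ : Ord ν, g μ = ∑ a ∈ Finset.range (2 * ν + 1), g ((a : ℤ) - ν) := by
  rw [Finset.univ_eq_attach, Finset.sum_attach (Finset.Icc (-(ν : ℤ)) (ν : ℤ)) g]
  symm
  refine Finset.sum_bij' (fun a _ => (a : ℤ) - ν) (fun μ _ => (μ + ν).toNat) ?_ ?_ ?_ ?_ ?_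
  · intro a ha
    simp only [Finset.mem_range, Finset.mem_Icc] at ha ⊢
    omega
  · intro a ha
    simp only [Finset.mem_range, Finset.mem_Icc] at ha ⊢
    omega
  · intro a ha
    simp
  · intro a ha
    simp only [Finset.mem_Icc] at ha
    omega
  · intro a ha
    rfl

/-- The coefficient of a product, with the first factor of degree at most `2ν`. -/
theorem coeff_mul_eq_sum_range (p q : Polynomial ℂ) (ν N : ℕ) (hp : p.natDegree ≤ 2 * ν) :
    (p * q).coeff N =
      ∑ a ∈ Finset.range (2 * ν + 1), if a ≤ N then p.coeff a * q.coeff (N - a) else 0 := by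
  rw [Polynomial.coeff_mul, Finset.Nat.sum_antidiagonal_eq_sum_range_succ
    (fun i j => p.coeff i * q.coeff j), ← Finset.sum_filter]
  symm
  apply Finset.sum_subset_zero_on_sdiff
  · intro a ha
    simp only [Finset.mem_filter, Finset.mem_range] at ha ⊢
    omega
  · intro a ha
    simp only [Finset.mem_filter, Finset.mem_range, Finset.mem_sdiff, not_and] at ha
    rw [Polynomial.coeff_eq_zero_of_natDegree_lt, zero_mul]
    by_contra h
    exact ha.2 (by omega) (by omega)
  · intros; rfl

/-- **Addition theorem** for the regular solid harmonics. -/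
theorem solidHarmonic_add (n : ℕ) (m : Ord n) (x z : E3) :
    solidHarmonic n m (x + z) =
      ∑ ν ∈ Finset.range (n + 1), ∑ μ : Ord ν, shiftMatrix n ν z m μ * solidHarmonic ν μ x := by
  obtain ⟨m, hm⟩ := m
  have hm2 := Finset.mem_Icc.1 hm
  simp only
  rw [solidHarmonic_eq_coeff n m hm2.1 hm2.2, genPoly_add, add_pow, Polynomial.finsetSum_coeff,
    Finset.mul_sum]
  refine Finset.sum_congr rfl fun ν hν => ?_
  have hνn : ν ≤ n := by simpa [Nat.lt_succ_iff] using hν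
  set N := ((n : ℤ) + m).toNat with hN
  let g : ℤ → ℂ := fun μ =>
    if max (-(ν : ℤ)) (ν - n + m) ≤ μ ∧ μ ≤ min (ν : ℤ) (-ν + n + m) then
      (shiftCoeff ν μ n m : ℂ) * solidHarmonic (n - ν) (m - μ) z * solidHarmonic ν μ x else 0
  have hg : ∀ μ : Ord ν, shiftMatrix n ν z ⟨m, hm⟩ μ * solidHarmonic ν μ x = g μ := by
    intro μ
    simp only [shiftMatrix, Matrix.of_apply, g, ite_mul, zero_mul]
  rw [Finset.sum_congr rfl fun μ _ => hg μ, sum_ord_eq_sum_range, mul_comm (_ * _) ((n.choose ν : ℕ) : Polynomial ℂ),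
    ← Polynomial.C_eq_natCast, Polynomial.coeff_C_mul,
    coeff_mul_eq_sum_range _ _ ν N (natDegree_genPoly_pow_le x ν), Finset.mul_sum, Finset.mul_sum]
  refine Finset.sum_congr rfl fun a ha => ?_
  have ha' : a < 2 * ν + 1 := by simpa using ha
  simp only [g]
  -- With μ = a - ν, the window in the definition of G says exactly that 0 ≤ N - a ≤ 2(n - ν): the
  -- second factor has a coefficient of index N - a that its degree allows. Outside the window the
  -- product vanishes.
  by_cases hcond : max (-(ν : ℤ)) (ν - n + m) ≤ (a : ℤ) - ν ∧ (a : ℤ) - ν ≤ min (ν : ℤ) (-ν + n + m)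
  · rw [if_pos hcond]
    have h1 : a ≤ N := by omega
    rw [if_pos h1, solidHarmonic_eq_coeff ν _ (by omega) (by omega),
      solidHarmonic_eq_coeff (n - ν) _ (by omega) (by omega),
      ← harmonicNorm_eq_shiftCoeff n ν hνn m ((a : ℤ) - ν),
      show ((ν : ℤ) + ((a : ℤ) - ν)).toNat = a by omega,
      show (((n - ν : ℕ) : ℤ) + (m - ((a : ℤ) - ν))).toNat = N - a by omega]
    rw [Nat.cast_choose ℂ hνn]
    have f1 : (n.factorial : ℂ) ≠ 0 := by exact_mod_cast n.factorial_ne_zero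
    have f2 : (ν.factorial : ℂ) ≠ 0 := by exact_mod_cast ν.factorial_ne_zero
    have f3 : ((n - ν).factorial : ℂ) ≠ 0 := by exact_mod_cast (n - ν).factorial_ne_zero
    push_cast
    field_simp
  · rw [if_neg hcond]
    by_cases h1 : a ≤ N
    · rw [if_pos h1, Polynomial.coeff_eq_zero_of_natDegree_lt (p := genPoly z ^ (n - ν))]
      · simp
      · refine lt_of_le_of_lt (natDegree_genPoly_pow_le z _) ?_
        by_contra h2
        apply hcond
        omega
    · rw [if_neg h1]; simp

theorem solidHarmonic_zero_zero (x : E3) : solidHarmonic 0 0 x = (1 / Real.sqrt (4 * Real.pi) : ℝ) := by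
  simp [solidHarmonic, sphericalHarmonic, assocLegendre, assocLegendreNat, intFactorial]

/-- For equal degrees the window shrinks to j = k, and C = √(4π) cancels the constant harmonic
1/√(4π). -/
theorem shiftMatrix_self (n : ℕ) (z : E3) : shiftMatrix n n z = 1 := by
  ext k j
  obtain ⟨k, hk⟩ := k
  obtain ⟨j, hj⟩ := j
  rw [Finset.mem_Icc] at hk hj
  have hpi := Real.pi_pos
  simp only [shiftMatrix, Matrix.of_apply]
  by_cases h : k = j
  · subst h
    rw [if_pos (by omega), Matrix.one_apply_eq, Nat.sub_self, sub_self, solidHarmonic_zero_zero]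
    have h1 := intFactorial_pos (n - k)
    have h2 := intFactorial_pos (n + k)
    have : shiftCoeff n k n k = Real.sqrt (4 * Real.pi) := by
      unfold shiftCoeff
      congr 1
      simp only [sub_self, zero_sub, neg_add_cancel, zero_add]
      have h0 : intFactorial 0 = 1 := by simp [intFactorial]
      push_cast
      rw [h0]
      field_simp
    rw [this, ← Complex.ofReal_mul, mul_one_div_cancel (by positivity), Complex.ofReal_one]
  · rw [if_neg (by omega), Matrix.one_apply_ne (by simpa using h)]

/-! ### Isotropic linear forms: smoothness and harmonicity -/

/-- The linear form `x ↦ (t² - 1) x₀ / 2 + i (t² + 1) x₁ / 2 + t x₂`; its coefficient vector is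
isotropic. -/
def nullForm (t : ℂ) : E3 →L[ℝ] ℂ :=
  ((t ^ 2 - 1) / 2) • (Complex.ofRealCLM.comp (EuclideanSpace.proj 0)) +
    (Complex.I * (t ^ 2 + 1) / 2) • (Complex.ofRealCLM.comp (EuclideanSpace.proj 1)) +
    t • (Complex.ofRealCLM.comp (EuclideanSpace.proj 2))

theorem nullForm_apply (t : ℂ) (x : E3) :
    nullForm t x = (t ^ 2 - 1) / 2 * x 0 + Complex.I * (t ^ 2 + 1) / 2 * x 1 + t * x 2 := by
  simp [nullForm]

theorem eval_genPoly (x : E3) (t : ℂ) : (genPoly x).eval t = nullForm t x := by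
  rw [nullForm_apply]
  simp [genPoly, harmonicQuadratic, planar]
  ring

/-- Solid harmonics are linear combinations of powers of isotropic linear forms. -/
theorem exists_solidHarmonic_eq_sum_nullForm_pow (n : ℕ) (m : Ord n) :
    ∃ c t : Fin (2 * n + 1) → ℂ, ∀ x, solidHarmonic n m x = ∑ j, c j * nullForm (t j) x ^ n := by
  -- The n-th power of `genPoly x` has degree at most 2n, so Lagrange interpolation at any 2n + 1
  -- distinct nodes, here 0, …, 2n, recovers its coefficients from its values.
  let v : Fin (2 * n + 1) → ℂ := fun j => (j : ℕ)
  have hv : Set.InjOn v (Finset.univ : Finset (Fin (2 * n + 1))) := by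
    intro i _ j _ hij
    simpa [v, Fin.ext_iff] using hij
  have hm2 := Finset.mem_Icc.1 m.2
  refine ⟨fun j => (harmonicNorm n m / n.factorial) *
    (Lagrange.basis Finset.univ v j).coeff ((n : ℤ) + m).toNat, v, fun x => ?_⟩
  rw [solidHarmonic_eq_coeff n m hm2.1 hm2.2]
  have hdeg : (genPoly x ^ n).degree < (Finset.univ : Finset (Fin (2 * n + 1))).card := by
    rw [Finset.card_univ, Fintype.card_fin]
    refine lt_of_le_of_lt (Polynomial.degree_le_of_natDegree_le (natDegree_genPoly_pow_le x n)) ?_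
    exact_mod_cast Nat.lt_succ_self _
  conv_lhs => rw [Lagrange.eq_interpolate hv hdeg]
  rw [Lagrange.interpolate_apply, Polynomial.finsetSum_coeff, Finset.mul_sum]
  refine Finset.sum_congr rfl fun j _ => ?_
  rw [Polynomial.coeff_C_mul, Polynomial.eval_pow, eval_genPoly]
  ring

theorem contDiff_solidHarmonic (n : ℕ) (m : Ord n) : ContDiff ℝ 2 (solidHarmonic n m) := by
  obtain ⟨c, t, h⟩ := exists_solidHarmonic_eq_sum_nullForm_pow n m
  rw [show solidHarmonic n m = fun x => ∑ j, c j * nullForm (t j) x ^ n from funext h]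
  fun_prop

/-! ### Behaviour under translations -/

theorem measurableEmbedding_add_right (z : E3) : MeasurableEmbedding (fun x : E3 => x + z) :=
  (Homeomorph.addRight z).measurableEmbedding

theorem measurePreserving_shift (z : E3) (D : Set E3) :
    MeasurePreserving (fun x : E3 => x + z) (surfaceMeasure D) (surfaceMeasure (shift z D)) := by
  have h : MeasurePreserving (fun x : E3 => x + z)
      (Measure.euclideanHausdorffMeasure 2 : Measure E3) (Measure.euclideanHausdorffMeasure 2) :=
    (IsometryEquiv.addRight z).measurePreserving_euclideanHausdorffMeasure 2
  have h2 := h.restrict_image_emb (measurableEmbedding_add_right z) (frontier D)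
  have h3 : frontier (shift z D) = (fun x : E3 => x + z) '' frontier D :=
    ((Homeomorph.addRight z).image_frontier D).symm
  unfold surfaceMeasure
  rw [h3]
  exact h2

theorem ae_surfaceMeasure_shift_iff (z : E3) (D : Set E3) (p : E3 → Prop) :
    (∀ᵐ x ∂(surfaceMeasure (shift z D)), p x) ↔ ∀ᵐ x ∂(surfaceMeasure D), p (x + z) := by
  rw [← (measurePreserving_shift z D).map_eq, (measurableEmbedding_add_right z).ae_map_iff]

theorem eLpNorm_surfaceMeasure_shift (z : E3) (D : Set E3) (f : E3 → ℂ) :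
    eLpNorm f 2 (surfaceMeasure (shift z D)) =
      eLpNorm (fun x => f (x + z)) 2 (surfaceMeasure D) := by
  rw [← (measurePreserving_shift z D).map_eq,
    (measurableEmbedding_add_right z).eLpNorm_map_measure]
  rfl

theorem add_mem_shift_iff (z : E3) (D : Set E3) (x : E3) : x + z ∈ shift z D ↔ x ∈ D := by
  simp [shift]

theorem isOutwardNormal_shift_iff (z : E3) (D : Set E3) (x v : E3) :
    IsOutwardNormal (shift z D) (x + z) v ↔ IsOutwardNormal D x v := by
  unfold IsOutwardNormal
  refine and_congr_right fun _ => forall₂_congr fun δ _ => ?_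
  have hmap : 𝓝 (x + z) = Filter.map (fun y => y + z) (𝓝 x) :=
    ((Homeomorph.addRight z).map_nhds_eq x).symm
  rw [hmap, Filter.eventually_map]
  simp only [add_mem_shift_iff, add_sub_add_right_eq_sub]

theorem outwardNormal_shift (z : E3) (D : Set E3) (x : E3) :
    outwardNormal (shift z D) (x + z) = outwardNormal D x := by
  unfold outwardNormal
  have h : IsOutwardNormal (shift z D) (x + z) = IsOutwardNormal D x :=
    funext fun v => propext (isOutwardNormal_shift_iff z D x v)
  rw [h]

/-- Pull-back of densities from `∂D_z` to `∂D`. -/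
def shiftL2 (z : E3) (D : Set E3) : L2 (shift z D) ≃L[ℂ] L2 D :=
  (LinearIsometryEquiv.ofSurjective
    (Lp.compMeasurePreservingₗᵢ ℂ (fun x : E3 => x + z) (measurePreserving_shift z D)) (by
      intro g
      have hmp : MeasurePreserving (fun x : E3 => x + -z) (surfaceMeasure (shift z D))
          (surfaceMeasure D) := by
        have h : MeasurePreserving (Homeomorph.addRight z).toMeasurableEquiv
          (surfaceMeasure D) (surfaceMeasure (shift z D)) := measurePreserving_shift z D
        exact h.symm
      refine ⟨Lp.compMeasurePreserving _ hmp g, ?_⟩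
      have h := Lp.compMeasurePreserving_comp_apply g hmp (measurePreserving_shift z D)
      change Lp.compMeasurePreserving _ _ _ = g
      rw [← h]
      have hid : ((fun x : E3 => x + -z) ∘ fun x => x + z) = id := by
        funext x; simp
      apply Lp.ext
      refine (Lp.coeFn_compMeasurePreserving _ _).trans ?_
      rw [hid]; rfl)).toContinuousLinearEquiv

theorem shiftL2_coeFn (z : E3) (D : Set E3) (φ : L2 (shift z D)) :
    shiftL2 z D φ =ᵐ[surfaceMeasure D] fun x => φ (x + z) :=
  Lp.coeFn_compMeasurePreserving φ (measurePreserving_shift z D)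

theorem truncatedNPAdjoint_congr {D : Set E3} {φ ψ : E3 → ℂ} (h : φ =ᵐ[surfaceMeasure D] ψ)
    (ε : ℝ) (x : E3) : truncatedNPAdjoint D ε φ x = truncatedNPAdjoint D ε ψ x := by
  unfold truncatedNPAdjoint
  congr 1
  apply integral_congr_ae
  filter_upwards [ae_restrict_of_ae h] with y hy
  rw [hy]

theorem truncatedNPAdjoint_shift (z : E3) (D : Set E3) (ε : ℝ) (φ : E3 → ℂ) (x : E3) :
    truncatedNPAdjoint (shift z D) ε φ (x + z) =
      truncatedNPAdjoint D ε (fun y => φ (y + z)) x := by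
  unfold truncatedNPAdjoint
  rw [← (measurePreserving_shift z D).setIntegral_preimage_emb (measurableEmbedding_add_right z),
    outwardNormal_shift]
  simp only [Set.preimage_ofPred_eq, add_sub_add_right_eq_sub]

/-- The truncated integrals themselves commute with the translation, so both modes of convergence
transfer. The equivalence also transfers non-existence of the operator, as the default branch of
`npAdjoint` requires. -/
theorem isNPAdjoint_shift_iff (z : E3) (D : Set E3) (T : L2 (shift z D) →L[ℂ] L2 (shift z D)) :
    IsNPAdjoint (shift z D) T ↔
      IsNPAdjoint D ((shiftL2 z D).conjContinuousAlgEquiv T) := by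
  unfold IsNPAdjoint
  rw [(shiftL2 z D).surjective.forall]
  refine forall_congr' fun φ => ?_
  rw [ContinuousLinearEquiv.conjContinuousAlgEquiv_apply_apply,
    ContinuousLinearEquiv.symm_apply_apply]
  have h1 : ∀ ε x, truncatedNPAdjoint (shift z D) ε φ (x + z) =
      truncatedNPAdjoint D ε (shiftL2 z D φ) x := by
    intro ε x
    rw [truncatedNPAdjoint_shift, truncatedNPAdjoint_congr (shiftL2_coeFn z D φ)]
  refine and_congr ?_ ?_
  · rw [ae_surfaceMeasure_shift_iff]
    simp only [h1]
    have h2 := shiftL2_coeFn z D (T φ)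
    constructor
    · intro h
      filter_upwards [h, h2] with x hx hx2
      rw [hx2]; exact hx
    · intro h
      filter_upwards [h, h2] with x hx hx2
      rw [hx2] at hx; exact hx
  · have h3 : ∀ ε, eLpNorm (fun x => truncatedNPAdjoint (shift z D) ε φ x - T φ x) 2
        (surfaceMeasure (shift z D)) =
        eLpNorm (fun x => truncatedNPAdjoint D ε (shiftL2 z D φ) x - shiftL2 z D (T φ) x) 2
        (surfaceMeasure D) := by
      intro ε
      rw [eLpNorm_surfaceMeasure_shift]
      apply eLpNorm_congr_ae
      filter_upwards [shiftL2_coeFn z D (T φ)] with x hx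
      rw [hx, h1]
    simp only [h3]

theorem IsNPAdjoint.unique {D : Set E3} {S T : L2 D →L[ℂ] L2 D} (hS : IsNPAdjoint D S)
    (hT : IsNPAdjoint D T) : S = T := by
  ext1 φ
  apply Lp.ext
  filter_upwards [(hS φ).1, (hT φ).1] with x h1 h2
  exact tendsto_nhds_unique h1 h2

theorem npAdjoint_eq {D : Set E3} {T : L2 D →L[ℂ] L2 D} (hT : IsNPAdjoint D T) :
    npAdjoint D = T := by
  have h : ∃ T, IsNPAdjoint D T := ⟨T, hT⟩
  rw [npAdjoint, dif_pos h]
  exact h.choose_spec.unique hT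

theorem npAdjoint_shift (z : E3) (D : Set E3) :
    (shiftL2 z D).conjContinuousAlgEquiv (npAdjoint (shift z D)) = npAdjoint D := by
  by_cases h : ∃ T, IsNPAdjoint (shift z D) T
  · obtain ⟨T, hT⟩ := h
    rw [npAdjoint_eq hT, npAdjoint_eq ((isNPAdjoint_shift_iff z D T).1 hT)]
  · have h' : ¬ ∃ T, IsNPAdjoint D T := by
      rintro ⟨T, hT⟩
      refine h ⟨(shiftL2 z D).conjContinuousAlgEquiv.symm T, ?_⟩
      rw [isNPAdjoint_shift_iff, ContinuousAlgEquiv.apply_symm_apply]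
      exact hT
    rw [npAdjoint, dif_neg h, npAdjoint, dif_neg h', map_zero]

/-- Isomorphisms preserve non-units too, so the default value 0 is also respected and no
invertibility of λ - K* is needed. -/
theorem map_ringInverse {A B : Type*} [Ring A] [Ring B] (e : A ≃+* B) (a : A) :
    e (Ring.inverse a) = Ring.inverse (e a) := by
  by_cases h : IsUnit a
  · obtain ⟨u, rfl⟩ := h
    rw [Ring.inverse_unit]
    exact (Ring.inverse_unit (Units.map (e : A →* B) u)).symm
  · have h' : ¬ IsUnit (e a) := by rwa [MulEquiv.isUnit_map]
    rw [Ring.inverse_non_unit _ h, Ring.inverse_non_unit _ h', map_zero]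

theorem shiftL2_npResolvent (lam : ℝ) (z : E3) (D : Set E3) (φ : L2 (shift z D)) :
    shiftL2 z D (npResolvent lam (shift z D) φ) = npResolvent lam D (shiftL2 z D φ) := by
  have h : (shiftL2 z D).conjContinuousAlgEquiv (npResolvent lam (shift z D)) =
      npResolvent lam D := by
    have h1 := map_ringInverse
      (shiftL2 z D).conjContinuousAlgEquiv.toAlgEquiv.toRingEquiv
      ((lam : ℂ) • (1 : L2 (shift z D) →L[ℂ] L2 (shift z D)) - npAdjoint (shift z D))
    have h2 : (shiftL2 z D).conjContinuousAlgEquiv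
        ((lam : ℂ) • (1 : L2 (shift z D) →L[ℂ] L2 (shift z D)) - npAdjoint (shift z D)) =
        (lam : ℂ) • (1 : L2 D →L[ℂ] L2 D) - npAdjoint D := by
      rw [map_sub, map_smul, map_one, npAdjoint_shift]
    exact h1.trans (congrArg Ring.inverse h2)
  rw [← h, ContinuousLinearEquiv.conjContinuousAlgEquiv_apply_apply,
    ContinuousLinearEquiv.symm_apply_apply]

theorem normalDerivative_shift (z : E3) (D : Set E3) (h : E3 → ℂ) (x : E3) :
    normalDerivative (shift z D) h (x + z) = normalDerivative D (fun y => h (y + z)) x := by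
  rw [normalDerivative, normalDerivative, outwardNormal_shift, fderiv_comp_add_right]

theorem shiftL2_normalDerivativeL2 (z : E3) (D : Set E3) (h : E3 → ℂ) :
    shiftL2 z D (normalDerivativeL2 (shift z D) h) =
      normalDerivativeL2 D (fun y => h (y + z)) := by
  have hiff : MemLp (normalDerivative (shift z D) h) 2 (surfaceMeasure (shift z D)) ↔
      MemLp (normalDerivative D (fun y => h (y + z))) 2 (surfaceMeasure D) := by
    conv_lhs => rw [← (measurePreserving_shift z D).map_eq,
      (measurableEmbedding_add_right z).memLp_map_measure_iff]
    rw [show normalDerivative (shift z D) h ∘ (fun x => x + z) =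
      normalDerivative D (fun y => h (y + z)) from funext (normalDerivative_shift z D h)]
  unfold normalDerivativeL2
  by_cases hm : MemLp (normalDerivative (shift z D) h) 2 (surfaceMeasure (shift z D))
  · rw [dif_pos hm, dif_pos (hiff.1 hm)]
    apply Lp.ext
    refine (shiftL2_coeFn z D _).trans ?_
    refine EventuallyEq.trans ?_ (MemLp.coeFn_toLp (hiff.1 hm)).symm
    have := (measurePreserving_shift z D).quasiMeasurePreserving.ae_eq_comp (MemLp.coeFn_toLp hm)
    refine this.trans (Eventually.of_forall fun x => ?_)
    exact normalDerivative_shift z D h x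
  · rw [dif_neg hm, dif_neg (fun h' => hm (hiff.2 h')), map_zero]

/-- Everything except the harmonics is translation invariant, so the shift moves from the domain to
the two harmonics. -/
theorem cgpt_shift (lam : ℝ) (z : E3) (D : Set E3) (n : ℕ) (m : ℤ) (l : ℕ) (k : ℤ) :
    cgpt lam (shift z D) n m l k =
      ∫ y, starRingEnd ℂ (solidHarmonic l k (y + z)) *
        npResolvent lam D (normalDerivativeL2 D (fun x => solidHarmonic n m (x + z))) y
          ∂(surfaceMeasure D) := by
  unfold cgpt
  rw [← (measurePreserving_shift z D).integral_comp (measurableEmbedding_add_right z)]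
  apply integral_congr_ae
  rw [← shiftL2_normalDerivativeL2, ← shiftL2_npResolvent]
  filter_upwards [shiftL2_coeFn z D
    (npResolvent lam (shift z D) (normalDerivativeL2 (shift z D) (solidHarmonic n m)))] with y hy
  rw [hy]

/-! ### The area formula for Lipschitz graphs -/

/-- The Euclidean plane. -/
abbrev E2 : Type := EuclideanSpace ℝ (Fin 2)

/-- The graph parametrization `x ↦ (x, f x)`. -/
def graphMap (f : E2 → ℝ) (x : E2) : E3 := !₂[x 0, x 1, f x]

/-- The projection to the first two coordinates. -/
def baseProj (p : E3) : E2 := !₂[p 0, p 1]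

@[simp] theorem graphMap_zero (f : E2 → ℝ) (x : E2) : graphMap f x 0 = x 0 := rfl
@[simp] theorem graphMap_one (f : E2 → ℝ) (x : E2) : graphMap f x 1 = x 1 := rfl
@[simp] theorem graphMap_two (f : E2 → ℝ) (x : E2) : graphMap f x 2 = f x := rfl

@[simp] theorem baseProj_graphMap (f : E2 → ℝ) (x : E2) : baseProj (graphMap f x) = x := by
  ext i; fin_cases i <;> rfl

theorem continuous_baseProj : Continuous baseProj := by
  unfold baseProj; fun_prop

theorem norm_sq_eq_coords_two (x : E2) : ‖x‖ ^ 2 = x 0 ^ 2 + x 1 ^ 2 := by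
  rw [EuclideanSpace.norm_sq_eq, Fin.sum_univ_two]
  simp

theorem continuous_graphMap {f : E2 → ℝ} (hf : Continuous f) : Continuous (graphMap f) := by
  unfold graphMap
  fun_prop

theorem graphMap_injective (f : E2 → ℝ) : Function.Injective (graphMap f) :=
  Function.LeftInverse.injective (baseProj_graphMap f)

theorem measurableEmbedding_graphMap {f : E2 → ℝ} (hf : Continuous f) :
    MeasurableEmbedding (graphMap f) :=
  (continuous_graphMap hf).measurableEmbedding (graphMap_injective f)

/-- The graph of a linear form, as a linear map. -/
def linGraph (A : E2 →L[ℝ] ℝ) : E2 →ₗ[ℝ] E3 where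
  toFun := graphMap A
  map_add' x y := by ext i; fin_cases i <;> simp [graphMap]
  map_smul' c x := by ext i; fin_cases i <;> simp [graphMap]

theorem norm_linGraph_sq (A : E2 →L[ℝ] ℝ) (x : E2) :
    ‖linGraph A x‖ ^ 2 = ‖x‖ ^ 2 + A x ^ 2 := by
  rw [norm_sq_eq_coords, norm_sq_eq_coords_two]; rfl

theorem norm_le_norm_linGraph (A : E2 →L[ℝ] ℝ) (x : E2) : ‖x‖ ≤ ‖linGraph A x‖ := by
  refine le_of_sq_le_sq ?_ (norm_nonneg _)
  rw [norm_linGraph_sq]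
  nlinarith [sq_nonneg (A x)]

/-- The area density `√(1 + |∇f|²)` as a function of the differential. -/
def areaDensity (A : E2 →L[ℝ] ℝ) : ℝ :=
  ‖(!₂[1, A (EuclideanSpace.single 0 1), A (EuclideanSpace.single 1 1)] : E3)‖

theorem areaDensity_sq (A : E2 →L[ℝ] ℝ) : areaDensity A ^ 2 =
    1 + A (EuclideanSpace.single 0 1) ^ 2 + A (EuclideanSpace.single 1 1) ^ 2 := by
  rw [areaDensity, norm_sq_eq_coords]
  simp

theorem one_le_areaDensity (A : E2 →L[ℝ] ℝ) : 1 ≤ areaDensity A := by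
  refine le_of_sq_le_sq ?_ (norm_nonneg _)
  rw [areaDensity_sq]
  nlinarith [sq_nonneg (A (EuclideanSpace.single 0 1)), sq_nonneg (A (EuclideanSpace.single 1 1))]

theorem continuous_areaDensity : Continuous areaDensity := by
  unfold areaDensity
  fun_prop

theorem areaDensity_le_mul {A B : E2 →L[ℝ] ℝ} {δ : ℝ} (h : ‖A - B‖ ≤ δ) :
    areaDensity A ≤ (1 + 2 * δ) * areaDensity B := by
  have h1 := one_le_areaDensity B
  have hδ : 0 ≤ δ := (norm_nonneg _).trans h
  have h2 : areaDensity A ≤ areaDensity B + 2 * δ := by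
    have e : (!₂[1, A (EuclideanSpace.single 0 1), A (EuclideanSpace.single 1 1)] : E3) =
        !₂[1, B (EuclideanSpace.single 0 1), B (EuclideanSpace.single 1 1)] +
        !₂[0, (A - B) (EuclideanSpace.single 0 1), (A - B) (EuclideanSpace.single 1 1)] := by
      ext i; fin_cases i <;> simp
    rw [areaDensity, e]
    refine (norm_add_le _ _).trans ?_
    have h3 : ∀ i : Fin 2, |(A - B) (EuclideanSpace.single i 1)| ≤ δ := by
      intro i
      have := (A - B).le_opNorm (EuclideanSpace.single i 1)
      simp only [PiLp.norm_single, norm_one, mul_one] at this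
      exact this.trans h
    have h4 : ‖(!₂[0, (A - B) (EuclideanSpace.single 0 1), (A - B) (EuclideanSpace.single 1 1)] : E3)‖
        ≤ 2 * δ := by
      refine le_of_sq_le_sq ?_ (by positivity)
      rw [norm_sq_eq_coords]
      have a := sq_le_sq' (abs_le.1 (h3 0)).1 (abs_le.1 (h3 0)).2
      have b := sq_le_sq' (abs_le.1 (h3 1)).1 (abs_le.1 (h3 1)).2
      change 0 ^ 2 + (A - B) (EuclideanSpace.single 0 1) ^ 2 +
        (A - B) (EuclideanSpace.single 1 1) ^ 2 ≤ _
      nlinarith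
    exact add_le_add le_rfl h4
  nlinarith

/-- Polarization gives the Gram matrix of S as I + ∇A ∇Aᵀ, whose determinant is 1 + |∇A|²;
Lagrange's identity equates it with (det S)². -/
theorem abs_det_eq_areaDensity (A : E2 →L[ℝ] ℝ) (S : E2 →ₗ[ℝ] E2)
    (hS : ∀ x, ‖S x‖ = ‖linGraph A x‖) : |LinearMap.det S| = areaDensity A := by
  have hinner : ∀ x y, inner ℝ (S x) (S y) = inner ℝ x y + A x * A y := by
    intro x y
    have h1 : ‖S (x + y)‖ ^ 2 = ‖x + y‖ ^ 2 + A (x + y) ^ 2 := by rw [hS, norm_linGraph_sq]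
    have h2 : ‖S x‖ ^ 2 = ‖x‖ ^ 2 + A x ^ 2 := by rw [hS, norm_linGraph_sq]
    have h3 : ‖S y‖ ^ 2 = ‖y‖ ^ 2 + A y ^ 2 := by rw [hS, norm_linGraph_sq]
    rw [map_add, map_add, norm_add_sq_real, norm_add_sq_real] at h1
    linarith
  let b := (EuclideanSpace.basisFun (Fin 2) ℝ).toBasis
  have hdet : LinearMap.det S ^ 2 = areaDensity A ^ 2 := by
    rw [← LinearMap.det_toMatrix b, Matrix.det_fin_two, areaDensity_sq]
    have e : ∀ i j, LinearMap.toMatrix b b S i j = S (EuclideanSpace.single j 1) i := by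
      intro i j
      rw [LinearMap.toMatrix_apply]
      simp [b]
    have h00 := hinner (EuclideanSpace.single 0 1) (EuclideanSpace.single 0 1)
    have h01 := hinner (EuclideanSpace.single 0 1) (EuclideanSpace.single 1 1)
    have h11 := hinner (EuclideanSpace.single 1 1) (EuclideanSpace.single 1 1)
    simp only [PiLp.inner_apply, Fin.sum_univ_two, PiLp.single_apply] at h00 h01 h11
    simp at h00 h01 h11
    rw [e, e, e, e]
    set p := S (EuclideanSpace.single 0 1)
    set q := S (EuclideanSpace.single 1 1)
    have : (p 0 * q 1 - q 0 * p 1) ^ 2 =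
      (p 0 ^ 2 + p 1 ^ 2) * (q 0 ^ 2 + q 1 ^ 2) - (q 0 * p 0 + q 1 * p 1) ^ 2 := by ring
    rw [this, h00, h11, h01]
    ring
  rw [← Real.sqrt_sq_eq_abs, hdet, Real.sqrt_sq]
  exact zero_le_one.trans (one_le_areaDensity A)

-- The image plane is isometric to the Euclidean plane; through this isometry the graph map becomes
-- an endomorphism of the plane, which scales area by its determinant.
open scoped MeasureTheory in
theorem euclideanHausdorffMeasure_linGraph_image (A : E2 →L[ℝ] ℝ) (s : Set E2) :
    (Measure.euclideanHausdorffMeasure 2 : Measure E3) (linGraph A '' s) =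
      ENNReal.ofReal (areaDensity A) * volume s := by
  have hinj : Function.Injective (linGraph A) := graphMap_injective A
  have hfin : Module.finrank ℝ (LinearMap.range (linGraph A)) = 2 := by
    rw [LinearMap.finrank_range_of_inj hinj]; simp
  let U := ((stdOrthonormalBasis ℝ (LinearMap.range (linGraph A))).reindex (finCongr hfin)).repr
  let S : E2 →ₗ[ℝ] E2 := U.toLinearEquiv.toLinearMap ∘ₗ (linGraph A).rangeRestrict
  have hS : ∀ x, ‖S x‖ = ‖linGraph A x‖ := by
    intro x
    change ‖U ((linGraph A).rangeRestrict x)‖ = _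
    rw [LinearIsometryEquiv.norm_map]
    rfl
  let V : E2 → E3 := fun y => (U.symm y : E3)
  have hV : Isometry V := isometry_subtype_coe.comp U.symm.isometry
  have him : linGraph A '' s = V '' (S '' s) := by
    rw [Set.image_image]
    apply Set.image_congr
    intro x _
    change linGraph A x = (U.symm (U ((linGraph A).rangeRestrict x)) : E3)
    rw [LinearIsometryEquiv.symm_apply_apply]
    rfl
  rw [him, hV.euclideanHausdorffMeasure_image, EuclideanSpace.euclideanHausdorffMeasure_eq_volume,
    Measure.addHaar_image_linearMap, abs_det_eq_areaDensity A S hS]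

theorem lipschitzOnWith_euclideanHausdorffMeasure_image_le {X Y : Type*} [MetricSpace X]
    [MeasurableSpace X] [BorelSpace X] [MetricSpace Y] [MeasurableSpace Y] [BorelSpace Y]
    {K : ℝ≥0} {g : X → Y} {s : Set X} (h : LipschitzOnWith K g s) (d : ℕ) :
    (Measure.euclideanHausdorffMeasure d : Measure Y) (g '' s) ≤
      (K : ℝ≥0∞) ^ d * (Measure.euclideanHausdorffMeasure d : Measure X) s := by
  have h1 := h.hausdorffMeasure_image_le (d := (d : ℝ)) (by positivity)
  rw [ENNReal.rpow_natCast] at h1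
  simp only [Measure.euclideanHausdorffMeasure_def, Measure.smul_apply]
  rw [mul_smul_comm]
  gcongr

/-- On a set where `f` is `δ`-close to the linear form `A`, the graph of `f` has nearly the same
area as that of `A`. -/
theorem graph_area_comparison {f : E2 → ℝ} {A : E2 →L[ℝ] ℝ} {δ : ℝ≥0} (hδ : δ ≤ 1 / 2) {t : Set E2}
    (h : ApproximatesLinearOn f A t δ) :
    (Measure.euclideanHausdorffMeasure 2 : Measure E3) (graphMap f '' t) ≤
        ((1 + 2 * δ : ℝ≥0) : ℝ≥0∞) ^ 2 * (ENNReal.ofReal (areaDensity A) * volume t) ∧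
      ENNReal.ofReal (areaDensity A) * volume t ≤
        ((1 + 2 * δ : ℝ≥0) : ℝ≥0∞) ^ 2 *
          (Measure.euclideanHausdorffMeasure 2 : Measure E3) (graphMap f '' t) := by
  have hδ' : (δ : ℝ) ≤ 1 / 2 := by exact_mod_cast hδ
  -- The two graph maps differ only in height, so linear approximation of f makes each graph a small
  -- Lipschitz perturbation of the other; area scales at most by the square of the Lipschitz
  -- constant.
  have key : ∀ x ∈ t, ∀ y ∈ t,
      ‖(graphMap f x - graphMap f y) - (linGraph A x - linGraph A y)‖ ≤
        δ * ‖linGraph A x - linGraph A y‖ := by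
    intro x hx y hy
    have h2 : ‖f x - f y - A (x - y)‖ ≤ δ * ‖x - y‖ := h x hx y hy
    have h3 : ‖(graphMap f x - graphMap f y) - (linGraph A x - linGraph A y)‖ =
        ‖f x - f y - A (x - y)‖ := by
      rw [← sq_eq_sq₀ (norm_nonneg _) (norm_nonneg _), norm_sq_eq_coords]
      simp [linGraph]
    rw [h3, ← map_sub]
    exact h2.trans (mul_le_mul_of_nonneg_left (norm_le_norm_linGraph A _) δ.2)
  rw [← euclideanHausdorffMeasure_linGraph_image]
  constructor
  · have him : graphMap f '' t = (fun p => graphMap f (baseProj p)) '' (linGraph A '' t) := by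
      rw [Set.image_image]
      apply Set.image_congr
      intro x _
      change _ = graphMap f (baseProj (graphMap A x))
      rw [baseProj_graphMap]
    rw [him]
    apply lipschitzOnWith_euclideanHausdorffMeasure_image_le
    rw [lipschitzOnWith_iff_dist_le_mul]
    rintro _ ⟨x, hx, rfl⟩ _ ⟨y, hy, rfl⟩
    change dist (graphMap f (baseProj (graphMap A x))) (graphMap f (baseProj (graphMap A y))) ≤ _
    rw [baseProj_graphMap, baseProj_graphMap, dist_eq_norm, dist_eq_norm]
    have h1 := key x hx y hy
    have h2 := norm_sub_norm_le (graphMap f x - graphMap f y) (linGraph A x - linGraph A y)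
    have h3 := norm_nonneg (linGraph A x - linGraph A y)
    push_cast
    nlinarith [δ.2, mul_nonneg δ.2 h3]
  · have him : linGraph A '' t = (fun p => linGraph A (baseProj p)) '' (graphMap f '' t) := by
      rw [Set.image_image]
      apply Set.image_congr
      intro x _
      rw [baseProj_graphMap]
    conv_lhs => rw [him]
    apply lipschitzOnWith_euclideanHausdorffMeasure_image_le
    rw [lipschitzOnWith_iff_dist_le_mul]
    rintro _ ⟨x, hx, rfl⟩ _ ⟨y, hy, rfl⟩
    change dist (linGraph A (baseProj (graphMap f x))) (linGraph A (baseProj (graphMap f y))) ≤ _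
    rw [baseProj_graphMap, baseProj_graphMap, dist_eq_norm, dist_eq_norm]
    have h1 := key x hx y hy
    have h2 := norm_sub_norm_le (linGraph A x - linGraph A y) (graphMap f x - graphMap f y)
    rw [norm_sub_rev (linGraph A x - linGraph A y) (graphMap f x - graphMap f y)] at h2
    have h3 := norm_nonneg (linGraph A x - linGraph A y)
    push_cast
    have hδ0 : (0 : ℝ) ≤ δ := δ.2
    set a := ‖linGraph A x - linGraph A y‖
    set b := ‖graphMap f x - graphMap f y‖
    have h4 : (1 - δ) * a ≤ b := by linarith
    have h5 : (1 + 2 * (δ : ℝ)) * ((1 - δ) * a) ≤ (1 + 2 * δ) * b :=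
      mul_le_mul_of_nonneg_left h4 (by positivity)
    -- Here δ ≤ 1/2 enters: (1 + 2δ)(1 - δ) = 1 + δ(1 - 2δ) ≥ 1.
    nlinarith [mul_nonneg (mul_nonneg hδ0 (by linarith : 0 ≤ 1 - 2 * (δ : ℝ))) h3]

theorem tendsto_one_add_two_mul_pow (k : ℕ) :
    Tendsto (fun δ : ℝ≥0 => ((1 + 2 * δ : ℝ≥0) : ℝ≥0∞) ^ k) (𝓝[>] 0) (𝓝 1) := by
  have h : Tendsto (fun δ : ℝ≥0 => (1 + 2 * δ) ^ k) (𝓝 0) (𝓝 1) := by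
    have : Continuous fun δ : ℝ≥0 => (1 + 2 * δ) ^ k := by fun_prop
    simpa using this.tendsto 0
  have h2 := (ENNReal.tendsto_coe.2 h).mono_left (nhdsWithin_le_nhds (s := Set.Ioi 0))
  simpa using h2

theorem graph_area_comparison_lintegral {f : E2 → ℝ} {A : E2 →L[ℝ] ℝ} {δ : ℝ≥0} (hδ : δ ≤ 1 / 2)
    {t : Set E2} (ht : MeasurableSet t) (h : ApproximatesLinearOn f A t δ)
    (hd : ∀ x ∈ t, DifferentiableAt ℝ f x) :
    (Measure.euclideanHausdorffMeasure 2 : Measure E3) (graphMap f '' t) ≤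
        ((1 + 2 * δ : ℝ≥0) : ℝ≥0∞) ^ 3 *
          ∫⁻ x in t, ENNReal.ofReal (areaDensity (fderiv ℝ f x)) ∧
      ∫⁻ x in t, ENNReal.ofReal (areaDensity (fderiv ℝ f x)) ≤
        ((1 + 2 * δ : ℝ≥0) : ℝ≥0∞) ^ 3 *
          (Measure.euclideanHausdorffMeasure 2 : Measure E3) (graphMap f '' t) := by
  obtain ⟨h1, h2⟩ := graph_area_comparison hδ h
  -- the scalar function is made plane-valued to apply the estimate on the differential
  let e : E2 := EuclideanSpace.single 0 1
  have he : ‖e‖ = 1 := by simp [e]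
  have hae : ∀ᵐ x ∂(volume.restrict t), ‖fderiv ℝ f x - A‖ ≤ δ := by
    have happ : ApproximatesLinearOn (fun x => f x • e) (A.smulRight e) t δ := by
      intro x hx y hy
      have := h x hx y hy
      simp only [ContinuousLinearMap.smulRight_apply]
      rw [← sub_smul, ← sub_smul, norm_smul, he, mul_one]
      exact this
    filter_upwards [happ.norm_fderiv_sub_le volume ht (fun x => (fderiv ℝ f x).smulRight e)
      (fun x hx => ((hd x hx).hasFDerivAt.smul_const e).hasFDerivWithinAt)] with x hx
    have hx' : ‖(fderiv ℝ f x).smulRight e - A.smulRight e‖ ≤ δ := hx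
    have heq : (fderiv ℝ f x).smulRight e - A.smulRight e = (fderiv ℝ f x - A).smulRight e := by
      ext1 y; simp [sub_smul]
    rw [heq, ContinuousLinearMap.norm_smulRight_apply, he, mul_one] at hx'
    exact hx'
  have hK : ((1 + 2 * δ : ℝ≥0) : ℝ≥0∞) = ENNReal.ofReal (1 + 2 * δ) := by
    rw [← ENNReal.ofReal_coe_nnreal]; push_cast; rfl
  have hpos : (0 : ℝ) ≤ 1 + 2 * (δ : ℝ) := by positivity
  have h3 : ENNReal.ofReal (areaDensity A) * volume t ≤
      ((1 + 2 * δ : ℝ≥0) : ℝ≥0∞) * ∫⁻ x in t, ENNReal.ofReal (areaDensity (fderiv ℝ f x)) := by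
    rw [← setLIntegral_const, ← lintegral_const_mul' _ _ ENNReal.coe_ne_top]
    refine lintegral_mono_ae ?_
    filter_upwards [hae] with x hx
    rw [hK, ← ENNReal.ofReal_mul hpos]
    exact ENNReal.ofReal_le_ofReal (areaDensity_le_mul (by rwa [norm_sub_rev]))
  have h4 : ∫⁻ x in t, ENNReal.ofReal (areaDensity (fderiv ℝ f x)) ≤
      ((1 + 2 * δ : ℝ≥0) : ℝ≥0∞) * (ENNReal.ofReal (areaDensity A) * volume t) := by
    rw [← setLIntegral_const, ← lintegral_const_mul' _ _ ENNReal.coe_ne_top]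
    refine lintegral_mono_ae ?_
    filter_upwards [hae] with x hx
    rw [hK, ← ENNReal.ofReal_mul hpos]
    exact ENNReal.ofReal_le_ofReal (areaDensity_le_mul hx)
  constructor
  · refine h1.trans ?_
    rw [pow_succ _ 2, mul_assoc]
    gcongr
  · refine h4.trans ?_
    rw [pow_succ' _ 2, mul_assoc]
    gcongr

/-- Cut s into countably many pieces on which f is δ-close to a linear form. The comparison constant
(1 + 2δ)³ is the same on all pieces, so it survives summation and tends to 1 with δ. -/
theorem graph_area_of_differentiable {f : E2 → ℝ} (hf : Continuous f) {s : Set E2}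
    (hs : MeasurableSet s) (hd : ∀ x ∈ s, DifferentiableAt ℝ f x) :
    (Measure.euclideanHausdorffMeasure 2 : Measure E3) (graphMap f '' s) =
      ∫⁻ x in s, ENNReal.ofReal (areaDensity (fderiv ℝ f x)) := by
  set μ := (Measure.euclideanHausdorffMeasure 2 : Measure E3)
  have key : ∀ δ : ℝ≥0, 0 < δ → δ ≤ 1 / 2 →
      μ (graphMap f '' s) ≤ ((1 + 2 * δ : ℝ≥0) : ℝ≥0∞) ^ 3 *
          ∫⁻ x in s, ENNReal.ofReal (areaDensity (fderiv ℝ f x)) ∧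
      ∫⁻ x in s, ENNReal.ofReal (areaDensity (fderiv ℝ f x)) ≤
        ((1 + 2 * δ : ℝ≥0) : ℝ≥0∞) ^ 3 * μ (graphMap f '' s) := by
    intro δ hδ0 hδ
    obtain ⟨t, A, htd, htm, hst, happ, -⟩ :=
      exists_partition_approximatesLinearOn_of_hasFDerivWithinAt f s (fderiv ℝ f)
        (fun x hx => (hd x hx).hasFDerivAt.hasFDerivWithinAt) (fun _ => δ) (fun _ => hδ0.ne')
    have hsu : s = ⋃ n, s ∩ t n := by
      rw [← Set.inter_iUnion, Set.inter_eq_left.2 hst]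
    have hdisj : Pairwise (Function.onFun Disjoint fun n => s ∩ t n) := fun i j hij =>
      (htd hij).mono Set.inter_subset_right Set.inter_subset_right
    have hmeas : ∀ n, MeasurableSet (s ∩ t n) := fun n => hs.inter (htm n)
    have e1 : μ (graphMap f '' s) = ∑' n, μ (graphMap f '' (s ∩ t n)) := by
      conv_lhs => rw [hsu, Set.image_iUnion]
      refine measure_iUnion (fun i j hij => ?_) fun n =>
        (measurableEmbedding_graphMap hf).measurableSet_image.2 (hmeas n)
      exact (Set.disjoint_image_iff (graphMap_injective f)).2 (hdisj hij)
    have e2 : ∫⁻ x in s, ENNReal.ofReal (areaDensity (fderiv ℝ f x)) =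
        ∑' n, ∫⁻ x in s ∩ t n, ENNReal.ofReal (areaDensity (fderiv ℝ f x)) := by
      conv_lhs => rw [hsu]
      exact lintegral_iUnion hmeas hdisj _
    have hc := fun n => graph_area_comparison_lintegral hδ (hmeas n) (happ n)
      (fun x hx => hd x hx.1)
    rw [e1, e2, ← ENNReal.tsum_mul_left, ← ENNReal.tsum_mul_left]
    exact ⟨ENNReal.tsum_le_tsum fun n => (hc n).1, ENNReal.tsum_le_tsum fun n => (hc n).2⟩
  have hev : ∀ᶠ δ : ℝ≥0 in 𝓝[>] 0, 0 < δ ∧ δ ≤ 1 / 2 := by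
    filter_upwards [self_mem_nhdsWithin,
      nhdsWithin_le_nhds (Iic_mem_nhds (show (0 : ℝ≥0) < 1 / 2 by norm_num))] with δ h1 h2
    exact ⟨h1, h2⟩
  have hlim : ∀ a : ℝ≥0∞,
      Tendsto (fun δ : ℝ≥0 => ((1 + 2 * δ : ℝ≥0) : ℝ≥0∞) ^ 3 * a) (𝓝[>] 0) (𝓝 a) := by
    intro a
    have := ENNReal.Tendsto.mul_const (b := a) (tendsto_one_add_two_mul_pow 3)
      (Or.inl one_ne_zero)
    rwa [one_mul] at this
  apply le_antisymm
  · exact ge_of_tendsto (hlim _) (hev.mono fun δ h => (key δ h.1 h.2).1)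
  · exact ge_of_tendsto (hlim _) (hev.mono fun δ h => (key δ h.1 h.2).2)

theorem lipschitzWith_graphMap {f : E2 → ℝ} {K : ℝ≥0} (hf : LipschitzWith K f) :
    LipschitzWith (1 + K) (graphMap f) := by
  apply LipschitzWith.of_dist_le_mul
  intro x y
  rw [dist_eq_norm, dist_eq_norm]
  have h1 := hf.dist_le_mul x y
  rw [dist_eq_norm, dist_eq_norm] at h1
  refine le_of_sq_le_sq ?_ (by positivity)
  rw [norm_sq_eq_coords, mul_pow]
  have h2 := norm_sq_eq_coords_two (x - y)
  simp only [PiLp.sub_apply, graphMap_zero, graphMap_one, graphMap_two] at h2 ⊢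
  have h3 : (f x - f y) ^ 2 ≤ (K * ‖x - y‖) ^ 2 :=
    sq_le_sq' (abs_le.1 h1).1 (abs_le.1 h1).2
  push_cast
  have hK : (0 : ℝ) ≤ K := K.2
  nlinarith [mul_nonneg hK (sq_nonneg ‖x - y‖)]

/-- **Area formula** for Lipschitz graphs. -/
theorem graph_area {f : E2 → ℝ} {K : ℝ≥0} (hf : LipschitzWith K f) {s : Set E2}
    (hs : MeasurableSet s) :
    (Measure.euclideanHausdorffMeasure 2 : Measure E3) (graphMap f '' s) =
      ∫⁻ x in s, ENNReal.ofReal (areaDensity (fderiv ℝ f x)) := by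
  set N := {x | DifferentiableAt ℝ f x}
  -- By Rademacher the points of non-differentiability are null, and the graph map, being Lipschitz,
  -- sends them to a set of zero area.
  have hN : MeasurableSet N := measurableSet_of_differentiableAt ℝ f
  have hN0 : volume (Nᶜ) = 0 := hf.ae_differentiableAt
  have h0 : (Measure.euclideanHausdorffMeasure 2 : Measure E3) (graphMap f '' (s \ N)) = 0 := by
    refine le_antisymm ?_ zero_le
    refine (lipschitzOnWith_euclideanHausdorffMeasure_image_le
      ((lipschitzWith_graphMap hf).lipschitzOnWith (s := s \ N)) 2).trans ?_
    rw [EuclideanSpace.euclideanHausdorffMeasure_eq_volume,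
      measure_mono_null (fun x hx => hx.2) hN0, mul_zero]
  have h1 : graphMap f '' s = graphMap f '' (s ∩ N) ∪ graphMap f '' (s \ N) := by
    rw [← Set.image_union, Set.inter_union_sdiff]
  have h2 : (Measure.euclideanHausdorffMeasure 2 : Measure E3) (graphMap f '' s) =
      (Measure.euclideanHausdorffMeasure 2 : Measure E3) (graphMap f '' (s ∩ N)) := by
    refine le_antisymm ?_ (measure_mono (Set.image_mono Set.inter_subset_left))
    rw [h1]
    refine (measure_union_le _ _).trans ?_
    rw [h0, add_zero]
  rw [h2, graph_area_of_differentiable hf.continuous (hs.inter hN) (fun x hx => hx.2)]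
  refine (setLIntegral_congr ?_)
  exact inter_ae_eq_left_of_ae_eq_univ (by rwa [ae_eq_univ])

/-- The surface measure on a Lipschitz graph, in graph coordinates. -/
theorem euclideanHausdorffMeasure_restrict_graph {f : E2 → ℝ} {K : ℝ≥0} (hf : LipschitzWith K f) :
    (Measure.euclideanHausdorffMeasure 2 : Measure E3).restrict (Set.range (graphMap f)) =
      Measure.map (graphMap f)
        (volume.withDensity fun x => ENNReal.ofReal (areaDensity (fderiv ℝ f x))) := by
  have hm := measurableEmbedding_graphMap hf.continuous
  ext B hB
  rw [Measure.restrict_apply hB, Measure.map_apply hm.measurable hB,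
    withDensity_apply _ (hm.measurable hB), ← graph_area hf (hm.measurable hB),
    Set.image_preimage_eq_inter_range]

/-! ### Local graph coordinates on the boundary -/

/-- If v ≠ w, the direction w - v points strictly against v and strictly along w. Short steps from x
in that direction would be both inside and outside D. -/
theorem IsOutwardNormal.unique {D : Set E3} {x v w : E3} (hv : IsOutwardNormal D x v)
    (hw : IsOutwardNormal D x w) : v = w := by
  by_contra hne
  have hpos : 0 < 1 - inner ℝ v w := by
    have h1 : 0 < ‖v - w‖ ^ 2 := by
      have := norm_pos_iff.2 (sub_ne_zero.2 hne)
      positivity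
    rw [norm_sub_sq_real, hv.1, hw.1] at h1
    linarith
  set d := w - v
  set c := 1 - inner ℝ v w
  have hd : 0 < ‖d‖ := norm_pos_iff.2 (sub_ne_zero.2 (Ne.symm hne))
  have hdv : inner ℝ d v = -c := by
    rw [inner_sub_left, real_inner_self_eq_norm_sq, hv.1, real_inner_comm]; ring
  have hdw : inner ℝ d w = c := by
    rw [inner_sub_left, real_inner_self_eq_norm_sq, hw.1]; ring
  set δ := c / (2 * ‖d‖)
  have hδ : 0 < δ := by positivity
  have hδd : δ * ‖d‖ < c := by
    have : δ * ‖d‖ = c / 2 := by simp only [δ]; field_simp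
    linarith
  have hlim : Tendsto (fun t : ℝ => x + t • d) (𝓝[>] 0) (𝓝 x) := by
    have : Continuous fun t : ℝ => x + t • d := by fun_prop
    have h := this.tendsto 0
    simp only [zero_smul, add_zero] at h
    exact h.mono_left nhdsWithin_le_nhds
  obtain ⟨t, ⟨h1, h2⟩, ht0⟩ := (((hlim.eventually (hv.2 δ hδ)).and
    (hlim.eventually (hw.2 δ hδ))).and self_mem_nhdsWithin).exists
  have ht : 0 < t := ht0
  simp only [add_sub_cancel_left, inner_smul_left, norm_smul, Real.norm_eq_abs, abs_of_pos ht,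
    hdv, hdw, conj_trivial] at h1 h2
  refine h2.2 ?_ (h1.1 ?_) <;> nlinarith

theorem IsOutwardNormal.outwardNormal_eq {D : Set E3} {x v : E3} (hv : IsOutwardNormal D x v) :
    outwardNormal D x = v := by
  have h : ∃ v, IsOutwardNormal D x v := ⟨v, hv⟩
  rw [outwardNormal, dif_pos h]
  exact h.choose_spec.unique hv

theorem norm_outwardNormal_le (D : Set E3) (x : E3) : ‖outwardNormal D x‖ ≤ 1 := by
  unfold outwardNormal
  split_ifs with h
  · exact h.choose_spec.1.le
  · simp

/-- In the open set `U`, the set `D` is the region above the graph of `f` in the orthonormal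
coordinates given by `e`. -/
structure IsGraphChart (D U : Set E3) (e : E3 ≃ₗᵢ[ℝ] E3) (K : ℝ≥0) (f : E2 → ℝ) : Prop where
  isOpen : IsOpen U
  lipschitz : LipschitzWith K f
  mem_iff : ∀ x ∈ U, (x ∈ D ↔ f (baseProj (e x)) < e x 2)

/-- The unit normal, pointing down, to the graph of a function with differential `A`. -/
def graphNormal (A : E2 →L[ℝ] ℝ) : E3 :=
  (areaDensity A)⁻¹ • !₂[A (EuclideanSpace.single 0 1), A (EuclideanSpace.single 1 1), -1]

theorem apply_eq_coords (A : E2 →L[ℝ] ℝ) (w : E2) :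
    A w = w 0 * A (EuclideanSpace.single 0 1) + w 1 * A (EuclideanSpace.single 1 1) := by
  have : w = w 0 • EuclideanSpace.single 0 1 + w 1 • EuclideanSpace.single 1 1 := by
    ext i; fin_cases i <;> simp
  conv_lhs => rw [this]
  simp

theorem areaDensity_pos (A : E2 →L[ℝ] ℝ) : 0 < areaDensity A :=
  zero_lt_one.trans_le (one_le_areaDensity A)

/-- The area density cancels the normalization of the normal, so fluxes through a graph become
unweighted integrals over the plane, linear in ∇f. -/
theorem areaDensity_mul_inner_graphNormal (A : E2 →L[ℝ] ℝ) (w : E3) :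
    areaDensity A * inner ℝ w (graphNormal A) = A (baseProj w) - w 2 := by
  have h := areaDensity_pos A
  rw [graphNormal, inner_smul_right, ← mul_assoc, mul_inv_cancel₀ h.ne', one_mul,
    apply_eq_coords A (baseProj w)]
  simp [PiLp.inner_apply, Fin.sum_univ_three, baseProj]
  ring

theorem norm_graphNormal (A : E2 →L[ℝ] ℝ) : ‖graphNormal A‖ = 1 := by
  have h := areaDensity_pos A
  have h2 : ‖(!₂[A (EuclideanSpace.single 0 1), A (EuclideanSpace.single 1 1), -1] : E3)‖ =
      areaDensity A := by
    rw [← sq_eq_sq₀ (norm_nonneg _) h.le, areaDensity_sq, norm_sq_eq_coords]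
    simp
    ring
  rw [graphNormal, norm_smul, h2, norm_inv, Real.norm_of_nonneg h.le, inv_mul_cancel₀ h.ne']

theorem norm_baseProj_le (w : E3) : ‖baseProj w‖ ≤ ‖w‖ := by
  refine le_of_sq_le_sq ?_ (norm_nonneg _)
  rw [norm_sq_eq_coords, norm_sq_eq_coords_two]
  simp [baseProj]
  positivity

theorem baseProj_sub (x y : E3) : baseProj (x - y) = baseProj x - baseProj y := by
  ext i; fin_cases i <;> rfl

namespace IsGraphChart

variable {D U : Set E3} {e : E3 ≃ₗᵢ[ℝ] E3} {K : ℝ≥0} {f : E2 → ℝ}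

theorem mem_frontier_iff (h : IsGraphChart D U e K f) {x : E3} (hx : x ∈ U) :
    x ∈ frontier D ↔ e x 2 = f (baseProj (e x)) := by
  have hc : Continuous fun y : E3 => e y 2 - f (baseProj (e y)) := by
    have h1 := h.lipschitz.continuous
    have h2 := continuous_baseProj
    fun_prop
  have hU := h.isOpen.mem_nhds hx
  constructor
  · intro hfr
    by_contra hne
    rcases lt_or_gt_of_ne hne with hlt | hgt
    · have hev : ∀ᶠ y in 𝓝 x, y ∉ D := by
        filter_upwards [hU, hc.continuousAt.eventually_lt_const (sub_neg.2 hlt)] with y hy hy2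
        rw [h.mem_iff y hy]
        linarith
      have := mem_closure_iff_frequently.1 hfr.1
      exact this hev
    · have hev : D ∈ 𝓝 x := by
        filter_upwards [hU, hc.continuousAt.eventually_const_lt (sub_pos.2 hgt)] with y hy hy2
        rw [h.mem_iff y hy]
        linarith
      exact hfr.2 (mem_interior_iff_mem_nhds.2 hev)
  · intro heq
    refine ⟨?_, fun hint => ?_⟩
    -- Moving vertically upwards in the chart from a point of the graph enters D, so the point is in
    -- the closure.
    · let d : E3 := e.symm !₂[0, 0, 1]
      have hlim : Tendsto (fun t : ℝ => x + t • d) (𝓝[>] 0) (𝓝 x) := by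
        have : Continuous fun t : ℝ => x + t • d := by fun_prop
        have h := this.tendsto 0
        simp only [zero_smul, add_zero] at h
        exact h.mono_left nhdsWithin_le_nhds
      refine mem_closure_of_tendsto hlim ?_
      filter_upwards [hlim.eventually hU, self_mem_nhdsWithin] with t ht ht0
      have ht0 : 0 < t := ht0
      rw [h.mem_iff _ ht]
      have e1 : e (x + t • d) = e x + t • !₂[0, 0, 1] := by simp [d]
      have e2 : baseProj (e (x + t • d)) = baseProj (e x) := by
        rw [e1]; ext i; fin_cases i <;> simp [baseProj]
      rw [e2, e1, ← heq]
      simpa using ht0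
    · have := (h.mem_iff x hx).1 (interior_subset hint)
      linarith

/-- Up to the factor `areaDensity` ≥ 1, the inner product with the normal measures the height below
the tangent plane. Differentiability makes the graph deviate from that plane by less than any cone
of opening δ. -/
theorem isOutwardNormal (h : IsGraphChart D U e K f) {x : E3} (hx : x ∈ U)
    (hfr : e x 2 = f (baseProj (e x))) (hd : DifferentiableAt ℝ f (baseProj (e x))) :
    IsOutwardNormal D x (e.symm (graphNormal (fderiv ℝ f (baseProj (e x))))) := by
  set x' := baseProj (e x)
  set A := fderiv ℝ f x'
  refine ⟨by rw [LinearIsometryEquiv.norm_map, norm_graphNormal], fun δ hδ => ?_⟩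
  have hlim : Tendsto (fun y : E3 => baseProj (e y)) (𝓝 x) (𝓝 x') :=
    (continuous_baseProj.comp e.continuous).tendsto x
  have hev := hlim.eventually ((hasFDerivAt_iff_isLittleO.1 hd.hasFDerivAt).def hδ)
  filter_upwards [h.isOpen.mem_nhds hx, hev] with y hy hy2
  have hJ := one_le_areaDensity A
  have hin : areaDensity A * inner ℝ (y - x) (e.symm (graphNormal A)) =
      A (baseProj (e y) - x') - (e y 2 - e x 2) := by
    rw [← LinearIsometryEquiv.inner_map_map e, LinearIsometryEquiv.apply_symm_apply, map_sub,
      areaDensity_mul_inner_graphNormal, baseProj_sub]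
    rfl
  have hn : ‖baseProj (e y) - x'‖ ≤ ‖y - x‖ := by
    rw [← baseProj_sub, ← map_sub]
    exact (norm_baseProj_le _).trans (e.norm_map _).le
  rw [Real.norm_eq_abs, abs_le] at hy2
  have hn2 : δ * ‖baseProj (e y) - x'‖ ≤ δ * ‖y - x‖ := by gcongr
  have hn3 : δ * ‖y - x‖ ≤ areaDensity A * (δ * ‖y - x‖) :=
    le_mul_of_one_le_left (by positivity) hJ
  rw [h.mem_iff y hy]
  constructor
  · intro hlt
    have := mul_lt_mul_of_pos_left hlt (areaDensity_pos A)
    rw [hin] at this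
    linarith [hy2.2]
  · intro hlt
    have := mul_lt_mul_of_pos_left hlt (areaDensity_pos A)
    rw [hin] at this
    linarith [hy2.1]

/-- The local parametrization of the boundary. -/
theorem range_inter (h : IsGraphChart D U e K f) :
    frontier D ∩ U = Set.range (fun x => e.symm (graphMap f x)) ∩ U := by
  ext x
  simp only [Set.mem_inter_iff, Set.mem_range]
  refine and_congr_left fun hx => ?_
  rw [h.mem_frontier_iff hx]
  constructor
  · intro hfr
    refine ⟨baseProj (e x), ?_⟩
    rw [LinearIsometryEquiv.symm_apply_eq]
    ext i
    fin_cases i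
    · rfl
    · rfl
    · exact hfr.symm
  · rintro ⟨y, rfl⟩
    simp

theorem measurableEmbedding_param (hf : Continuous f) :
    MeasurableEmbedding (fun x => e.symm (graphMap f x)) :=
  e.symm.toHomeomorph.measurableEmbedding.comp (measurableEmbedding_graphMap hf)

theorem surfaceMeasure_restrict (h : IsGraphChart D U e K f) :
    (surfaceMeasure D).restrict U =
      (Measure.map (fun x => e.symm (graphMap f x))
        (volume.withDensity fun x => ENNReal.ofReal (areaDensity (fderiv ℝ f x)))).restrict U := by
  have hU := h.isOpen.measurableSet
  have h1 : (Measure.euclideanHausdorffMeasure 2 : Measure E3).restrict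
      (Set.range (fun x => e.symm (graphMap f x))) =
      Measure.map (fun x => e.symm (graphMap f x))
        (volume.withDensity fun x => ENNReal.ofReal (areaDensity (fderiv ℝ f x))) := by
    have hmp := (e.symm.toIsometryEquiv.measurePreserving_euclideanHausdorffMeasure 2)
    have hr : Set.range (fun x => e.symm (graphMap f x)) =
        e.symm.toIsometryEquiv '' (Set.range (graphMap f)) := by
      rw [← Set.range_comp]; rfl
    rw [hr, ← (hmp.restrict_image_emb e.symm.toIsometryEquiv.toHomeomorph.measurableEmbedding
      (Set.range (graphMap f))).map_eq, euclideanHausdorffMeasure_restrict_graph h.lipschitz,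
      Measure.map_map e.symm.toIsometryEquiv.continuous.measurable
        (measurableEmbedding_graphMap h.lipschitz.continuous).measurable]
    rfl
  rw [surfaceMeasure, ← h1, Measure.restrict_restrict hU, Measure.restrict_restrict hU,
    Set.inter_comm, h.range_inter, Set.inter_comm]

theorem ae_normal (h : IsGraphChart D U e K f) :
    ∀ᵐ x ∂(surfaceMeasure D).restrict U,
      IsOutwardNormal D x (e.symm (graphNormal (fderiv ℝ f (baseProj (e x))))) := by
  have hemb := measurableEmbedding_param (e := e) h.lipschitz.continuous
  rw [h.surfaceMeasure_restrict, ae_restrict_iff' h.isOpen.measurableSet, hemb.ae_map_iff]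
  refine (withDensity_absolutelyContinuous _ _).ae_le ?_
  filter_upwards [h.lipschitz.ae_differentiableAt] with x hx hxU
  exact h.isOutwardNormal hxU (by simp) (by simpa using hx)

theorem ae_outwardNormal_eq (h : IsGraphChart D U e K f) :
    ∀ᵐ x ∂(surfaceMeasure D).restrict U,
      outwardNormal D x = e.symm (graphNormal (fderiv ℝ f (baseProj (e x)))) :=
  h.ae_normal.mono fun _ hx => hx.outwardNormal_eq

theorem continuous_graphNormal : Continuous graphNormal := by
  unfold graphNormal
  refine (continuous_areaDensity.inv₀ fun A => (areaDensity_pos A).ne').smul ?_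
  fun_prop

/-- The normal field is defined by choice; measurability comes from its almost everywhere agreement
with an explicit function of the measurable differential of f. -/
theorem aemeasurable_outwardNormal (h : IsGraphChart D U e K f) :
    AEMeasurable (outwardNormal D) ((surfaceMeasure D).restrict U) := by
  refine AEMeasurable.congr ?_ (EventuallyEq.symm h.ae_outwardNormal_eq)
  apply Measurable.aemeasurable
  have h1 := measurable_fderiv ℝ f
  have h2 := continuous_baseProj.measurable
  have h3 := continuous_graphNormal.measurable
  exact e.symm.continuous.measurable.comp
    (h3.comp (h1.comp (h2.comp e.continuous.measurable)))

theorem surfaceMeasure_lt_top (h : IsGraphChart D U e K f) (hb : Bornology.IsBounded U) :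
    surfaceMeasure D U < ∞ := by
  set Γ : E2 → E3 := fun x => e.symm (graphMap f x)
  have hL : LipschitzWith (1 * (1 + K)) Γ :=
    e.symm.lipschitz.comp (lipschitzWith_graphMap h.lipschitz)
  have h1 : surfaceMeasure D U = (Measure.euclideanHausdorffMeasure 2 : Measure E3) (Γ '' (Γ ⁻¹' U)) := by
    rw [surfaceMeasure, Measure.restrict_apply h.isOpen.measurableSet, Set.inter_comm,
      h.range_inter, Set.image_preimage_eq_inter_range, Set.inter_comm]
  rw [h1]
  refine (lipschitzOnWith_euclideanHausdorffMeasure_image_le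
    (hL.lipschitzOnWith (s := Γ ⁻¹' U)) 2).trans_lt ?_
  rw [EuclideanSpace.euclideanHausdorffMeasure_eq_volume]
  refine ENNReal.mul_lt_top (by finiteness) ?_
  refine Bornology.IsBounded.measure_lt_top ?_
  obtain ⟨R, hR⟩ := hb.exists_norm_le
  rw [isBounded_iff_forall_norm_le]
  refine ⟨R, fun x hx => ?_⟩
  have := hR _ hx
  rw [LinearIsometryEquiv.norm_map] at this
  refine le_trans ?_ this
  conv_lhs => rw [← baseProj_graphMap f x]
  exact norm_baseProj_le _

end IsGraphChart

namespace IsBoundedLipschitzDomain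

variable {D : Set E3}

theorem isCompact_frontier (hD : IsBoundedLipschitzDomain D) : IsCompact (frontier D) :=
  Metric.isCompact_of_isClosed_isBounded isClosed_frontier
    (hD.isBounded.closure.subset frontier_subset_closure)

/-- The boundary is covered by finitely many graph charts over balls. -/
theorem exists_finite_charts (hD : IsBoundedLipschitzDomain D) :
    ∃ (ι : Type) (_ : Fintype ι) (U : ι → Set E3) (e : ι → (E3 ≃ₗᵢ[ℝ] E3)) (K : ι → ℝ≥0)
      (f : ι → E2 → ℝ), (∀ i, IsGraphChart D (U i) (e i) (K i) (f i)) ∧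
        (∀ i, Bornology.IsBounded (U i)) ∧ frontier D ⊆ ⋃ i, U i := by
  choose! e r K f hr hf h using hD.lipschitzBoundary
  obtain ⟨t, ht, hcover⟩ := hD.isCompact_frontier.elim_nhds_subcover (fun p => Metric.ball p (r p))
    (fun p hp => Metric.ball_mem_nhds p (hr p hp))
  refine ⟨t, inferInstance, fun p => Metric.ball p (r p), fun p => e p, fun p => K p,
    fun p => f p, fun p => ⟨Metric.isOpen_ball, hf p (ht p p.2), fun x hx => h p (ht p p.2) x hx⟩,
    fun p => Metric.isBounded_ball, ?_⟩
  intro x hx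
  obtain ⟨p, hp, hxp⟩ := Set.mem_iUnion₂.1 (hcover hx)
  exact Set.mem_iUnion.2 ⟨⟨p, hp⟩, hxp⟩

theorem surfaceMeasure_restrict_eq {s : Set E3} (hs : frontier D ⊆ s) :
    (surfaceMeasure D).restrict s = surfaceMeasure D := by
  rw [surfaceMeasure, Measure.restrict_restrict' isClosed_frontier.measurableSet,
    Set.inter_eq_right.2 hs]

theorem isFiniteMeasure_surfaceMeasure (hD : IsBoundedLipschitzDomain D) :
    IsFiniteMeasure (surfaceMeasure D) := by
  obtain ⟨ι, _, U, e, K, f, hch, hb, hcover⟩ := hD.exists_finite_charts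
  constructor
  have h1 : surfaceMeasure D Set.univ ≤ ∑ i, surfaceMeasure D (U i) := by
    rw [← surfaceMeasure_restrict_eq hcover, Measure.restrict_apply_univ,
      surfaceMeasure_restrict_eq hcover]
    exact measure_iUnion_fintype_le _ _
  exact h1.trans_lt (ENNReal.sum_lt_top.2 fun i _ => (hch i).surfaceMeasure_lt_top (hb i))

theorem ae_isOutwardNormal (hD : IsBoundedLipschitzDomain D) :
    ∀ᵐ x ∂(surfaceMeasure D), IsOutwardNormal D x (outwardNormal D x) := by
  obtain ⟨ι, _, U, e, K, f, hch, hb, hcover⟩ := hD.exists_finite_charts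
  rw [← surfaceMeasure_restrict_eq hcover, ae_restrict_iUnion_iff]
  intro i
  filter_upwards [(hch i).ae_normal] with x hx
  rwa [hx.outwardNormal_eq]

theorem aemeasurable_outwardNormal (hD : IsBoundedLipschitzDomain D) :
    AEMeasurable (outwardNormal D) (surfaceMeasure D) := by
  obtain ⟨ι, _, U, e, K, f, hch, hb, hcover⟩ := hD.exists_finite_charts
  rw [← surfaceMeasure_restrict_eq hcover, aemeasurable_iUnion_iff]
  exact fun i => (hch i).aemeasurable_outwardNormal

end IsBoundedLipschitzDomain

/-! ### The divergence theorem above a Lipschitz graph -/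

/-- The vertical unit vector. -/
def vertical : E3 := !₂[0, 0, 1]

/-- Coordinates `(x, t) ↦ (x, f x + t)` adapted to the graph of `f`. -/
def graphHomeo (f : E2 → ℝ) (hf : Continuous f) : E2 × ℝ ≃ₜ E3 where
  toFun q := graphMap (fun x => f x + q.2) q.1
  invFun p := (baseProj p, p 2 - f (baseProj p))
  left_inv q := by simp
  right_inv p := by
    ext i; fin_cases i <;> simp [graphMap, baseProj]
  continuous_toFun := by unfold graphMap; fun_prop
  continuous_invFun := by
    have := continuous_baseProj
    fun_prop

theorem graphHomeo_apply (f : E2 → ℝ) (hf : Continuous f) (x : E2) (t : ℝ) :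
    graphHomeo f hf (x, t) = graphMap f x + t • vertical := by
  ext i; fin_cases i <;> simp [graphHomeo, graphMap, vertical]

/-- The map is a shear: on each vertical line it is a translation. The rest of the proof reorders
coordinates. -/
theorem measurePreserving_graphHomeo (f : E2 → ℝ) (hf : Continuous f) :
    MeasurePreserving (graphHomeo f hf) (volume.prod volume) volume := by
  have h1 : MeasurePreserving (fun q : E2 × ℝ => (q.1, f q.1 + q.2)) (volume.prod volume)
      (volume.prod volume) := by
    refine (MeasurePreserving.id (volume : Measure E2)).skew_product
      (g := fun x t => f x + t) (by fun_prop) (Eventually.of_forall fun x => ?_)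
    exact (measurePreserving_add_left volume (f x)).map_eq
  have h2 : MeasurePreserving (fun q : E2 × ℝ => (q.2, (WithLp.ofLp q.1 : Fin 2 → ℝ)))
      (volume.prod volume) (volume.prod volume) := by
    have a : MeasurePreserving (Prod.map id WithLp.ofLp : ℝ × E2 → ℝ × (Fin 2 → ℝ))
        (volume.prod volume) (volume.prod volume) :=
      (MeasurePreserving.id volume).prod (PiLp.volume_preserving_ofLp (Fin 2))
    exact a.comp Measure.measurePreserving_swap
  have h3 := (volume_preserving_piFinSuccAbove (fun _ : Fin 3 => ℝ) (Fin.last 2)).symm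
  have h4 := (PiLp.volume_preserving_toLp (Fin 3)).comp (h3.comp (h2.comp h1))
  have h5 : (graphHomeo f hf : E2 × ℝ → E3) = WithLp.toLp 2 ∘
      (MeasurableEquiv.piFinSuccAbove (fun _ : Fin 3 => ℝ) (Fin.last 2)).symm ∘
        (fun q : E2 × ℝ => (q.2, (WithLp.ofLp q.1 : Fin 2 → ℝ))) ∘
          fun q : E2 × ℝ => (q.1, f q.1 + q.2) := by
    funext q
    ext i
    fin_cases i <;> rfl
  rw [h5]
  exact h4

theorem hasDerivAt_graphMap_line {f : E2 → ℝ} {x a : E2} (hd : DifferentiableAt ℝ f x) (t : ℝ) :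
    HasDerivAt (fun s : ℝ => graphMap (fun x => f x + t) (x + s • a))
      (!₂[a 0, a 1, fderiv ℝ f x a] : E3) 0 := by
  suffices hs : HasDerivAt (fun s : ℝ => WithLp.ofLp (graphMap (fun x => f x + t) (x + s • a)))
      (WithLp.ofLp (!₂[a 0, a 1, fderiv ℝ f x a] : E3)) 0 from
    ((PiLp.continuousLinearEquiv 2 ℝ (fun _ : Fin 3 => ℝ)).symm.hasFDerivAt).comp_hasDerivAt
      (0 : ℝ) hs
  rw [hasDerivAt_pi]
  intro i
  have hline : HasDerivAt (fun s : ℝ => x + s • a) a 0 := by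
    simpa using ((hasDerivAt_id (0 : ℝ)).smul_const a).const_add x
  fin_cases i
  · change HasDerivAt (fun s : ℝ => x 0 + s * a 0) (a 0) 0
    simpa using ((hasDerivAt_id (0 : ℝ)).mul_const (a 0)).const_add (x 0)
  · change HasDerivAt (fun s : ℝ => x 1 + s * a 1) (a 1) 0
    simpa using ((hasDerivAt_id (0 : ℝ)).mul_const (a 1)).const_add (x 1)
  · change HasDerivAt (fun s : ℝ => f (x + s • a) + t) (fderiv ℝ f x a) 0
    have hf : HasFDerivAt f (fderiv ℝ f x) (x + (0 : ℝ) • a) := by simpa using hd.hasFDerivAt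
    exact (hf.comp_hasDerivAt (0 : ℝ) hline).add_const t

/-- Integration by parts against the constant function 1. -/
theorem integral_lineDeriv_eq_zero {E : Type*} [NormedAddCommGroup E] [NormedSpace ℝ E]
    [FiniteDimensional ℝ E] [MeasurableSpace E] [BorelSpace E] (μ : Measure E)
    [μ.IsAddHaarMeasure] {g : E → ℝ} {C : ℝ≥0} (hg : LipschitzWith C g)
    (hc : HasCompactSupport g) (a : E) : ∫ x, lineDeriv ℝ g x a ∂μ = 0 := by
  have h := (LipschitzWith.const (1 : ℝ) (α := E)).integral_lineDeriv_mul_eq (μ := μ) hg hc (-a)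
  simp only [neg_neg, mul_one] at h
  rw [← h]
  simp [lineDeriv]

theorem norm_fderiv_apply_le {f : E2 → ℝ} {K : ℝ≥0} (hf : LipschitzWith K f) (x a : E2) :
    |fderiv ℝ f x a| ≤ K * ‖a‖ :=
  ((fderiv ℝ f x).le_opNorm a).trans
    (mul_le_mul_of_nonneg_right (norm_fderiv_le_of_lipschitz ℝ hf) (norm_nonneg _))

/-- **Divergence theorem** above a Lipschitz graph, for compactly supported functions. -/
theorem integral_fderiv_epigraph {f : E2 → ℝ} {K : ℝ≥0} (hf : LipschitzWith K f) {u : E3 → ℝ}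
    (hu : ContDiff ℝ 1 u) (hc : HasCompactSupport u) (w : E3) :
    ∫ x in {x : E3 | f (baseProj x) < x 2}, fderiv ℝ u x w =
      ∫ x : E2, u (graphMap f x) * (fderiv ℝ f x (baseProj w) - w 2) := by
  have hfc := hf.continuous
  set Φ := graphHomeo f hfc
  set a := baseProj w
  have hud : Differentiable ℝ u := hu.differentiable one_ne_zero
  have hfd : Continuous (fderiv ℝ u) := hu.continuous_fderiv one_ne_zero
  have hcd : HasCompactSupport (fderiv ℝ u) := hc.fderiv ℝ
  have hint : ∀ v : E3, Integrable (fun q => fderiv ℝ u (Φ q) v)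
      ((volume : Measure E2).prod (volume : Measure ℝ)) := by
    intro v
    apply Continuous.integrable_of_hasCompactSupport
    · exact (hfd.comp Φ.continuous).clm_apply continuous_const
    · have h1 : HasCompactSupport (fderiv ℝ u ∘ Φ) := hcd.comp_homeomorph Φ
      exact h1.comp_left (g := fun L : E3 →L[ℝ] ℝ => L v) (by simp)
  -- Split w as a vector tangent to the graph over a plus α times the vertical. The tangential part
  -- integrates to zero on each translated graph; the vertical part leaves the boundary term.
  set α : E2 → ℝ := fun x => w 2 - fderiv ℝ f x a
  have hαm : Measurable α := by
    have := measurable_fderiv_apply_const ℝ f a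
    fun_prop
  have hαb : ∀ x, ‖α x‖ ≤ |w 2| + K * ‖a‖ := fun x =>
    (abs_sub _ _).trans (add_le_add le_rfl (norm_fderiv_apply_le hf x a))
  have hαG : Integrable (fun q : E2 × ℝ => α q.1 * fderiv ℝ u (Φ q) vertical)
      ((volume : Measure E2).prod (volume : Measure ℝ)) :=
    (hint vertical).bdd_mul (hαm.comp measurable_fst).aestronglyMeasurable
      (Eventually.of_forall fun q => hαb q.1)
  have hset : Φ ⁻¹' {x : E3 | f (baseProj x) < x 2} = Set.univ ×ˢ Set.Ioi 0 := by
    ext ⟨x, t⟩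
    simp [Φ, graphHomeo]
  have hH : Integrable (fun q : E2 × ℝ =>
      fderiv ℝ u (Φ q) w - α q.1 * fderiv ℝ u (Φ q) vertical)
      ((volume : Measure E2).prod ((volume : Measure ℝ).restrict (Set.Ioi 0))) := by
    have := ((hint w).sub hαG).restrict (s := Set.univ ×ˢ Set.Ioi 0)
    rwa [← Measure.prod_restrict, Measure.restrict_univ] at this
  have hαG' : Integrable (fun q : E2 × ℝ => α q.1 * fderiv ℝ u (Φ q) vertical)
      ((volume : Measure E2).prod ((volume : Measure ℝ).restrict (Set.Ioi 0))) := by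
    have := hαG.restrict (s := Set.univ ×ˢ Set.Ioi 0)
    rwa [← Measure.prod_restrict, Measure.restrict_univ] at this
  have h1 : ∫ x in {x : E3 | f (baseProj x) < x 2}, fderiv ℝ u x w =
      ∫ q, fderiv ℝ u (Φ q) w
        ∂((volume : Measure E2).prod ((volume : Measure ℝ).restrict (Set.Ioi 0))) := by
    rw [← (measurePreserving_graphHomeo f hfc).setIntegral_preimage_emb
      Φ.measurableEmbedding, hset, ← Measure.prod_restrict, Measure.restrict_univ]
  have h2 : ∫ q, (fderiv ℝ u (Φ q) w - α q.1 * fderiv ℝ u (Φ q) vertical)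
        ∂((volume : Measure E2).prod ((volume : Measure ℝ).restrict (Set.Ioi 0))) = 0 := by
    rw [integral_prod_symm _ hH]
    refine integral_eq_zero_of_ae (Eventually.of_forall fun t => ?_)
    simp only [Pi.zero_apply]
    set g : E2 → ℝ := fun x => u (graphMap (fun x => f x + t) x)
    have hft : LipschitzWith K (fun x => f x + t) := by
      simpa using hf.add (LipschitzWith.const t)
    obtain ⟨C, hC⟩ := hu.lipschitzWith_of_hasCompactSupport hc one_ne_zero
    have hgL : LipschitzWith (C * (1 + K)) g := hC.comp (lipschitzWith_graphMap hft)
    have hgc : HasCompactSupport g :=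
      hc.comp_isClosedEmbedding (Function.LeftInverse.isClosedEmbedding
        (baseProj_graphMap _) continuous_baseProj (continuous_graphMap hft.continuous))
    rw [← integral_lineDeriv_eq_zero volume hgL hgc a]
    -- For fixed height t the integrand is almost everywhere the derivative along a of u restricted
    -- to the graph of f + t, a compactly supported Lipschitz function on the plane.
    apply integral_congr_ae
    filter_upwards [hf.ae_differentiableAt] with x hx
    have hcurve := hasDerivAt_graphMap_line (a := a) hx t
    have h0 : (fun s : ℝ => graphMap (fun x => f x + t) (x + s • a)) 0 = Φ (x, t) := by
      simp [Φ, graphHomeo]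
    have hu' : HasFDerivAt u (fderiv ℝ u (Φ (x, t)))
        ((fun s : ℝ => graphMap (fun x => f x + t) (x + s • a)) 0) := by
      rw [h0]; exact (hud _).hasFDerivAt
    have hline : HasLineDerivAt ℝ g (fderiv ℝ u (Φ (x, t)) !₂[a 0, a 1, fderiv ℝ f x a]) x a :=
      hu'.comp_hasDerivAt 0 hcurve
    rw [hline.lineDeriv]
    have hw : (!₂[a 0, a 1, fderiv ℝ f x a] : E3) = w - α x • vertical := by
      ext i; fin_cases i <;> simp [a, α, baseProj, vertical]
    rw [hw, map_sub, map_smul, smul_eq_mul]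
  have h3 : ∀ x : E2, ∫ t in Set.Ioi (0 : ℝ), fderiv ℝ u (Φ (x, t)) vertical =
      -u (graphMap f x) := by
    intro x
    have hemb : Topology.IsClosedEmbedding (fun t : ℝ => graphMap f x + t • vertical) := by
      refine Function.LeftInverse.isClosedEmbedding (f := fun p : E3 => p 2 - f x) (fun t => ?_)
        (by fun_prop) (by fun_prop)
      simp [vertical]
    have hk : HasCompactSupport (fun t : ℝ => u (graphMap f x + t • vertical)) :=
      hc.comp_isClosedEmbedding hemb
    have hk1 : ContDiff ℝ 1 (fun t : ℝ => u (graphMap f x + t • vertical)) := by fun_prop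
    have := hk.integral_Ioi_deriv_eq hk1 0
    rw [zero_smul, add_zero] at this
    rw [← this]
    congr 1
    funext t
    have hl : HasDerivAt (fun t : ℝ => graphMap f x + t • vertical) vertical t := by
      simpa using ((hasDerivAt_id t).smul_const vertical).const_add (graphMap f x)
    have := ((hud (graphMap f x + t • vertical)).hasFDerivAt.comp_hasDerivAt t hl).deriv
    simp only [Φ, graphHomeo_apply]
    exact this.symm
  rw [h1]
  have h4 : ∀ q : E2 × ℝ, fderiv ℝ u (Φ q) w =
      (fderiv ℝ u (Φ q) w - α q.1 * fderiv ℝ u (Φ q) vertical) +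
        α q.1 * fderiv ℝ u (Φ q) vertical := fun q => by ring
  rw [integral_congr_ae (Eventually.of_forall h4), integral_add hH hαG', h2, zero_add,
    integral_prod _ hαG']
  congr 1
  funext x
  simp only
  rw [integral_const_mul, h3]
  simp only [α]
  ring

/-! ### The divergence theorem on bounded Lipschitz domains -/

theorem fderiv_apply_eq_zero_of_notMem_tsupport {u : E3 → ℝ} {x : E3} (hx : x ∉ tsupport u)
    (v : E3) : fderiv ℝ u x v = 0 := by
  have : fderiv ℝ u x = 0 := by
    by_contra h
    exact hx (support_fderiv_subset ℝ h)
  rw [this]; rfl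

/-- As u lives in U, the domain may be replaced by the rotated epigraph. Both sides then become the
same plane integral, the right one through `areaDensity_mul_inner_graphNormal`. -/
theorem IsGraphChart.integral_fderiv {D U : Set E3} {e : E3 ≃ₗᵢ[ℝ] E3} {K : ℝ≥0} {f : E2 → ℝ}
    (h : IsGraphChart D U e K f) (hDm : MeasurableSet D) {u : E3 → ℝ} (hu : ContDiff ℝ 1 u)
    (hc : HasCompactSupport u) (hsupp : tsupport u ⊆ U) (v : E3) :
    ∫ x in D, fderiv ℝ u x v = ∫ x, u x * inner ℝ v (outwardNormal D x) ∂(surfaceMeasure D) := by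
  have hfc := h.lipschitz.continuous
  have hud : Differentiable ℝ u := hu.differentiable one_ne_zero
  have hbp := continuous_baseProj
  have hEm : MeasurableSet {y : E3 | f (baseProj y) < y 2} :=
    (isOpen_lt (by fun_prop) (by fun_prop)).measurableSet
  have hL : ∫ x in D, fderiv ℝ u x v =
      ∫ x : E2, u (e.symm (graphMap f x)) * (fderiv ℝ f x (baseProj (e v)) - e v 2) := by
    have h1 : ∫ x in D, fderiv ℝ u x v =
        ∫ x in e ⁻¹' {y : E3 | f (baseProj y) < y 2}, fderiv ℝ u x v := by
      rw [← integral_indicator hDm, ← integral_indicator (e.continuous.measurable hEm)]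
      congr 1
      funext x
      by_cases hx : x ∈ U
      · by_cases hxD : x ∈ D
        · rw [Set.indicator_of_mem hxD, Set.indicator_of_mem]
          exact (h.mem_iff x hx).1 hxD
        · rw [Set.indicator_of_notMem hxD, Set.indicator_of_notMem]
          exact fun h' => hxD ((h.mem_iff x hx).2 h')
      · have h0 := fderiv_apply_eq_zero_of_notMem_tsupport (fun h' => hx (hsupp h')) v
        have h1 : ∀ s : Set E3, s.indicator (fun x => fderiv ℝ u x v) x = 0 := fun s => by
          rw [Set.indicator_apply_eq_zero]
          exact fun _ => h0
        rw [h1, h1]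
    have h2 : ∀ x, fderiv ℝ u x v = fderiv ℝ (fun y => u (e.symm y)) (e x) (e v) := by
      intro x
      have : HasFDerivAt (fun y => u (e.symm y))
          ((fderiv ℝ u (e.symm (e x))).comp (e.symm.toContinuousLinearEquiv : E3 →L[ℝ] E3)) (e x) :=
        (hud _).hasFDerivAt.comp (e x) e.symm.toContinuousLinearEquiv.hasFDerivAt
      rw [this.fderiv]
      simp
    rw [h1, setIntegral_congr_fun (e.continuous.measurable hEm) (fun x _ => h2 x),
      e.measurePreserving.setIntegral_preimage_emb e.toHomeomorph.measurableEmbedding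
        (fun y => fderiv ℝ (fun y => u (e.symm y)) y (e v))]
    exact integral_fderiv_epigraph h.lipschitz (hu.comp e.symm.contDiff)
      (hc.comp_homeomorph e.symm.toHomeomorph) (e v)
  have hmeas : Measurable fun x => ENNReal.ofReal (areaDensity (fderiv ℝ f x)) :=
    (continuous_areaDensity.measurable.comp (measurable_fderiv ℝ f)).ennreal_ofReal
  have h0 : ∀ x, x ∉ U → ∀ c, u x * c = 0 := fun x hx c => by
    rw [image_eq_zero_of_notMem_tsupport (fun h' => hx (hsupp h')), zero_mul]
  have hR : ∫ x, u x * inner ℝ v (outwardNormal D x) ∂(surfaceMeasure D) =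
      ∫ x : E2, u (e.symm (graphMap f x)) * (fderiv ℝ f x (baseProj (e v)) - e v 2) := by
    rw [← setIntegral_eq_integral_of_forall_compl_eq_zero (s := U) (fun x hx => h0 x hx _)]
    have h1 : ∫ x in U, u x * inner ℝ v (outwardNormal D x) ∂(surfaceMeasure D) =
        ∫ x in U, u x * inner ℝ v (e.symm (graphNormal (fderiv ℝ f (baseProj (e x)))))
          ∂(surfaceMeasure D) := by
      apply integral_congr_ae
      filter_upwards [h.ae_outwardNormal_eq] with x hx
      rw [hx]
    rw [h1, h.surfaceMeasure_restrict,
      setIntegral_eq_integral_of_forall_compl_eq_zero (fun x hx => h0 x hx _),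
      (IsGraphChart.measurableEmbedding_param (e := e) hfc).integral_map,
      integral_withDensity_eq_integral_toReal_smul hmeas (by simp)]
    congr 1
    funext x
    rw [ENNReal.toReal_ofReal (areaDensity_pos _).le, smul_eq_mul,
      LinearIsometryEquiv.apply_symm_apply, baseProj_graphMap,
      ← areaDensity_mul_inner_graphNormal, ← LinearIsometryEquiv.inner_map_map e v,
      LinearIsometryEquiv.apply_symm_apply]
    ring
  rw [hL, hR]

theorem integral_fderiv_eq_zero {u : E3 → ℝ} (hu : ContDiff ℝ 1 u) (hc : HasCompactSupport u)
    (v : E3) : ∫ x, fderiv ℝ u x v = 0 := by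
  obtain ⟨C, hC⟩ := hu.lipschitzWith_of_hasCompactSupport hc one_ne_zero
  rw [← integral_lineDeriv_eq_zero volume hC hc v]
  congr 1
  funext x
  exact ((hu.differentiable one_ne_zero x).lineDeriv_eq_fderiv).symm

theorem integral_fderiv_of_tsupport_subset {D : Set E3} {u : E3 → ℝ}
    (hDo : IsOpen D) (hu : ContDiff ℝ 1 u)
    (hc : HasCompactSupport u) (hsupp : tsupport u ⊆ D) (v : E3) :
    ∫ x in D, fderiv ℝ u x v = ∫ x, u x * inner ℝ v (outwardNormal D x) ∂(surfaceMeasure D) := by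
  rw [setIntegral_eq_integral_of_forall_compl_eq_zero (fun x hx =>
    fderiv_apply_eq_zero_of_notMem_tsupport (fun h' => hx (hsupp h')) v),
    integral_fderiv_eq_zero hu hc]
  symm
  apply setIntegral_eq_zero_of_forall_eq_zero
  intro x hx
  rw [hDo.frontier_eq] at hx
  rw [image_eq_zero_of_notMem_tsupport (f := u) (fun h' => hx.2 (hsupp h')), zero_mul]

namespace IsBoundedLipschitzDomain

variable {D : Set E3}

theorem integrable_mul_inner_outwardNormal (hD : IsBoundedLipschitzDomain D) {u : E3 → ℝ}
    (hu : Continuous u) (v : E3) :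
    Integrable (fun x => u x * inner ℝ v (outwardNormal D x)) (surfaceMeasure D) := by
  have := hD.isFiniteMeasure_surfaceMeasure
  obtain ⟨C, hC⟩ := hD.isCompact_frontier.exists_bound_of_continuousOn hu.continuousOn
  refine Integrable.of_bound (C := C * ‖v‖) ?_ ?_
  · have h1 := hD.aemeasurable_outwardNormal
    exact (hu.measurable.aemeasurable.mul (h1.const_inner)).aestronglyMeasurable
  · filter_upwards [ae_restrict_mem isClosed_frontier.measurableSet] with x hx
    rw [norm_mul]
    have h2 : ‖inner ℝ v (outwardNormal D x)‖ ≤ ‖v‖ :=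
      (norm_inner_le_norm _ _).trans
        (mul_le_of_le_one_right (norm_nonneg _) (norm_outwardNormal_le D x))
    exact mul_le_mul (hC x hx) h2 (norm_nonneg _) ((norm_nonneg _).trans (hC x hx))

open scoped Manifold ContDiff in
/-- **Divergence theorem** on a bounded Lipschitz domain. -/
theorem integral_fderiv (hD : IsBoundedLipschitzDomain D) {u : E3 → ℝ} (hu : ContDiff ℝ 1 u)
    (v : E3) :
    ∫ x in D, fderiv ℝ u x v = ∫ x, u x * inner ℝ v (outwardNormal D x) ∂(surfaceMeasure D) := by
  obtain ⟨ι, _, U, e, K, f, hch, hb, hcover⟩ := hD.exists_finite_charts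
  -- The index `none` stands for D itself, the region away from the boundary, where the localized
  -- integrals are zero on both sides.
  let V : Option ι → Set E3 := fun o => o.elim D U
  have hVo : ∀ o, IsOpen (V o) := by
    rintro (_ | i)
    · exact hD.isOpen
    · exact (hch i).isOpen
  have hVb : ∀ o, Bornology.IsBounded (V o) := by
    rintro (_ | i)
    · exact hD.isBounded
    · exact hb i
  have hVc : closure D ⊆ ⋃ o, V o := by
    intro x hx
    by_cases hxD : x ∈ D
    · exact Set.mem_iUnion.2 ⟨none, hxD⟩
    · have : x ∈ frontier D := by rw [hD.isOpen.frontier_eq]; exact ⟨hx, hxD⟩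
      obtain ⟨i, hi⟩ := Set.mem_iUnion.1 (hcover this)
      exact Set.mem_iUnion.2 ⟨some i, hi⟩
  obtain ⟨ρ, hρ⟩ := SmoothPartitionOfUnity.exists_isSubordinate 𝓘(ℝ, E3) isClosed_closure V hVo hVc
  have hρd : ∀ o, ContDiff ℝ 1 (ρ o) := fun o =>
    ((ρ o).contMDiff.contDiff).of_le (by exact_mod_cast le_top)
  let w : Option ι → E3 → ℝ := fun o x => ρ o x * u x
  have hwd : ∀ o, ContDiff ℝ 1 (w o) := fun o => (hρd o).mul hu
  have hwsupp : ∀ o, tsupport (w o) ⊆ V o := fun o =>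
    (closure_mono (Function.support_mul_subset_left _ _)).trans (hρ o)
  have hwc : ∀ o, HasCompactSupport (w o) := fun o =>
    Metric.isCompact_of_isClosed_isBounded (isClosed_tsupport _) ((hVb o).subset (hwsupp o))
  have hsum : ∀ x ∈ closure D, ∑ o, w o x = u x := by
    intro x hx
    rw [← Finset.sum_mul, ← finsum_eq_sum_of_fintype, ρ.sum_eq_one hx, one_mul]
  have hfd : ∀ x ∈ D, fderiv ℝ u x v = ∑ o, fderiv ℝ (w o) x v := by
    intro x hx
    have h1 : (fun y => ∑ o, w o y) =ᶠ[𝓝 x] u := by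
      filter_upwards [hD.isOpen.mem_nhds hx] with y hy
      exact hsum y (subset_closure hy)
    rw [← h1.fderiv_eq, fderiv_fun_sum fun o _ => ((hwd o).differentiable one_ne_zero x),
      sum_apply]
  have hpiece : ∀ o, ∫ x in D, fderiv ℝ (w o) x v =
      ∫ x, w o x * inner ℝ v (outwardNormal D x) ∂(surfaceMeasure D) := by
    rintro (_ | i)
    · exact integral_fderiv_of_tsupport_subset hD.isOpen (hwd none) (hwc none) (hwsupp none) v
    · exact (hch i).integral_fderiv hD.isOpen.measurableSet (hwd _) (hwc _) (hwsupp (some i)) v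
  rw [setIntegral_congr_fun hD.isOpen.measurableSet hfd, integral_finsetSum]
  · simp_rw [hpiece]
    rw [← integral_finsetSum _ fun o _ =>
      hD.integrable_mul_inner_outwardNormal (hwd o).continuous v]
    apply integral_congr_ae
    filter_upwards [ae_restrict_mem isClosed_frontier.measurableSet] with x hx
    rw [← Finset.sum_mul, hsum x (frontier_subset_closure hx)]
  · intro o _
    apply Integrable.integrableOn
    apply Continuous.integrable_of_hasCompactSupport
    · exact ((hwd o).continuous_fderiv one_ne_zero).clm_apply continuous_const
    · exact ((hwc o).fderiv ℝ).comp_left (g := fun L : E3 →L[ℝ] ℝ => L v) (by simp)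

end IsBoundedLipschitzDomain

/-! ### A regularized solid angle -/

/-- The derivative of `s³ (1 + s²)^{-3/2}`. -/
def radialWeight (s : ℝ) : ℝ := s ^ 2 * (3 * (1 + s ^ 2) ^ (-5 / 2 : ℝ))

theorem rpow_neg_three_halves {q : ℝ} (hq : 0 < q) :
    q ^ (-3 / 2 : ℝ) = q * q ^ (-5 / 2 : ℝ) := by
  rw [← Real.rpow_one_add' hq.le (by norm_num)]
  norm_num

theorem hasDerivAt_radialPrimitive (s : ℝ) :
    HasDerivAt (fun s : ℝ => s ^ 3 * (1 + s ^ 2) ^ (-3 / 2 : ℝ)) (radialWeight s) s := by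
  have hq : 0 < 1 + s ^ 2 := by positivity
  have h1 : HasDerivAt (fun s : ℝ => 1 + s ^ 2) (2 * s) s := by
    simpa using (hasDerivAt_pow 2 s).const_add 1
  have h2 := h1.rpow_const (p := (-3 / 2 : ℝ)) (Or.inl hq.ne')
  have h3 := (hasDerivAt_pow 3 s).mul h2
  refine h3.congr_deriv ?_
  rw [show (-3 / 2 - 1 : ℝ) = -5 / 2 by norm_num, rpow_neg_three_halves hq, radialWeight]
  push_cast
  ring

theorem radialWeight_nonneg (s : ℝ) : 0 ≤ radialWeight s := by
  unfold radialWeight; positivity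

theorem continuous_radialWeight : Continuous radialWeight := by
  unfold radialWeight
  have : Continuous fun s : ℝ => (1 + s ^ 2) ^ (-5 / 2 : ℝ) :=
    Continuous.rpow_const (by fun_prop) fun s => Or.inl (by positivity)
  fun_prop

theorem tendsto_radialPrimitive :
    Tendsto (fun s : ℝ => s ^ 3 * (1 + s ^ 2) ^ (-3 / 2 : ℝ)) atTop (𝓝 1) := by
  have h1 : Tendsto (fun s : ℝ => (1 - (1 + s ^ 2)⁻¹) ^ (3 / 2 : ℝ)) atTop (𝓝 1) := by
    have h2 : Tendsto (fun s : ℝ => 1 + s ^ 2) atTop atTop :=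
      tendsto_atTop_add_const_left _ _ (tendsto_pow_atTop two_ne_zero)
    have h3 : Tendsto (fun s : ℝ => 1 - (1 + s ^ 2)⁻¹) atTop (𝓝 1) := by
      simpa using h2.inv_tendsto_atTop.const_sub 1
    simpa using h3.rpow_const (p := (3 / 2 : ℝ)) (Or.inl one_ne_zero)
  refine h1.congr' ?_
  filter_upwards [eventually_ge_atTop 0] with s hs
  have hq : 0 < 1 + s ^ 2 := by positivity
  have h4 : 1 - (1 + s ^ 2)⁻¹ = s ^ 2 * (1 + s ^ 2)⁻¹ := by field_simp; ring
  rw [h4, Real.mul_rpow (by positivity) (by positivity), Real.inv_rpow hq.le, ← Real.rpow_neg hq.le,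
    ← Real.rpow_natCast s 2, ← Real.rpow_mul hs, ← Real.rpow_natCast s 3]
  norm_num

theorem integral_radialWeight : ∫ s in Set.Ioi (0 : ℝ), radialWeight s = 1 := by
  rw [integral_Ioi_of_hasDerivAt_of_nonneg' (fun s _ => hasDerivAt_radialPrimitive s)
    (fun s _ => radialWeight_nonneg s) tendsto_radialPrimitive]
  simp

theorem integrableOn_radialWeight : IntegrableOn radialWeight (Set.Ioi 0) :=
  integrableOn_Ioi_deriv_of_nonneg' (fun s _ => hasDerivAt_radialPrimitive s)
    (fun s _ => radialWeight_nonneg s) tendsto_radialPrimitive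

/-- At ρ = |x - y|/ε this is |x - y|³(|x - y|² + ε²)^(-3/2): averaging the cutoffs |x - y| > εs
replaces the singular denominator |x - y|³ by a smooth one. -/
theorem integral_radialWeight_lt {ρ : ℝ} (hρ : 0 ≤ ρ) :
    ∫ s in Set.Ioi (0 : ℝ), (if s < ρ then radialWeight s else 0) =
      ρ ^ 3 * (1 + ρ ^ 2) ^ (-3 / 2 : ℝ) := by
  have h1 : ∀ s : ℝ, (if s < ρ then radialWeight s else 0) = (Set.Iio ρ).indicator radialWeight s :=
    fun s => by simp [Set.indicator_apply]
  simp_rw [h1]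
  rw [integral_indicator measurableSet_Iio, Measure.restrict_restrict measurableSet_Iio,
    Set.inter_comm, Set.Ioi_inter_Iio, ← integral_Ioc_eq_integral_Ioo,
    ← intervalIntegral.integral_of_le hρ,
    intervalIntegral.integral_eq_sub_of_hasDerivAt (fun s _ => hasDerivAt_radialPrimitive s)
      (continuous_radialWeight.intervalIntegrable _ _)]
  simp

/-- The density `3 (1 + |u|²)^{-5/2}` on space. -/
def angleDensity (u : E3) : ℝ := 3 * (1 + ‖u‖ ^ 2) ^ (-5 / 2 : ℝ)

theorem angleDensity_nonneg (u : E3) : 0 ≤ angleDensity u := by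
  unfold angleDensity; positivity

theorem integrable_angleDensity : Integrable angleDensity := by
  have h := integrable_rpow_neg_one_add_norm_sq (E := E3) (μ := volume) (r := 5) (by simp; norm_num)
  exact h.const_mul 3

theorem integral_angleDensity : ∫ u, angleDensity u = 4 * Real.pi := by
  have h := integral_fun_norm_addHaar (E := E3) volume
    (fun s : ℝ => 3 * (1 + s ^ 2) ^ (-5 / 2 : ℝ))
  have h2 : ∫ u, angleDensity u = ∫ u : E3, 3 * (1 + ‖u‖ ^ 2) ^ (-5 / 2 : ℝ) := rfl
  rw [h2, h]
  have h3 : Module.finrank ℝ E3 = 3 := by simp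
  have h4 : volume.real (Metric.ball (0 : E3) 1) = Real.pi * 4 / 3 := by
    rw [Measure.real, EuclideanSpace.volume_ball_fin_three]
    simp [ENNReal.toReal_ofReal (show 0 ≤ Real.pi * 4 / 3 by positivity)]
  have h5 : ∫ s in Set.Ioi (0 : ℝ), s ^ (3 - 1) • (3 * (1 + s ^ 2) ^ (-5 / 2 : ℝ)) = 1 :=
    integral_radialWeight
  rw [h3, h4, h5]
  simp
  ring

/-- The solid angle of `D` seen from `y`, regularized at scale `ε`. -/
def solidAngle (D : Set E3) (ε : ℝ) (y : E3) : ℝ :=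
  ∫ x in D, 3 * ε ^ 2 * (‖x - y‖ ^ 2 + ε ^ 2) ^ (-5 / 2 : ℝ)

/-- The change of variables x = y + εu makes the density independent of ε and blows D up around y.
-/
theorem solidAngle_eq {D : Set E3} (hD : MeasurableSet D) {ε : ℝ} (hε : 0 < ε) (y : E3) :
    solidAngle D ε y = ∫ u, {u : E3 | ε • u + y ∈ D}.indicator angleDensity u := by
  set F : E3 → ℝ := fun x => 3 * ε ^ 2 * (‖x - y‖ ^ 2 + ε ^ 2) ^ (-5 / 2 : ℝ)
  have h1 := Measure.integral_comp_smul_of_nonneg volume (fun x => D.indicator F (x + y)) ε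
    (hR := hε.le)
  rw [integral_add_right_eq_self (D.indicator F) y, integral_indicator hD] at h1
  have h3 : Module.finrank ℝ E3 = 3 := by simp
  have h2 : solidAngle D ε y = ε ^ 3 * ∫ u, D.indicator F (ε • u + y) := by
    rw [h1, h3, smul_eq_mul, ← mul_assoc, mul_inv_cancel₀ (by positivity), one_mul]
    rfl
  rw [h2, ← integral_const_mul]
  congr 1
  funext u
  by_cases hu : ε • u + y ∈ D
  · rw [Set.indicator_of_mem hu, Set.indicator_of_mem (show u ∈ {u : E3 | ε • u + y ∈ D} from hu)]
    simp only [F, angleDensity, add_sub_cancel_right, norm_smul, Real.norm_eq_abs, abs_of_pos hε]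
    rw [show (ε * ‖u‖) ^ 2 + ε ^ 2 = ε ^ 2 * (1 + ‖u‖ ^ 2) by ring,
      Real.mul_rpow (by positivity) (by positivity), ← Real.rpow_natCast ε 2,
      ← Real.rpow_mul hε.le]
    have : ε ^ 3 * (ε ^ ((2 : ℕ) : ℝ) * ε ^ (((2 : ℕ) : ℝ) * (-5 / 2))) = 1 := by
      rw [← Real.rpow_natCast ε 3, ← Real.rpow_add hε, ← Real.rpow_add hε]
      norm_num
    linear_combination (3 * (1 + ‖u‖ ^ 2) ^ (-5 / 2 : ℝ)) * this
  · rw [Set.indicator_of_notMem hu,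
      Set.indicator_of_notMem (show u ∉ {u : E3 | ε • u + y ∈ D} from hu), mul_zero]

theorem abs_solidAngle_le {D : Set E3} (hD : MeasurableSet D) {ε : ℝ} (hε : 0 < ε) (y : E3) :
    |solidAngle D ε y| ≤ 4 * Real.pi := by
  have hm : MeasurableSet {u : E3 | ε • u + y ∈ D} := by
    have : Measurable fun u : E3 => ε • u + y := by fun_prop
    exact this hD
  rw [solidAngle_eq hD hε, ← integral_angleDensity, integral_indicator hm,
    abs_of_nonneg (integral_nonneg fun u => angleDensity_nonneg u)]
  exact setIntegral_le_integral integrable_angleDensity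
    (Eventually.of_forall angleDensity_nonneg)

theorem ae_inner_ne_zero {v : E3} (hv : v ≠ 0) : ∀ᵐ u : E3, inner ℝ u v ≠ 0 := by
  have h : volume ((LinearMap.ker (innerₛₗ ℝ v) : Submodule ℝ E3) : Set E3) = 0 := by
    apply Measure.addHaar_submodule
    intro htop
    have : v ∈ LinearMap.ker (innerₛₗ ℝ v) := htop ▸ Submodule.mem_top
    rw [LinearMap.mem_ker] at this
    exact hv (inner_self_eq_zero.1 this)
  rw [ae_iff]
  refine measure_mono_null (fun u hu => ?_) h
  simp only [not_not, Set.mem_ofPred_eq] at hu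
  change inner ℝ v u = 0
  rw [real_inner_comm]; exact hu

/-- The density is even and u ↦ -u exchanges the two sides of a null hyperplane, so a half-space
carries half of 4π. -/
theorem integral_angleDensity_halfSpace {v : E3} (hv : v ≠ 0) :
    ∫ u, {u : E3 | inner ℝ u v < 0}.indicator angleDensity u = 2 * Real.pi := by
  set H := {u : E3 | inner ℝ u v < 0}
  have hH : MeasurableSet H := (isOpen_lt (by fun_prop) continuous_const).measurableSet
  have hneg : ∫ u, H.indicator angleDensity (-u) = ∫ u, H.indicator angleDensity u :=
    integral_neg_eq_self _ _
  have hi := integrable_angleDensity.indicator hH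
  have hi' : Integrable fun u => H.indicator angleDensity (-u) := hi.comp_neg
  have hsum : ∫ u, (H.indicator angleDensity u + H.indicator angleDensity (-u)) =
      4 * Real.pi := by
    rw [← integral_angleDensity]
    apply integral_congr_ae
    filter_upwards [ae_inner_ne_zero hv] with u hu
    have hn : angleDensity (-u) = angleDensity u := by simp [angleDensity]
    rcases lt_or_gt_of_ne hu with h | h
    · have h' : -u ∉ H := by
        simp only [H, Set.mem_ofPred_eq, inner_neg_left]; linarith
      rw [Set.indicator_of_mem (show u ∈ H from h), Set.indicator_of_notMem h', add_zero]
    · have h1 : u ∉ H := by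
        simp only [H, Set.mem_ofPred_eq]; linarith
      have h2 : -u ∈ H := by
        simp only [H, Set.mem_ofPred_eq, inner_neg_left]; linarith
      rw [Set.indicator_of_notMem h1, Set.indicator_of_mem h2, zero_add, hn]
  rw [integral_add hi hi', hneg] at hsum
  linarith

/-- The cone condition says that the blow-ups of D at y converge to the half-space ⟨u, v⟩ < 0 for
almost every u; dominated convergence does the rest. -/
theorem tendsto_solidAngle {D : Set E3} (hD : MeasurableSet D) {y v : E3}
    (h : IsOutwardNormal D y v) :
    Tendsto (fun ε => solidAngle D ε y) (𝓝[>] 0) (𝓝 (2 * Real.pi)) := by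
  have hv : v ≠ 0 := by
    rintro rfl
    simpa using h.1
  rw [← integral_angleDensity_halfSpace hv]
  have hev : ∀ᶠ ε : ℝ in 𝓝[>] 0, ∫ u, {u : E3 | ε • u + y ∈ D}.indicator angleDensity u =
      solidAngle D ε y := by
    filter_upwards [self_mem_nhdsWithin] with ε hε
    exact (solidAngle_eq hD hε y).symm
  refine Tendsto.congr' hev ?_
  refine tendsto_integral_filter_of_dominated_convergence angleDensity ?_ ?_
    integrable_angleDensity ?_
  · refine Eventually.of_forall fun ε => ?_
    have hm : MeasurableSet {u : E3 | ε • u + y ∈ D} := by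
      have : Measurable fun u : E3 => ε • u + y := by fun_prop
      exact this hD
    exact (integrable_angleDensity.indicator hm).aestronglyMeasurable
  · refine Eventually.of_forall fun ε => Eventually.of_forall fun u => ?_
    refine (norm_indicator_le_norm_self _ _).trans ?_
    rw [Real.norm_of_nonneg (angleDensity_nonneg u)]
  · filter_upwards [ae_inner_ne_zero hv] with u hu
    have hu0 : 0 < ‖u‖ := by
      rw [norm_pos_iff]; rintro rfl; simp at hu
    -- Half the cosine of the angle between u and ±v, so that the whole ray through u lies strictly
    -- inside one of the two cones of opening δ.
    set δ := |inner ℝ u v| / (2 * ‖u‖)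
    have hδ : 0 < δ := by
      have := abs_pos.2 hu
      positivity
    have hδu : δ * ‖u‖ < |inner ℝ u v| := by
      have h1 : δ * ‖u‖ = |inner ℝ u v| / 2 := by simp only [δ]; field_simp
      have := abs_pos.2 hu
      linarith
    have hlim : Tendsto (fun ε : ℝ => ε • u + y) (𝓝[>] 0) (𝓝 y) := by
      have : Continuous fun ε : ℝ => ε • u + y := by fun_prop
      have h := this.tendsto 0
      simp only [zero_smul, zero_add] at h
      exact h.mono_left nhdsWithin_le_nhds
    apply tendsto_const_nhds.congr'
    filter_upwards [hlim.eventually (h.2 δ hδ), self_mem_nhdsWithin] with ε h1 h2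
    have hε : 0 < ε := h2
    simp only [add_sub_cancel_right, inner_smul_left, norm_smul, Real.norm_eq_abs,
      abs_of_pos hε, conj_trivial] at h1
    rcases lt_or_gt_of_ne hu with hlt | hgt
    · rw [abs_of_neg hlt] at hδu
      rw [Set.indicator_of_mem (show u ∈ {u : E3 | inner ℝ u v < 0} from hlt),
        Set.indicator_of_mem (show u ∈ {u : E3 | ε • u + y ∈ D} from h1.1 (by nlinarith))]
    · rw [abs_of_pos hgt] at hδu
      rw [Set.indicator_of_notMem (show u ∉ {u : E3 | inner ℝ u v < 0} from not_lt.2 hgt.le),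
        Set.indicator_of_notMem (show u ∉ {u : E3 | ε • u + y ∈ D} from h1.2 (by nlinarith))]

/-- Gauss' formula: the solid angle is a flux through the boundary. -/
theorem IsBoundedLipschitzDomain.integral_flux_eq_solidAngle {D : Set E3}
    (hD : IsBoundedLipschitzDomain D) {ε : ℝ} (hε : 0 < ε) (y : E3) :
    ∫ x, inner ℝ (x - y) (outwardNormal D x) * (‖x - y‖ ^ 2 + ε ^ 2) ^ (-3 / 2 : ℝ)
      ∂(surfaceMeasure D) = solidAngle D ε y := by
  set q : E3 → ℝ := fun x => ‖x - y‖ ^ 2 + ε ^ 2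
  have hq : ∀ x, 0 < q x := fun x => by positivity
  let b : Fin 3 → E3 := fun i => EuclideanSpace.single i 1
  let u : Fin 3 → E3 → ℝ := fun i x => (x i - y i) * q x ^ (-3 / 2 : ℝ)
  have hqd : ContDiff ℝ 1 q := by
    have : ContDiff ℝ 1 fun x : E3 => ‖x - y‖ ^ 2 := (contDiff_id.sub contDiff_const).norm_sq ℝ
    fun_prop
  have hqr : ContDiff ℝ 1 (fun x => q x ^ (-3 / 2 : ℝ)) :=
    hqd.rpow_const_of_ne fun x => (hq x).ne'
  have hud : ∀ i, ContDiff ℝ 1 (u i) := by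
    intro i
    refine ContDiff.mul ?_ hqr
    fun_prop
  have hfd : ∀ i x, fderiv ℝ (u i) x (b i) = q x ^ (-3 / 2 : ℝ) -
      3 * (x i - y i) ^ 2 * q x ^ (-5 / 2 : ℝ) := by
    intro i x
    have hl : HasDerivAt (fun t : ℝ => x + t • b i) (b i) 0 := by
      simpa using ((hasDerivAt_id (0 : ℝ)).smul_const (b i)).const_add x
    have h1 : HasDerivAt (fun t : ℝ => u i (x + t • b i)) (fderiv ℝ (u i) x (b i)) 0 := by
      have hF : HasFDerivAt (u i) (fderiv ℝ (u i) x) (x + (0 : ℝ) • b i) := by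
        simpa using ((hud i).differentiable one_ne_zero x).hasFDerivAt
      exact hF.comp_hasDerivAt (0 : ℝ) hl
    have hqt : ∀ t : ℝ, q (x + t • b i) = q x + 2 * t * (x i - y i) + t ^ 2 := by
      intro t
      have e1 : x + t • b i - y = (x - y) + t • b i := by abel
      have e2 : inner ℝ (x - y) (b i) = x i - y i := by
        simp [b, EuclideanSpace.inner_single_right]
      have e3 : ‖b i‖ = 1 := by simp [b]
      simp only [q]
      rw [e1, norm_add_sq_real, inner_smul_right, e2, norm_smul, e3, mul_one, Real.norm_eq_abs,
        sq_abs]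
      ring
    have hit : ∀ t : ℝ, (x + t • b i) i = x i + t := by
      intro t; simp [b]
    have h2 : HasDerivAt (fun t : ℝ => u i (x + t • b i))
        (1 * (q x) ^ (-3 / 2 : ℝ) + (x i - y i) *
          (2 * (x i - y i) * (-3 / 2) * q x ^ (-3 / 2 - 1 : ℝ))) 0 := by
      have a1 : HasDerivAt (fun t : ℝ => x i + t - y i) 1 0 :=
        ((hasDerivAt_id (0 : ℝ)).const_add (x i)).sub_const (y i)
      have a2 : HasDerivAt (fun t : ℝ => q x + 2 * t * (x i - y i) + t ^ 2)
          (2 * (x i - y i)) 0 := by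
        refine (((((hasDerivAt_id (0 : ℝ)).const_mul 2).mul_const (x i - y i)).const_add
          (q x)).fun_add (hasDerivAt_pow 2 (0 : ℝ))).congr_deriv ?_
        simp
      have a3 := a2.rpow_const (p := (-3 / 2 : ℝ)) (Or.inl (by simpa using (hq x).ne'))
      have a4 := a1.mul a3
      have e : (fun t : ℝ => u i (x + t • b i)) = (fun t : ℝ => x i + t - y i) *
          fun t : ℝ => (q x + 2 * t * (x i - y i) + t ^ 2) ^ (-3 / 2 : ℝ) := by
        funext t
        simp only [u, Pi.mul_apply, hqt, hit]
      rw [e]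
      simpa using a4
    rw [h1.unique h2, show (-3 / 2 - 1 : ℝ) = -5 / 2 by norm_num]
    ring
  have hpt : ∀ x, inner ℝ (x - y) (outwardNormal D x) * q x ^ (-3 / 2 : ℝ) =
      ∑ i, u i x * inner ℝ (b i) (outwardNormal D x) := by
    intro x
    simp only [u, b, PiLp.inner_apply, Finset.sum_mul]
    refine Finset.sum_congr rfl fun i _ => ?_
    simp
    ring
  -- The divergence is 3q^(-3/2) - 3|x - y|² q^(-5/2), and q - |x - y|² = ε².
  have hdiv : ∀ x, ∑ i, fderiv ℝ (u i) x (b i) = 3 * ε ^ 2 * q x ^ (-5 / 2 : ℝ) := by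
    intro x
    simp_rw [hfd]
    have h1 : ‖x - y‖ ^ 2 = (x 0 - y 0) ^ 2 + (x 1 - y 1) ^ 2 + (x 2 - y 2) ^ 2 := by
      rw [norm_sq_eq_coords]; rfl
    have h2 : q x = ‖x - y‖ ^ 2 + ε ^ 2 := rfl
    rw [Fin.sum_univ_three, rpow_neg_three_halves (hq x)]
    linear_combination 3 * q x ^ (-5 / 2 : ℝ) * (h1 + h2)
  refine (integral_congr_ae (Eventually.of_forall hpt)).trans ?_
  rw [integral_finsetSum _ fun i _ =>
    hD.integrable_mul_inner_outwardNormal (hud i).continuous (b i)]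
  rw [Finset.sum_congr rfl fun i _ => (hD.integral_fderiv (hud i) (b i)).symm,
    ← integral_finsetSum]
  · simp_rw [hdiv]
    rfl
  · intro i _
    have hc : Continuous fun x => fderiv ℝ (u i) x (b i) :=
      ((hud i).continuous_fderiv one_ne_zero).clm_apply continuous_const
    exact (hc.continuousOn.integrableOn_compact
      (Metric.isCompact_of_isClosed_isBounded isClosed_closure hD.isBounded.closure)).mono_set
      subset_closure

/-! ### The mean of `K_D^*[φ]` -/

/-- The kernel `⟨x - y, ν(x)⟩ / |x - y|³`. -/
def npKernel (D : Set E3) (p : E3 × E3) : ℝ :=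
  inner ℝ (p.1 - p.2) (outwardNormal D p.1) / ‖p.1 - p.2‖ ^ 3

/-- The integrand of the truncated operator. -/
def truncKernel (D : Set E3) (φ : E3 → ℂ) (a : ℝ) (p : E3 × E3) : ℂ :=
  if a < ‖p.1 - p.2‖ then (npKernel D p : ℂ) * φ p.2 else 0

theorem truncatedNPAdjoint_eq (D : Set E3) (a : ℝ) (φ : E3 → ℂ) (x : E3) :
    truncatedNPAdjoint D a φ x =
      (1 / (4 * Real.pi) : ℝ) * ∫ y, truncKernel D φ a (x, y) ∂(surfaceMeasure D) := by
  have hm : MeasurableSet {y : E3 | a < ‖x - y‖} :=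
    (isOpen_lt continuous_const (by fun_prop)).measurableSet
  rw [truncatedNPAdjoint, ← integral_indicator hm]
  congr 2

theorem abs_npKernel_le (D : Set E3) (p : E3 × E3) : |npKernel D p| ≤ (‖p.1 - p.2‖ ^ 2)⁻¹ := by
  rcases eq_or_ne (p.1 - p.2) 0 with h | h
  · simp [npKernel, h]
  have hpos : 0 < ‖p.1 - p.2‖ := norm_pos_iff.2 h
  have h1 : |inner ℝ (p.1 - p.2) (outwardNormal D p.1)| ≤ ‖p.1 - p.2‖ :=
    (abs_real_inner_le_norm _ _).trans
      (mul_le_of_le_one_right (norm_nonneg _) (norm_outwardNormal_le D p.1))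
  rw [npKernel, abs_div, abs_of_pos (pow_pos hpos 3), div_le_iff₀ (pow_pos hpos 3)]
  refine h1.trans (le_of_eq ?_)
  field_simp

theorem norm_truncKernel_le (D : Set E3) (φ : E3 → ℂ) {a : ℝ} (ha : 0 < a) (p : E3 × E3) :
    ‖truncKernel D φ a p‖ ≤ (a ^ 2)⁻¹ * ‖φ p.2‖ := by
  unfold truncKernel
  split_ifs with h
  · rw [norm_mul, Complex.norm_real]
    refine mul_le_mul_of_nonneg_right ((abs_npKernel_le D p).trans ?_) (norm_nonneg _)
    gcongr
  · rw [norm_zero]; positivity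

namespace IsBoundedLipschitzDomain

variable {D : Set E3}

theorem aemeasurable_inner_normal (hD : IsBoundedLipschitzDomain D) :
    AEMeasurable (fun p : E3 × E3 => inner ℝ (p.1 - p.2) (outwardNormal D p.1))
      ((surfaceMeasure D).prod (surfaceMeasure D)) := by
  have := hD.isFiniteMeasure_surfaceMeasure
  have h1 : AEMeasurable (fun p : E3 × E3 => outwardNormal D p.1)
      ((surfaceMeasure D).prod (surfaceMeasure D)) := hD.aemeasurable_outwardNormal.comp_fst
  have h2 : AEMeasurable (fun p : E3 × E3 => p.1 - p.2)
      ((surfaceMeasure D).prod (surfaceMeasure D)) := by fun_prop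
  exact h2.inner h1

theorem aemeasurable_npKernel (hD : IsBoundedLipschitzDomain D) :
    AEMeasurable (npKernel D) ((surfaceMeasure D).prod (surfaceMeasure D)) := by
  unfold npKernel
  refine hD.aemeasurable_inner_normal.div ?_
  fun_prop

theorem aestronglyMeasurable_mul_snd (hD : IsBoundedLipschitzDomain D) {φ : E3 → ℂ}
    (hφ : Integrable φ (surfaceMeasure D)) {k : E3 × E3 → ℝ}
    (hk : AEMeasurable k ((surfaceMeasure D).prod (surfaceMeasure D))) :
    AEStronglyMeasurable (fun p : E3 × E3 => (k p : ℂ) * φ p.2)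
      ((surfaceMeasure D).prod (surfaceMeasure D)) := by
  have := hD.isFiniteMeasure_surfaceMeasure
  exact (Complex.measurable_ofReal.comp_aemeasurable hk).aestronglyMeasurable.mul
    hφ.aestronglyMeasurable.comp_snd

theorem integrable_truncKernel (hD : IsBoundedLipschitzDomain D) {φ : E3 → ℂ}
    (hφ : Integrable φ (surfaceMeasure D)) {a : ℝ} (ha : 0 < a) :
    Integrable (truncKernel D φ a) ((surfaceMeasure D).prod (surfaceMeasure D)) := by
  have := hD.isFiniteMeasure_surfaceMeasure
  have hm : MeasurableSet {p : E3 × E3 | a < ‖p.1 - p.2‖} :=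
    (isOpen_lt continuous_const (by fun_prop)).measurableSet
  refine Integrable.mono' (g := fun p : E3 × E3 => (a ^ 2)⁻¹ * ‖φ p.2‖)
    ((hφ.norm.comp_snd _).const_mul _) ?_
    (Eventually.of_forall fun p => norm_truncKernel_le D φ ha p)
  exact (hD.aestronglyMeasurable_mul_snd hφ hD.aemeasurable_npKernel).indicator hm

theorem integrable_truncatedNPAdjoint (hD : IsBoundedLipschitzDomain D) {φ : E3 → ℂ}
    (hφ : Integrable φ (surfaceMeasure D)) {a : ℝ} (ha : 0 < a) :
    Integrable (truncatedNPAdjoint D a φ) (surfaceMeasure D) := by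
  have := hD.isFiniteMeasure_surfaceMeasure
  rw [show truncatedNPAdjoint D a φ = _ from funext (truncatedNPAdjoint_eq D a φ)]
  exact (hD.integrable_truncKernel hφ ha).integral_prod_left.const_mul _

theorem integral_truncatedNPAdjoint (hD : IsBoundedLipschitzDomain D) {φ : E3 → ℂ}
    (hφ : Integrable φ (surfaceMeasure D)) {a : ℝ} (ha : 0 < a) :
    ∫ x, truncatedNPAdjoint D a φ x ∂(surfaceMeasure D) =
      (1 / (4 * Real.pi) : ℝ) *
        ∫ p, truncKernel D φ a p ∂((surfaceMeasure D).prod (surfaceMeasure D)) := by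
  have := hD.isFiniteMeasure_surfaceMeasure
  simp_rw [truncatedNPAdjoint_eq]
  rw [integral_const_mul, integral_prod _ (hD.integrable_truncKernel hφ ha)]

/-- The truncated kernel is bounded by (εs)⁻², and the weight vanishes like s² at 0. This
cancellation is what makes Fubini legitimate. -/
theorem integrable_weighted_truncKernel (hD : IsBoundedLipschitzDomain D) {φ : E3 → ℂ}
    (hφ : Integrable φ (surfaceMeasure D)) {ε : ℝ} (hε : 0 < ε) :
    Integrable (fun r : ℝ × (E3 × E3) => (radialWeight r.1 : ℂ) * truncKernel D φ (ε * r.1) r.2)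
      (((volume : Measure ℝ).restrict (Set.Ioi 0)).prod
        ((surfaceMeasure D).prod (surfaceMeasure D))) := by
  have := hD.isFiniteMeasure_surfaceMeasure
  have hb : Integrable (fun s : ℝ => 3 * (ε ^ 2)⁻¹ * (1 + ‖s‖ ^ 2) ^ (-5 / 2 : ℝ))
      ((volume : Measure ℝ).restrict (Set.Ioi 0)) :=
    ((integrable_rpow_neg_one_add_norm_sq (E := ℝ) (μ := volume) (r := 5)
      (by simp)).const_mul _).restrict
  have hg := hb.mul_prod (hφ.norm.comp_snd (surfaceMeasure D))
  refine hg.mono' ?_ ?_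
  · have hm : MeasurableSet {r : ℝ × (E3 × E3) | ε * r.1 < ‖r.2.1 - r.2.2‖} :=
      (isOpen_lt (by fun_prop) (by fun_prop)).measurableSet
    have h1 := (hD.aestronglyMeasurable_mul_snd hφ hD.aemeasurable_npKernel).comp_snd
      (μ := (volume : Measure ℝ).restrict (Set.Ioi 0))
    have h2 : AEStronglyMeasurable (fun r : ℝ × (E3 × E3) => truncKernel D φ (ε * r.1) r.2)
        (((volume : Measure ℝ).restrict (Set.Ioi 0)).prod
          ((surfaceMeasure D).prod (surfaceMeasure D))) := h1.indicator hm
    have h3 : Continuous fun r : ℝ × (E3 × E3) => (radialWeight r.1 : ℂ) :=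
      Complex.continuous_ofReal.comp (continuous_radialWeight.comp continuous_fst)
    exact h3.aestronglyMeasurable.mul h2
  · have hpos : ∀ᵐ r : ℝ × (E3 × E3) ∂(((volume : Measure ℝ).restrict (Set.Ioi 0)).prod
        ((surfaceMeasure D).prod (surfaceMeasure D))), 0 < r.1 :=
      Measure.quasiMeasurePreserving_fst.ae
        (ae_restrict_mem (measurableSet_Ioi : MeasurableSet (Set.Ioi (0 : ℝ))))
    filter_upwards [hpos] with r hr
    rw [norm_mul, Complex.norm_real, Real.norm_of_nonneg (radialWeight_nonneg _)]
    refine (mul_le_mul_of_nonneg_left (norm_truncKernel_le D φ (mul_pos hε hr) r.2)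
      (radialWeight_nonneg _)).trans (le_of_eq ?_)
    rw [radialWeight, Real.norm_of_nonneg hr.le]
    field_simp

theorem integral_radialWeight_truncKernel {ε : ℝ} (hε : 0 < ε) (φ : E3 → ℂ)
    (p : E3 × E3) :
    ∫ s in Set.Ioi (0 : ℝ), (radialWeight s : ℂ) * truncKernel D φ (ε * s) p =
      ((inner ℝ (p.1 - p.2) (outwardNormal D p.1) *
        (‖p.1 - p.2‖ ^ 2 + ε ^ 2) ^ (-3 / 2 : ℝ) : ℝ) : ℂ) * φ p.2 := by
  set ρ := ‖p.1 - p.2‖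
  have hρ : 0 ≤ ρ := norm_nonneg _
  have h1 : ∀ s : ℝ, (radialWeight s : ℂ) * truncKernel D φ (ε * s) p =
      ((if s < ρ / ε then radialWeight s else 0 : ℝ) : ℂ) * ((npKernel D p : ℂ) * φ p.2) := by
    intro s
    have : ε * s < ρ ↔ s < ρ / ε := by rw [lt_div_iff₀ hε, mul_comm]
    unfold truncKernel
    by_cases h : s < ρ / ε
    · rw [if_pos h, if_pos (this.2 h)]
    · rw [if_neg h, if_neg (fun h' => h (this.1 h'))]; simp
  simp_rw [h1]
  rw [integral_mul_const, integral_complex_ofReal, integral_radialWeight_lt (by positivity), ← mul_assoc,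
    ← Complex.ofReal_mul]
  congr 2
  rcases eq_or_ne (p.1 - p.2) 0 with h | h
  · simp [npKernel, h]
  have hρ0 : 0 < ρ := norm_pos_iff.2 h
  have h2 : (ρ ^ 2 + ε ^ 2) = ε ^ 2 * (1 + (ρ / ε) ^ 2) := by field_simp; ring
  rw [h2, Real.mul_rpow (by positivity) (by positivity), ← Real.rpow_natCast ε 2,
    ← Real.rpow_mul hε.le, npKernel]
  have h3 : ε ^ (((2 : ℕ) : ℝ) * (-3 / 2)) = (ε ^ 3)⁻¹ := by
    rw [← Real.rpow_natCast ε 3, ← Real.rpow_neg hε.le]; norm_num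
  rw [h3]
  change (ρ / ε) ^ 3 * _ * (_ / ρ ^ 3) = _
  field_simp

/-- The averaged truncated integrals are given by the regularized solid angle. -/
theorem integral_radialWeight_mul (hD : IsBoundedLipschitzDomain D) {φ : E3 → ℂ}
    (hφ : Integrable φ (surfaceMeasure D)) {ε : ℝ} (hε : 0 < ε) :
    ∫ s in Set.Ioi (0 : ℝ), (radialWeight s : ℂ) *
        ∫ p, truncKernel D φ (ε * s) p ∂((surfaceMeasure D).prod (surfaceMeasure D)) =
      ∫ y, (solidAngle D ε y : ℂ) * φ y ∂(surfaceMeasure D) := by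
  have := hD.isFiniteMeasure_surfaceMeasure
  have hint := hD.integrable_weighted_truncKernel hφ hε
  have h1 := integral_integral_swap (f := fun (s : ℝ) (p : E3 × E3) =>
    (radialWeight s : ℂ) * truncKernel D φ (ε * s) p) hint
  simp only [integral_const_mul] at h1
  rw [h1]
  simp_rw [integral_radialWeight_truncKernel hε]
  have hint2 : Integrable (fun p : E3 × E3 => ((inner ℝ (p.1 - p.2) (outwardNormal D p.1) *
        (‖p.1 - p.2‖ ^ 2 + ε ^ 2) ^ (-3 / 2 : ℝ) : ℝ) : ℂ) * φ p.2)
      ((surfaceMeasure D).prod (surfaceMeasure D)) := by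
    have := hint.integral_prod_right
    simp_rw [integral_radialWeight_truncKernel hε] at this
    exact this
  rw [integral_prod_symm _ hint2]
  congr 1
  funext y
  simp only
  rw [integral_mul_const, integral_complex_ofReal, hD.integral_flux_eq_solidAngle hε]

theorem tendsto_integral_solidAngle (hD : IsBoundedLipschitzDomain D) {φ : E3 → ℂ}
    (hφ : Integrable φ (surfaceMeasure D)) :
    Tendsto (fun ε => ∫ y, (solidAngle D ε y : ℂ) * φ y ∂(surfaceMeasure D)) (𝓝[>] 0)
      (𝓝 (((2 * Real.pi : ℝ) : ℂ) * ∫ y, φ y ∂(surfaceMeasure D))) := by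
  have hDm := hD.isOpen.measurableSet
  rw [← integral_const_mul]
  refine tendsto_integral_filter_of_dominated_convergence
    (fun y => 4 * Real.pi * ‖φ y‖) ?_ ?_ (hφ.norm.const_mul _) ?_
  · filter_upwards [self_mem_nhdsWithin] with ε hε
    have hm : StronglyMeasurable fun y => solidAngle D ε y := by
      unfold solidAngle
      apply StronglyMeasurable.integral_prod_right (f := fun (y x : E3) =>
        3 * ε ^ 2 * (‖x - y‖ ^ 2 + ε ^ 2) ^ (-5 / 2 : ℝ))
      apply Measurable.stronglyMeasurable
      fun_prop
    exact (Complex.continuous_ofReal.comp_stronglyMeasurable hm).aestronglyMeasurable.mul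
      hφ.aestronglyMeasurable
  · filter_upwards [self_mem_nhdsWithin] with ε hε
    refine Eventually.of_forall fun y => ?_
    rw [norm_mul, Complex.norm_real]
    exact mul_le_mul_of_nonneg_right (abs_solidAngle_le hDm hε y) (norm_nonneg _)
  · filter_upwards [hD.ae_isOutwardNormal] with y hy
    exact ((Complex.continuous_ofReal.tendsto _).comp (tendsto_solidAngle hDm hy)).mul_const _

/-- Averaging over scales against a probability density does not change the limit, provided B is
bounded. -/
theorem tendsto_integral_radialWeight_mul {B : ℝ → ℂ} {L : ℂ} {C : ℝ}
    (hB : Tendsto B (𝓝[>] 0) (𝓝 L)) (hC : ∀ a, 0 < a → ‖B a‖ ≤ C)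
    (hm : ∀ ε > 0, AEStronglyMeasurable (fun s => (radialWeight s : ℂ) * B (ε * s))
      ((volume : Measure ℝ).restrict (Set.Ioi 0))) :
    Tendsto (fun ε => ∫ s in Set.Ioi (0 : ℝ), (radialWeight s : ℂ) * B (ε * s)) (𝓝[>] 0)
      (𝓝 L) := by
  have hL : ∫ s in Set.Ioi (0 : ℝ), (radialWeight s : ℂ) * L = L := by
    rw [integral_mul_const, integral_complex_ofReal, integral_radialWeight]; simp
  rw [← hL]
  refine tendsto_integral_filter_of_dominated_convergence (fun s => radialWeight s * C) ?_ ?_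
    (integrableOn_radialWeight.mul_const C) ?_
  · filter_upwards [self_mem_nhdsWithin] with ε hε
    exact hm ε hε
  · filter_upwards [self_mem_nhdsWithin] with ε hε
    filter_upwards [ae_restrict_mem measurableSet_Ioi] with s hs
    rw [norm_mul, Complex.norm_real, Real.norm_of_nonneg (radialWeight_nonneg _)]
    exact mul_le_mul_of_nonneg_left (hC _ (mul_pos hε hs)) (radialWeight_nonneg _)
  · filter_upwards [ae_restrict_mem measurableSet_Ioi] with s hs
    have hs : 0 < s := hs
    refine (hB.comp ?_).const_mul _
    rw [tendsto_nhdsWithin_iff]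
    constructor
    · have : Continuous fun ε : ℝ => ε * s := by fun_prop
      have h := this.tendsto 0
      rw [zero_mul] at h
      exact h.mono_left nhdsWithin_le_nhds
    · filter_upwards [self_mem_nhdsWithin] with ε hε
      exact mul_pos hε hs

/-- Only the L² half of the principal value condition is used: on a finite measure space it gives L¹
convergence, hence convergence of integrals. -/
theorem tendsto_integral_truncatedNPAdjoint (hD : IsBoundedLipschitzDomain D)
    {T : L2 D →L[ℂ] L2 D} (hT : IsNPAdjoint D T) (φ : L2 D) :
    Tendsto (fun ε => ∫ x, truncatedNPAdjoint D ε φ x ∂(surfaceMeasure D)) (𝓝[>] 0)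
      (𝓝 (∫ x, T φ x ∂(surfaceMeasure D))) := by
  have := hD.isFiniteMeasure_surfaceMeasure
  have hφ : Integrable φ (surfaceMeasure D) := (Lp.memLp φ).integrable one_le_two
  have hTφ : Integrable (T φ) (surfaceMeasure D) := (Lp.memLp (T φ)).integrable one_le_two
  refine tendsto_integral_of_L1' _ hTφ.aestronglyMeasurable ?_ ?_
  · filter_upwards [self_mem_nhdsWithin] with ε hε
    exact hD.integrable_truncatedNPAdjoint hφ hε
  · have h2 := (hT φ).2
    set c : ℝ≥0∞ := surfaceMeasure D Set.univ ^ (1 / (1 : ℝ≥0∞).toReal - 1 / (2 : ℝ≥0∞).toReal)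
    have hc : c ≠ ∞ := by
      apply ENNReal.rpow_ne_top_of_nonneg _ (measure_ne_top _ _)
      norm_num
    have h3 := ENNReal.Tendsto.mul_const (b := c) h2 (Or.inr hc)
    rw [zero_mul] at h3
    refine tendsto_of_tendsto_of_tendsto_of_le_of_le' tendsto_const_nhds h3
      (Eventually.of_forall fun _ => zero_le) ?_
    filter_upwards [self_mem_nhdsWithin] with ε hε
    exact eLpNorm_le_eLpNorm_mul_rpow_measure_univ one_le_two
      ((hD.integrable_truncatedNPAdjoint hφ hε).aestronglyMeasurable.sub hTφ.aestronglyMeasurable)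

/-- The operator `K_D^*` halves the mean. -/
theorem integral_npAdjoint (hD : IsBoundedLipschitzDomain D)
    {T : L2 D →L[ℂ] L2 D} (hT : IsNPAdjoint D T) (φ : L2 D) :
    ∫ x, T φ x ∂(surfaceMeasure D) = (1 / 2 : ℝ) * ∫ x, φ x ∂(surfaceMeasure D) := by
  have := hD.isFiniteMeasure_surfaceMeasure
  have hφ : Integrable φ (surfaceMeasure D) := (Lp.memLp φ).integrable one_le_two
  have hpi := Real.pi_pos
  set B : ℝ → ℂ := fun a =>
    ∫ p, truncKernel D φ a p ∂((surfaceMeasure D).prod (surfaceMeasure D))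
  set M := ∫ x, T φ x ∂(surfaceMeasure D)
  have hB : Tendsto B (𝓝[>] 0) (𝓝 (((4 * Real.pi : ℝ) : ℂ) * M)) := by
    refine ((hD.tendsto_integral_truncatedNPAdjoint hT φ).const_mul
      ((4 * Real.pi : ℝ) : ℂ)).congr' ?_
    filter_upwards [self_mem_nhdsWithin] with ε hε
    rw [hD.integral_truncatedNPAdjoint hφ hε, ← mul_assoc, ← Complex.ofReal_mul,
      mul_one_div_cancel (by positivity), Complex.ofReal_one, one_mul]
  -- Small radii are controlled by convergence of B at 0, radii at least δ by the kernel bound δ⁻².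
  obtain ⟨C, hC⟩ : ∃ C, ∀ a, 0 < a → ‖B a‖ ≤ C := by
    have hev := hB.norm.eventually_le_const (lt_add_one _)
    obtain ⟨δ, hδ, hball⟩ := mem_nhdsGT_iff_exists_Ioo_subset.1 hev
    have hδ : 0 < δ := hδ
    set C₂ := ∫ p : E3 × E3, (δ ^ 2)⁻¹ * ‖φ p.2‖ ∂((surfaceMeasure D).prod (surfaceMeasure D))
    refine ⟨max (‖((4 * Real.pi : ℝ) : ℂ) * M‖ + 1) C₂, fun a ha => ?_⟩
    rcases lt_or_ge a δ with h | h
    · exact (hball ⟨ha, h⟩ : ‖B a‖ ≤ _).trans (le_max_left _ _)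
    · refine le_trans ?_ (le_max_right _ _)
      refine norm_integral_le_of_norm_le ((hφ.norm.comp_snd _).const_mul _)
        (Eventually.of_forall fun p => (norm_truncKernel_le D φ ha p).trans ?_)
      gcongr
  have hm : ∀ ε > 0, AEStronglyMeasurable (fun s => (radialWeight s : ℂ) * B (ε * s))
      ((volume : Measure ℝ).restrict (Set.Ioi 0)) := by
    intro ε hε
    have := (hD.integrable_weighted_truncKernel hφ hε).integral_prod_left.aestronglyMeasurable
    simpa only [integral_const_mul] using this
  have h1 := tendsto_integral_radialWeight_mul hB hC hm
  have h2 := hD.tendsto_integral_solidAngle hφ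
  -- The same averages tend to 4π times the mean of Tφ and to 2π times the mean of φ.
  have h3 := tendsto_nhds_unique (h1.congr' (by
    filter_upwards [self_mem_nhdsWithin] with ε hε
    exact hD.integral_radialWeight_mul hφ hε)) h2
  have h4 : ((4 * Real.pi : ℝ) : ℂ) ≠ 0 := by
    exact_mod_cast (by positivity : (4 * Real.pi : ℝ) ≠ 0)
  apply mul_left_cancel₀ h4
  rw [h3, ← mul_assoc, ← Complex.ofReal_mul]
  congr 2
  ring

end IsBoundedLipschitzDomain

/-! ### Normal derivatives of harmonic functions -/

theorem fderiv_apply_eq_sum_single (L : E3 →L[ℝ] ℂ) (v : E3) :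
    L v = ∑ i : Fin 3, L (EuclideanSpace.single i 1) *
      (inner ℝ (EuclideanSpace.single i 1 : E3) v : ℂ) := by
  have hv : v = ∑ i : Fin 3, v i • (EuclideanSpace.single i 1 : E3) := by
    ext j
    fin_cases j <;> simp [Fin.sum_univ_three]
  conv_lhs => rw [hv, map_sum]
  refine Finset.sum_congr rfl fun i _ => ?_
  rw [map_smul, Complex.real_smul, EuclideanSpace.inner_single_left, mul_comm]
  simp

namespace IsBoundedLipschitzDomain

variable {D : Set E3}

theorem memLp_normalDerivative (hD : IsBoundedLipschitzDomain D) {h : E3 → ℂ}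
    (hh : ContDiff ℝ 1 h) : MemLp (normalDerivative D h) 2 (surfaceMeasure D) := by
  have := hD.isFiniteMeasure_surfaceMeasure
  have hc : Continuous (fderiv ℝ h) := hh.continuous_fderiv one_ne_zero
  obtain ⟨C, hC⟩ := hD.isCompact_frontier.exists_bound_of_continuousOn hc.continuousOn
  refine MemLp.of_bound (C := C) ?_ ?_
  · have h1 : Measurable fun p : E3 × E3 => fderiv ℝ h p.1 p.2 :=
      ((hc.comp continuous_fst).clm_apply continuous_snd).measurable
    have h2 : AEMeasurable (fun x => (x, outwardNormal D x)) (surfaceMeasure D) :=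
      aemeasurable_id.prodMk hD.aemeasurable_outwardNormal
    exact (h1.comp_aemeasurable h2).aestronglyMeasurable
  · filter_upwards [ae_restrict_mem isClosed_frontier.measurableSet] with x hx
    refine ((fderiv ℝ h x).le_opNorm _).trans ?_
    exact (mul_le_of_le_one_right (norm_nonneg _) (norm_outwardNormal_le D x)).trans (hC x hx)

theorem normalDerivativeL2_coeFn (hD : IsBoundedLipschitzDomain D) {h : E3 → ℂ}
    (hh : ContDiff ℝ 1 h) :
    normalDerivativeL2 D h =ᵐ[surfaceMeasure D] normalDerivative D h := by
  rw [normalDerivativeL2, dif_pos (hD.memLp_normalDerivative hh)]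
  exact MemLp.coeFn_toLp _

theorem normalDerivativeL2_add (hD : IsBoundedLipschitzDomain D) {g h : E3 → ℂ}
    (hg : ContDiff ℝ 1 g) (hh : ContDiff ℝ 1 h) :
    normalDerivativeL2 D (fun x => g x + h x) =
      normalDerivativeL2 D g + normalDerivativeL2 D h := by
  apply Lp.ext
  filter_upwards [hD.normalDerivativeL2_coeFn (hg.add hh), hD.normalDerivativeL2_coeFn hg,
    hD.normalDerivativeL2_coeFn hh, Lp.coeFn_add (normalDerivativeL2 D g) (normalDerivativeL2 D h)]
    with x h1 h2 h3 h4
  rw [h1, h4, Pi.add_apply, h2, h3, normalDerivative,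
    fderiv_fun_add (hg.differentiable one_ne_zero x) (hh.differentiable one_ne_zero x)]
  rfl

theorem normalDerivativeL2_const_mul (hD : IsBoundedLipschitzDomain D) {h : E3 → ℂ}
    (hh : ContDiff ℝ 1 h) (c : ℂ) :
    normalDerivativeL2 D (fun x => c * h x) = c • normalDerivativeL2 D h := by
  apply Lp.ext
  filter_upwards [hD.normalDerivativeL2_coeFn (contDiff_const (c := c) |>.mul hh),
    hD.normalDerivativeL2_coeFn hh, Lp.coeFn_smul c (normalDerivativeL2 D h)]
    with x h1 h2 h3
  rw [h1, h3, Pi.smul_apply, h2, normalDerivative,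
    fderiv_const_mul (hh.differentiable one_ne_zero x)]
  rfl

theorem normalDerivativeL2_const (hD : IsBoundedLipschitzDomain D) (c : ℂ) :
    normalDerivativeL2 D (fun _ => c) = 0 := by
  apply Lp.ext
  filter_upwards [hD.normalDerivativeL2_coeFn (contDiff_const (c := c)),
    Lp.coeFn_zero ℂ 2 (surfaceMeasure D)] with x h1 h2
  rw [h1, h2, normalDerivative, fderiv_const_apply]
  rfl

theorem normalDerivativeL2_sum (hD : IsBoundedLipschitzDomain D) {ι : Type*} (s : Finset ι)
    {h : ι → E3 → ℂ} (hh : ∀ i ∈ s, ContDiff ℝ 1 (h i)) :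
    normalDerivativeL2 D (fun x => ∑ i ∈ s, h i x) = ∑ i ∈ s, normalDerivativeL2 D (h i) := by
  classical
  induction s using Finset.induction_on with
  | empty => simpa using hD.normalDerivativeL2_const 0
  | insert a s ha ih =>
    simp only [Finset.sum_insert ha]
    rw [hD.normalDerivativeL2_add (hh a (Finset.mem_insert_self a s))
      (ContDiff.sum fun i hi => hh i (Finset.mem_insert_of_mem hi)),
      ih fun i hi => hh i (Finset.mem_insert_of_mem hi)]

/-- The divergence theorem for complex functions. -/
theorem integral_fderiv_complex (hD : IsBoundedLipschitzDomain D) {g : E3 → ℂ}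
    (hg : ContDiff ℝ 1 g) (v : E3) :
    ∫ x in D, fderiv ℝ g x v =
      ∫ x, g x * (inner ℝ v (outwardNormal D x) : ℂ) ∂(surfaceMeasure D) := by
  set u₁ : E3 → ℝ := fun x => (g x).re
  set u₂ : E3 → ℝ := fun x => (g x).im
  have hu₁ : ContDiff ℝ 1 u₁ := Complex.reCLM.contDiff.comp hg
  have hu₂ : ContDiff ℝ 1 u₂ := Complex.imCLM.contDiff.comp hg
  have hgd := hg.differentiable one_ne_zero
  have h1 : ∀ x, fderiv ℝ u₁ x v = (fderiv ℝ g x v).re := fun x => by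
    have : HasFDerivAt u₁ (Complex.reCLM.comp (fderiv ℝ g x)) x :=
      Complex.reCLM.hasFDerivAt.comp x (hgd x).hasFDerivAt
    rw [this.fderiv]; rfl
  have h2 : ∀ x, fderiv ℝ u₂ x v = (fderiv ℝ g x v).im := fun x => by
    have : HasFDerivAt u₂ (Complex.imCLM.comp (fderiv ℝ g x)) x :=
      Complex.imCLM.hasFDerivAt.comp x (hgd x).hasFDerivAt
    rw [this.fderiv]; rfl
  have hi : ∀ {u : E3 → ℝ}, ContDiff ℝ 1 u → IntegrableOn (fun x => fderiv ℝ u x v) D := by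
    intro u hu
    have hc : Continuous fun x => fderiv ℝ u x v :=
      (hu.continuous_fderiv one_ne_zero).clm_apply continuous_const
    exact (hc.continuousOn.integrableOn_compact
      (Metric.isCompact_of_isClosed_isBounded isClosed_closure hD.isBounded.closure)).mono_set
      subset_closure
  have hl : ∀ x, fderiv ℝ g x v =
      ((fderiv ℝ u₁ x v : ℝ) : ℂ) + ((fderiv ℝ u₂ x v : ℝ) : ℂ) * Complex.I := fun x => by
    rw [h1, h2, Complex.re_add_im]
  have hr : ∀ x, g x * (inner ℝ v (outwardNormal D x) : ℂ) =
      ((u₁ x * inner ℝ v (outwardNormal D x) : ℝ) : ℂ) +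
        ((u₂ x * inner ℝ v (outwardNormal D x) : ℝ) : ℂ) * Complex.I := fun x => by
    conv_lhs => rw [← Complex.re_add_im (g x)]
    push_cast
    ring
  simp_rw [hl, hr]
  rw [integral_add (hi hu₁).ofReal ((hi hu₂).ofReal.mul_const _),
    integral_add (hD.integrable_mul_inner_outwardNormal hu₁.continuous v).ofReal
      ((hD.integrable_mul_inner_outwardNormal hu₂.continuous v).ofReal.mul_const _),
    integral_mul_const, integral_mul_const, integral_complex_ofReal, integral_complex_ofReal,
    integral_complex_ofReal, integral_complex_ofReal, hD.integral_fderiv hu₁,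
    hD.integral_fderiv hu₂]

/-- The normal derivative of a harmonic function has mean zero. -/
theorem integral_normalDerivative_eq_zero (hD : IsBoundedLipschitzDomain D) {h : E3 → ℂ}
    (hh : ContDiff ℝ 2 h)
    (hlap : ∀ x, ∑ i : Fin 3, fderiv ℝ (fun y => fderiv ℝ h y (EuclideanSpace.single i 1)) x
      (EuclideanSpace.single i 1) = 0) :
    ∫ x, normalDerivative D h x ∂(surfaceMeasure D) = 0 := by
  have := hD.isFiniteMeasure_surfaceMeasure
  have hd : ∀ i : Fin 3, ContDiff ℝ 1 fun y => fderiv ℝ h y (EuclideanSpace.single i 1) :=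
    fun i => (hh.fderiv_right (m := 1) (by norm_num)).clm_apply contDiff_const
  have hpt : ∀ x, normalDerivative D h x = ∑ i : Fin 3,
      fderiv ℝ h x (EuclideanSpace.single i 1) *
        (inner ℝ (EuclideanSpace.single i 1 : E3) (outwardNormal D x) : ℂ) := fun x =>
    fderiv_apply_eq_sum_single _ _
  simp_rw [hpt]
  rw [integral_finsetSum]
  · rw [Finset.sum_congr rfl fun i _ => (hD.integral_fderiv_complex (hd i) _).symm,
      ← integral_finsetSum]
    · simp_rw [hlap]
      simp
    · intro i _
      have hc : Continuous fun x => fderiv ℝ (fun y => fderiv ℝ h y (EuclideanSpace.single i 1)) x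
          (EuclideanSpace.single i 1 : E3) :=
        ((hd i).continuous_fderiv one_ne_zero).clm_apply continuous_const
      exact (hc.continuousOn.integrableOn_compact
        (Metric.isCompact_of_isClosed_isBounded isClosed_closure hD.isBounded.closure)).mono_set
        subset_closure
  · intro i _
    obtain ⟨C, hC⟩ := hD.isCompact_frontier.exists_bound_of_continuousOn
      (hd i).continuous.continuousOn
    refine Integrable.of_bound (C := C) ?_ ?_
    · have h1 := hD.aemeasurable_outwardNormal
      exact ((hd i).continuous.measurable.aemeasurable.mul
        (Complex.measurable_ofReal.comp_aemeasurable h1.const_inner)).aestronglyMeasurable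
    · filter_upwards [ae_restrict_mem isClosed_frontier.measurableSet] with x hx
      rw [norm_mul, Complex.norm_real]
      refine (mul_le_of_le_one_right (norm_nonneg _) ?_).trans (hC x hx)
      refine (norm_inner_le_norm _ _).trans ?_
      simpa using norm_outwardNormal_le D x

end IsBoundedLipschitzDomain

theorem fderiv_sum_nullForm_pow {ι : Type*} [Fintype ι] (c t : ι → ℂ) (n : ℕ) (x v : E3) :
    fderiv ℝ (fun x => ∑ j, c j * nullForm (t j) x ^ n) x v =
      ∑ j, (c j * n * nullForm (t j) v) * nullForm (t j) x ^ (n - 1) := by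
  have h : ∀ j, HasFDerivAt (fun x => c j * nullForm (t j) x ^ n)
      (c j • ((n * nullForm (t j) x ^ (n - 1)) • nullForm (t j))) x := fun j => by
    have := ((nullForm (t j)).hasFDerivAt (x := x)).pow n
    refine (this.const_mul (c j)).congr_fderiv ?_
    ext v
    simp
  rw [(HasFDerivAt.fun_sum fun j _ => h j).fderiv, sum_apply]
  refine Finset.sum_congr rfl fun j _ => ?_
  simp
  ring

theorem sum_nullForm_single_sq (t : ℂ) :
    ∑ i : Fin 3, nullForm t (EuclideanSpace.single i 1) ^ 2 = 0 := by
  simp only [nullForm_apply, Fin.sum_univ_three]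
  simp
  linear_combination ((t ^ 2 + 1) ^ 2 / 4) * Complex.I_sq

/-- The Laplacian of the n-th power of a linear form contains the sum of squares of its
coefficients, which is zero for an isotropic form. -/
theorem laplacian_solidHarmonic (n : ℕ) (m : Ord n) (x : E3) :
    ∑ i : Fin 3, fderiv ℝ (fun y => fderiv ℝ (solidHarmonic n m) y (EuclideanSpace.single i 1)) x
      (EuclideanSpace.single i 1) = 0 := by
  obtain ⟨c, t, h⟩ := exists_solidHarmonic_eq_sum_nullForm_pow n m
  rw [show solidHarmonic n m = fun x => ∑ j, c j * nullForm (t j) x ^ n from funext h]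
  simp_rw [fderiv_sum_nullForm_pow]
  rw [Finset.sum_comm]
  refine Finset.sum_eq_zero fun j _ => ?_
  have := sum_nullForm_single_sq (t j)
  calc _ = (c j * n * (n - 1 : ℕ) * nullForm (t j) x ^ (n - 1 - 1)) *
        ∑ i : Fin 3, nullForm (t j) (EuclideanSpace.single i 1) ^ 2 := by
        rw [Finset.mul_sum]
        refine Finset.sum_congr rfl fun i _ => ?_
        ring
    _ = 0 := by rw [this, mul_zero]

/-! ### The shifting formula -/

theorem integrable_pairing {D : Set E3} (hD : IsBoundedLipschitzDomain D) {h : E3 → ℂ}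
    (hh : Continuous h) (ψ : L2 D) :
    Integrable (fun y => starRingEnd ℂ (h y) * ψ y) (surfaceMeasure D) := by
  have := hD.isFiniteMeasure_surfaceMeasure
  obtain ⟨C, hC⟩ := hD.isCompact_frontier.exists_bound_of_continuousOn hh.continuousOn
  refine ((Lp.memLp ψ).integrable one_le_two).bdd_mul (c := C)
    (Complex.continuous_conj.comp hh).aestronglyMeasurable ?_
  filter_upwards [ae_restrict_mem isClosed_frontier.measurableSet] with x hx
  simpa using hC x hx

/-- The pairing of a density on `∂D` with a continuous function. -/
def pairing {D : Set E3} (hD : IsBoundedLipschitzDomain D) {h : E3 → ℂ} (hh : Continuous h) :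
    L2 D →ₗ[ℂ] ℂ :=
  { toFun := fun ψ => ∫ y, starRingEnd ℂ (h y) * ψ y ∂(surfaceMeasure D)
    map_add' := fun ψ χ => by
      rw [← integral_add (integrable_pairing hD hh ψ) (integrable_pairing hD hh χ)]
      apply integral_congr_ae
      filter_upwards [Lp.coeFn_add ψ χ] with y hy
      rw [hy, Pi.add_apply, mul_add]
    map_smul' := fun c ψ => by
      rw [RingHom.id_apply, smul_eq_mul, ← integral_const_mul]
      apply integral_congr_ae
      filter_upwards [Lp.coeFn_smul c ψ] with y hy
      rw [hy, Pi.smul_apply, smul_eq_mul]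
      ring }

theorem pairing_apply {D : Set E3} (hD : IsBoundedLipschitzDomain D) {h : E3 → ℂ}
    (hh : Continuous h) (ψ : L2 D) :
    pairing hD hh ψ = ∫ y, starRingEnd ℂ (h y) * ψ y ∂(surfaceMeasure D) := rfl

/-- The resolvent of `K_D^*` preserves densities of mean zero. -/
theorem IsBoundedLipschitzDomain.integral_npResolvent_eq_zero {D : Set E3}
    (hD : IsBoundedLipschitzDomain D) {lam : ℝ} (hlam : 1 / 2 < |lam|) {f : L2 D}
    (hf : ∫ x, f x ∂(surfaceMeasure D) = 0) :
    ∫ x, npResolvent lam D f x ∂(surfaceMeasure D) = 0 := by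
  let mean : L2 D →ₗ[ℂ] ℂ := pairing hD (continuous_const (y := (1 : ℂ)))
  have hmean : ∀ ψ : L2 D, mean ψ = ∫ x, ψ x ∂(surfaceMeasure D) := fun ψ => by
    simp [mean, pairing_apply]
  rw [← hmean] at hf ⊢
  -- c is 1/2 for the genuine operator and 0 for the default one. Either way |λ| > 1/2 excludes λ =
  -- c, which is all that is needed.
  have hK : ∃ c : ℝ, |c| ≤ 1 / 2 ∧ ∀ ψ, mean (npAdjoint D ψ) = c * mean ψ := by
    by_cases h : ∃ T, IsNPAdjoint D T
    · obtain ⟨T, hT⟩ := h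
      refine ⟨1 / 2, by norm_num [abs_of_pos], fun ψ => ?_⟩
      rw [npAdjoint_eq hT, hmean, hmean, hD.integral_npAdjoint hT]
    · refine ⟨0, by norm_num, fun ψ => ?_⟩
      rw [npAdjoint, dif_neg h]
      simp
  obtain ⟨c, hc, hK⟩ := hK
  unfold npResolvent
  set A := (lam : ℂ) • (1 : L2 D →L[ℂ] L2 D) - npAdjoint D
  by_cases hA : IsUnit A
  · set ψ := Ring.inverse A f
    have h1 : A ψ = f := by
      have := congrArg (fun S : L2 D →L[ℂ] L2 D => S f) (Ring.mul_inverse_cancel A hA)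
      exact this
    have h2 : A ψ = (lam : ℂ) • ψ - npAdjoint D ψ := rfl
    have h3 : ((lam - c : ℝ) : ℂ) * mean ψ = 0 := by
      have h4 := congrArg mean (h2.symm.trans h1)
      rw [map_sub, map_smul, hK, hf, smul_eq_mul] at h4
      push_cast
      linear_combination h4
    refine (mul_eq_zero.1 h3).resolve_left ?_
    have : lam - c ≠ 0 := by
      intro h0
      rw [sub_eq_zero.1 h0] at hlam
      linarith
    exact_mod_cast this
  · rw [Ring.inverse_non_unit _ hA]
    simp

theorem contDiff_one_solidHarmonic (n : ℕ) (m : Ord n) : ContDiff ℝ 1 (solidHarmonic n m) :=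
  (contDiff_solidHarmonic n m).of_le (by norm_num)

section Shift

variable {D : Set E3}

theorem integral_npResolvent_solidHarmonic (hD : IsBoundedLipschitzDomain D) {lam : ℝ}
    (hlam : 1 / 2 < |lam|) (n : ℕ) (m : Ord n) :
    ∫ x, npResolvent lam D (normalDerivativeL2 D (solidHarmonic n m)) x ∂(surfaceMeasure D) =
      0 := by
  apply hD.integral_npResolvent_eq_zero hlam
  rw [integral_congr_ae (hD.normalDerivativeL2_coeFn (contDiff_one_solidHarmonic n m))]
  exact hD.integral_normalDerivative_eq_zero (contDiff_solidHarmonic n m)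
    (laplacian_solidHarmonic n m)

theorem normalDerivativeL2_solidHarmonic_zero (hD : IsBoundedLipschitzDomain D) (m : Ord 0) :
    normalDerivativeL2 D (solidHarmonic 0 m) = 0 := by
  have hm : (m : ℤ) = 0 := by
    have := Finset.mem_Icc.1 m.2
    simp only [Nat.cast_zero, neg_zero] at this
    omega
  rw [hm, show solidHarmonic 0 0 = fun _ => ((1 / Real.sqrt (4 * Real.pi) : ℝ) : ℂ) from
    funext solidHarmonic_zero_zero]
  exact hD.normalDerivativeL2_const _

theorem normalDerivativeL2_solidHarmonic_shift (hD : IsBoundedLipschitzDomain D) (z : E3) (n : ℕ)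
    (m : Ord n) :
    normalDerivativeL2 D (fun x => solidHarmonic n m (x + z)) =
      ∑ ν ∈ Finset.Icc 1 n, ∑ μ : Ord ν,
        shiftMatrix n ν z m μ • normalDerivativeL2 D (solidHarmonic ν μ) := by
  simp_rw [solidHarmonic_add n m _ z]
  have hd : ∀ ν, ∀ μ : Ord ν,
      ContDiff ℝ 1 (fun x => shiftMatrix n ν z m μ * solidHarmonic ν μ x) := fun ν μ =>
    contDiff_const.mul (contDiff_one_solidHarmonic ν μ)
  rw [hD.normalDerivativeL2_sum _ fun ν _ => ContDiff.sum fun μ _ => hd ν μ,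
    Finset.sum_congr rfl fun ν _ => hD.normalDerivativeL2_sum _ fun μ _ => hd ν μ,
    Finset.sum_congr rfl fun ν _ => Finset.sum_congr rfl fun μ _ =>
      hD.normalDerivativeL2_const_mul (contDiff_one_solidHarmonic ν μ) _,
    -- Split off degree ν = 0, a constant function with zero normal derivative, so that the sum
    -- starts at 1.
    Finset.range_eq_Ico, Finset.sum_eq_sum_Ico_succ_bot (Nat.succ_pos n)]
  rw [Finset.sum_eq_zero fun μ _ => by rw [normalDerivativeL2_solidHarmonic_zero hD, smul_zero],
    zero_add]
  rfl

/-- The degree-zero term of the addition theorem pairs ψ with a constant; the mean-zero assumption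
removes it, so the sum starts at 1. -/
theorem integral_conj_solidHarmonic_shift (hD : IsBoundedLipschitzDomain D) (z : E3) (l : ℕ)
    (k : Ord l) {ψ : L2 D} (hψ : ∫ y, ψ y ∂(surfaceMeasure D) = 0) :
    ∫ y, starRingEnd ℂ (solidHarmonic l k (y + z)) * ψ y ∂(surfaceMeasure D) =
      ∑ i ∈ Finset.Icc 1 l, ∑ j : Ord i, starRingEnd ℂ (shiftMatrix l i z k j) *
        ∫ y, starRingEnd ℂ (solidHarmonic i j y) * ψ y ∂(surfaceMeasure D) := by
  have hint : ∀ i, ∀ j : Ord i, Integrable (fun y => starRingEnd ℂ (shiftMatrix l i z k j) *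
      (starRingEnd ℂ (solidHarmonic i j y) * ψ y)) (surfaceMeasure D) := fun i j =>
    (integrable_pairing hD (contDiff_solidHarmonic i j).continuous ψ).const_mul _
  have h1 : ∀ y, starRingEnd ℂ (solidHarmonic l k (y + z)) * ψ y =
      ∑ i ∈ Finset.range (l + 1), ∑ j : Ord i, starRingEnd ℂ (shiftMatrix l i z k j) *
        (starRingEnd ℂ (solidHarmonic i j y) * ψ y) := fun y => by
    simp_rw [solidHarmonic_add l k _ z, map_sum, map_mul, Finset.sum_mul, mul_assoc]
  simp_rw [h1]
  rw [integral_finsetSum _ fun i _ => integrable_finsetSum _ fun j _ => hint i j,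
    Finset.sum_congr rfl fun i _ => integral_finsetSum _ fun j _ => hint i j,
    Finset.sum_congr rfl fun i _ => Finset.sum_congr rfl fun j _ => integral_const_mul _ _,
    Finset.range_eq_Ico, Finset.sum_eq_sum_Ico_succ_bot (Nat.succ_pos l)]
  rw [Finset.sum_eq_zero, zero_add]
  · rfl
  · intro j _
    have hj : (j : ℤ) = 0 := by
      have := Finset.mem_Icc.1 j.2
      simp only [Nat.cast_zero, neg_zero] at this
      omega
    rw [hj]
    simp_rw [solidHarmonic_zero_zero]
    rw [integral_const_mul, hψ, mul_zero, mul_zero]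

theorem cgptMatrix_shift (hD : IsBoundedLipschitzDomain D) {lam : ℝ}
    (hlam : 1 / 2 < |lam|) (z : E3) (l n : ℕ) :
    cgptMatrix lam (shift z D) l n =
      ∑ i ∈ Finset.Icc 1 l, ∑ ν ∈ Finset.Icc 1 n,
        (shiftMatrix l i z).map (starRingEnd ℂ) * cgptMatrix lam D i ν *
          (shiftMatrix n ν z).transpose := by
  ext k m
  let ψ : ∀ ν, Ord ν → L2 D := fun ν μ =>
    npResolvent lam D (normalDerivativeL2 D (solidHarmonic ν μ))
  have hψ0 : ∀ ν, ∀ μ : Ord ν, ∫ y, ψ ν μ y ∂(surfaceMeasure D) = 0 := fun ν μ =>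
    integral_npResolvent_solidHarmonic hD hlam ν μ
  have hcont : Continuous fun y => solidHarmonic l k (y + z) :=
    (contDiff_solidHarmonic l k).continuous.comp (continuous_id.add continuous_const)
  have hres : npResolvent lam D (normalDerivativeL2 D fun x => solidHarmonic n m (x + z)) =
      ∑ ν ∈ Finset.Icc 1 n, ∑ μ : Ord ν, shiftMatrix n ν z m μ • ψ ν μ := by
    rw [normalDerivativeL2_solidHarmonic_shift hD]
    simp only [map_sum, map_smul, ψ]
  have hL : cgptMatrix lam (shift z D) l n k m =
      ∑ ν ∈ Finset.Icc 1 n, ∑ μ : Ord ν, shiftMatrix n ν z m μ *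
        ∑ i ∈ Finset.Icc 1 l, ∑ j : Ord i, starRingEnd ℂ (shiftMatrix l i z k j) *
          cgptMatrix lam D i ν j μ := by
    change cgpt lam (shift z D) n m l k = _
    rw [cgpt_shift, ← pairing_apply hD hcont, hres]
    simp only [map_sum, map_smul, smul_eq_mul]
    refine Finset.sum_congr rfl fun ν _ => Finset.sum_congr rfl fun μ _ => ?_
    rw [pairing_apply, integral_conj_solidHarmonic_shift hD z l k (hψ0 ν μ)]
    rfl
  rw [hL]
  simp only [Matrix.sum_apply, Matrix.mul_apply, Matrix.transpose_apply, Matrix.map_apply]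
  rw [Finset.sum_comm]
  refine Finset.sum_congr rfl fun ν _ => ?_
  simp_rw [Finset.mul_sum, Finset.sum_mul]
  rw [Finset.sum_comm]
  refine Finset.sum_congr rfl fun i _ => Finset.sum_congr rfl fun μ _ =>
    Finset.sum_congr rfl fun j _ => ?_
  ring

end Shift

end CGPT

end

theorem mainTheorem4 (D : Set CGPT.E3) (hD : CGPT.IsBoundedLipschitzDomain D)
    (lam : ℝ) (hlam : 1 / 2 < |lam|) (z : CGPT.E3) :
    (∀ l n : ℕ, 0 < l → 0 < n →
      CGPT.cgptMatrix lam (CGPT.shift z D) l n =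
        ∑ i ∈ Finset.Icc 1 l, ∑ ν ∈ Finset.Icc 1 n,
          (CGPT.shiftMatrix l i z).map (starRingEnd ℂ) * CGPT.cgptMatrix lam D i ν *
            (CGPT.shiftMatrix n ν z).transpose) ∧
    (∀ n : ℕ, CGPT.shiftMatrix n n z = 1) := by
  exact ⟨fun l n _ _ => CGPT.cgptMatrix_shift hD hlam z l n,
    fun n => CGPT.shiftMatrix_self n z⟩
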